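/- Let $\pi:Y\to X$ be a smooth fibre bundle (or, more generally, a fibred manifold: a smooth surjection such that every point of $Y$ lies in an adapted chart), with $\dim X=n$ and $\dim Y=n+m$. Let $r\ge 0$, let $J^rY$ be the bundle of $r$-jets of local sections of $\pi$, with projections $\pi^{r}:J^{r}Y\to X$ and $\pi^{r+1,r}:J^{r+1}Y\to J^rY$, and let $\rho$ be a smooth $q$-form on $J^rY$ with $q\ge n+1$. For $\xi\in T_{j^{r+1}_x\gamma}J^{r+1}Y$ put $h\xi=(j^r\gamma)_{*,x}(\pi^{r+1})_*\xi$ and $p\xi=(\pi^{r+1,r})_*\xi-h\xi$. The contact component of order $k$ of $\rho$ is the $q$-form on $J^{r+1}Y$ $$p_k\rho(j^{r+1}_x\gamma)(\xi_1,\dots,\xi_q)=\frac1{k!\,(q-k)!}\sum_{\tau\in S_q}\operatorname{sgn}(\tau)\,\rho(j^r_x\gamma)\bigl(p\xi_{\tau(1)},\dots,p\xi_{\tau(k)},h\xi_{\tau(k+1)},\dots,h\xi_{\tau(q)}\bigr).$$ The form $\rho$ is called strongly contact if $p_{q-n}\rho=0$. Let $(V,\psi)$, $\psi=(x^i,y^\sigma)$,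 be an adapted chart on $Y$, let $(V^r,\psi^r)$, $\psi^r=(x^i,y^\sigma_J)_{|J|\le r}$, be the associated chart on $J^rY$ ($J$ runs over symmetric multi-indices in $\{1,\dots,n\}$), and put $\omega^\sigma_J=dy^\sigma_J-\sum_i y^\sigma_{Ji}\,dx^i$ for $|J|\le r-1$. Then $p_{q-n}\rho=0$ on $V^{r+1}$ if and only if, on $V^r$, $$\rho=\sum_{\substack{p+s=q-n+1\\ 0\le s\le n-1}}\ \sum_{\substack{|J_1|,\dots,|J_p|\le r-1\\ \sigma_1,\dots,\sigma_p}}\ \sum_{\substack{|I_1|=\dots=|I_s|=r-1\\ \nu_1,\dots,\nu_s}}\omega^{\sigma_1}_{J_1}\wedge\dots\wedge\omega^{\sigma_p}_{J_p}\wedge d\omega^{\nu_1}_{I_1}\wedge\dots\wedge d\omega^{\nu_s}_{I_s}\wedge\Phi^{J_1,\dots,J_p,I_1,\dots,I_s}_{\sigma_1,\dots,\sigma_p,\nu_1,\dots,\nu_s}$$ for some smooth $(n-1-s)$-forms $\Phi^{J_1,\dots,J_p,I_1,\dots,I_s}_{\sigma_1,\dots,\sigma_p,\nu_1,\dots,\nu_s}$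 on $V^r$. Consequently, $\rho$ is strongly contact if and only if it has such an expression in the associated chart of every adapted chart on $Y$. -/

import Mathlib

open scoped Manifold ContDiff

noncomputable section

namespace JetForms

/-! ### Exterior products of alternating forms -/

section Wedge

variable {E : Type*} [NormedAddCommGroup E] [NormedSpace ℝ E]

/-- The algebraic exterior product of two alternating forms, with values in an alternating map. -/
def algWedge {a b c : ℕ} (h : a + b = c) (α : E [⋀^Fin a]→L[ℝ] ℝ) (β : E [⋀^Fin b]→L[ℝ] ℝ) :
    E [⋀^Fin c]→ₗ[ℝ] ℝ :=
  ((LinearMap.mul' ℝ ℝ).compAlternatingMap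
    (α.toAlternatingMap.domCoprod β.toAlternatingMap)).domDomCongr
      (finSumFinEquiv.trans (finCongr h))

theorem continuous_algWedge {a b c : ℕ} (h : a + b = c) (α : E [⋀^Fin a]→L[ℝ] ℝ)
    (β : E [⋀^Fin b]→L[ℝ] ℝ) : Continuous (fun v => algWedge h α β v) := by
  have key : ∀ τ : Equiv.Perm.ModSumCongr (Fin a) (Fin b),
      Continuous (fun v : Fin c → E => (LinearMap.mul' ℝ ℝ)
        (AlternatingMap.domCoprod.summand α.toAlternatingMap β.toAlternatingMap τ
          (fun i => v ((finSumFinEquiv.trans (finCongr h)) i)))) := by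
    intro τ
    induction τ using Quotient.inductionOn' with
    | h τ =>
      have hα : Continuous fun v : Fin c → E =>
          α (fun i => v (finCongr h (finSumFinEquiv (τ (Sum.inl i))))) :=
        α.cont.comp (continuous_pi fun i => continuous_apply _)
      have hβ : Continuous fun v : Fin c → E =>
          β (fun i => v (finCongr h (finSumFinEquiv (τ (Sum.inr i))))) :=
        β.cont.comp (continuous_pi fun i => continuous_apply _)
      rcases Int.units_eq_one_or (Equiv.Perm.sign τ) with hs | hs
      · simpa [AlternatingMap.domCoprod.summand_mk'', hs, Pi.mul_def, Pi.neg_def] using hα.mul hβ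
      · simpa [AlternatingMap.domCoprod.summand_mk'', hs, Pi.mul_def, Pi.neg_def] using (hα.mul hβ).neg
  have hsum : (fun v : Fin c → E => algWedge h α β v) = fun v =>
      ∑ τ : Equiv.Perm.ModSumCongr (Fin a) (Fin b), (LinearMap.mul' ℝ ℝ)
        (AlternatingMap.domCoprod.summand α.toAlternatingMap β.toAlternatingMap τ
          (fun i => v ((finSumFinEquiv.trans (finCongr h)) i))) := by
    funext v
    simp [algWedge, AlternatingMap.domCoprod_apply, Function.comp_def]
  rw [hsum]
  exact continuous_finsetSum _ fun τ _ => key τ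

/-- The exterior product `α ∧ β`, i.e. the sum of
`sign τ * α (v ∘ τ ∘ inl) * β (v ∘ τ ∘ inr)` over the shuffles `τ`.
The degree `c` of the result is only required to be propositionally equal to `a + b`. -/
def wedge {a b c : ℕ} (h : a + b = c) (α : E [⋀^Fin a]→L[ℝ] ℝ) (β : E [⋀^Fin b]→L[ℝ] ℝ) :
    E [⋀^Fin c]→L[ℝ] ℝ :=
  { algWedge h α β with cont := continuous_algWedge h α β }

/-- Transport of an alternating form along an equality of degrees. -/
def castDeg {a b : ℕ} (h : a = b) (α : E [⋀^Fin a]→L[ℝ] ℝ) : E [⋀^Fin b]→L[ℝ] ℝ := h ▸ α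

/-- `α 0 ∧ (α 1 ∧ ( ⋯ ∧ (α (s - 1) ∧ η)))`. -/
def iterWedge {e d : ℕ} : (s : ℕ) → (Fin s → E [⋀^Fin e]→L[ℝ] ℝ) → E [⋀^Fin d]→L[ℝ] ℝ →
    E [⋀^Fin (s * e + d)]→L[ℝ] ℝ
  | 0, _, η => castDeg (by simp) η
  | s + 1, α, η => wedge (by ring) (α 0) (iterWedge s (fun i => α i.succ) η)

end Wedge

/-! ### Coordinates on jets -/

/-- Symmetric multi-indices `J = {j₁ ≤ ⋯ ≤ j_k}` in `{1, …, n}` of length `k = |J| ≤ r`. -/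
abbrev MultiIdx (n r : ℕ) : Type := {J : Multiset (Fin n) // Multiset.card J ≤ r}

/-- Multi-indices with `|J| ≤ r - 1` (none if `r = 0`). -/
abbrev LowIdx (n r : ℕ) : Type := {J : Multiset (Fin n) // Multiset.card J < r}

/-- Multi-indices with `|I| = r - 1` (none if `r = 0`). -/
abbrev TopIdx (n r : ℕ) : Type := {I : Multiset (Fin n) // Multiset.card I + 1 = r}

instance finite_multiIdx (n r : ℕ) : Finite (MultiIdx n r) := by
  let f : (Σ k : Fin (r + 1), Sym (Fin n) k) → MultiIdx n r := fun p =>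
    ⟨p.2.1, by rw [p.2.2]; exact Nat.lt_succ_iff.mp p.1.2⟩
  exact Finite.of_surjective f fun J =>
    ⟨⟨⟨Multiset.card J.1, Nat.lt_succ_iff.mpr J.2⟩, ⟨J.1, rfl⟩⟩, rfl⟩

instance finite_lowIdx (n r : ℕ) : Finite (LowIdx n r) :=
  Finite.of_injective (fun J => (⟨J.1, J.2.le⟩ : MultiIdx n r)) fun _ _ h =>
    Subtype.ext (Subtype.mk.inj h)

instance finite_topIdx (n r : ℕ) : Finite (TopIdx n r) :=
  Finite.of_injective (fun J => (⟨J.1, (Nat.le_succ _).trans J.2.le⟩ : MultiIdx n r)) fun _ _ h =>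
    Subtype.ext (Subtype.mk.inj h)

instance fintypeMultiIdx (n r : ℕ) : Fintype (MultiIdx n r) := Fintype.ofFinite _

instance fintypeLowIdx (n r : ℕ) : Fintype (LowIdx n r) := Fintype.ofFinite _

instance fintypeTopIdx (n r : ℕ) : Fintype (TopIdx n r) := Fintype.ofFinite _

/-- A contact index `J`, seen as an index of a jet coordinate. -/
def LowIdx.toIdx {n r : ℕ} (J : LowIdx n r) : MultiIdx n r := ⟨J.1, J.2.le⟩

/-- The index `Ji` (`= iJ`) obtained by adding `i` to `J`. -/
def LowIdx.cons {n r : ℕ} (i : Fin n) (J : LowIdx n r) : MultiIdx n r :=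
  ⟨i ::ₘ J.1, by rw [Multiset.card_cons]; exact J.2⟩

/-- The index `I`, `|I| = r - 1`, as one of the indices with `|J| ≤ r - 1`. -/
def TopIdx.toLow {n r : ℕ} (I : TopIdx n r) : LowIdx n r := ⟨I.1, Nat.lt_of_succ_le I.2.le⟩

/-- The space in which the associated charts `(x^i, y^σ_J)`, `|J| ≤ r`, of the `r`-jet bundle take
their values: `z.1 i` is `x^i` and `z.2 (σ, J)` is `y^σ_J` (with `y^σ` for `J = 0`). -/
abbrev JetCoord (n m r : ℕ) : Type :=
  EuclideanSpace ℝ (Fin n) × (Fin m × MultiIdx n r → ℝ)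

/-- The partial derivative `∂f/∂x^i`. -/
def partialD {n : ℕ} (i : Fin n) (f : EuclideanSpace ℝ (Fin n) → ℝ) :
    EuclideanSpace ℝ (Fin n) → ℝ :=
  fun a => fderiv ℝ f a (EuclideanSpace.single i 1)

/-- The partial derivative `∂^k f / ∂x^{j₁} ⋯ ∂x^{j_k}` for `J = {j₁ ≤ ⋯ ≤ j_k}`. -/
def partialDs {n : ℕ} (J : Multiset (Fin n)) (f : EuclideanSpace ℝ (Fin n) → ℝ) :
    EuclideanSpace ℝ (Fin n) → ℝ :=
  (J.sort (· ≤ ·)).foldr partialD f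

/-- The `r`-extension `a ↦ j^r_a g` of `g : ℝⁿ → ℝᵐ`, in coordinates. -/
def jetLift {n m : ℕ} (r : ℕ) (g : EuclideanSpace ℝ (Fin n) → EuclideanSpace ℝ (Fin m))
    (a : EuclideanSpace ℝ (Fin n)) : JetCoord n m r :=
  (a, fun p => partialDs p.2.1 (fun b => g b p.1) a)

/-- The projection `π^{r+1,r}` in associated charts. It is linear, hence also its own tangent
map. -/
def jetProj (n m r : ℕ) : JetCoord n m (r + 1) →L[ℝ] JetCoord n m r :=
  (ContinuousLinearMap.fst ℝ _ _).prod
    (ContinuousLinearMap.pi fun p : Fin m × MultiIdx n r =>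
      (ContinuousLinearMap.proj (R := ℝ) (φ := fun _ : Fin m × MultiIdx n (r + 1) => ℝ)
        (p.1, ⟨p.2.1, p.2.2.trans (Nat.le_succ r)⟩)).comp (ContinuousLinearMap.snd ℝ _ _))

/-- The contact form `ω^σ_J = dy^σ_J - ∑ i, y^σ_{Ji} dx^i`, `|J| ≤ r - 1`, as a differential
`1`-form on the coordinate space. -/
def omega {n m r : ℕ} (σ : Fin m) (J : LowIdx n r) (z : JetCoord n m r) :
    JetCoord n m r [⋀^Fin 1]→L[ℝ] ℝ :=
  ContinuousAlternatingMap.ofSubsingleton ℝ (JetCoord n m r) ℝ (0 : Fin 1)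
    ((ContinuousLinearMap.proj (R := ℝ) (φ := fun _ : Fin m × MultiIdx n r => ℝ)
        (σ, J.toIdx)).comp (ContinuousLinearMap.snd ℝ _ _) -
      ∑ i : Fin n, z.2 (σ, J.cons i) •
        (EuclideanSpace.proj (𝕜 := ℝ) i).comp (ContinuousLinearMap.fst ℝ _ _))

/-! ### Fibred manifolds, sections and jets -/

section Jets

variable {n m : ℕ} {X Y : Type*} [TopologicalSpace X] [TopologicalSpace Y]
  [ChartedSpace (EuclideanSpace ℝ (Fin n)) X] [ChartedSpace (EuclideanSpace ℝ (Fin (n + m))) Y]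

/-- An adapted chart `(V, ψ)`, `ψ = (x^i, y^σ)`, of `π : Y → X`: a smooth chart `toY` of `Y` with
domain `V` and a smooth chart `toX` of `X` with domain `π(V)` in which `π` is `(x, y) ↦ x`. -/
structure AdaptedChart (n m : ℕ) {X Y : Type*} [TopologicalSpace X] [TopologicalSpace Y]
    [ChartedSpace (EuclideanSpace ℝ (Fin n)) X]
    [ChartedSpace (EuclideanSpace ℝ (Fin (n + m))) Y] (π : Y → X) where
  toY : OpenPartialHomeomorph Y (EuclideanSpace ℝ (Fin n) × EuclideanSpace ℝ (Fin m))
  toX : OpenPartialHomeomorph X (EuclideanSpace ℝ (Fin n))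
  smooth_toY : ContMDiffOn (𝓡 (n + m))
    𝓘(ℝ, EuclideanSpace ℝ (Fin n) × EuclideanSpace ℝ (Fin m)) ∞ toY toY.source
  smooth_toY_symm : ContMDiffOn 𝓘(ℝ, EuclideanSpace ℝ (Fin n) × EuclideanSpace ℝ (Fin m))
    (𝓡 (n + m)) ∞ toY.symm toY.target
  smooth_toX : ContMDiffOn (𝓡 n) (𝓡 n) ∞ toX toX.source
  smooth_toX_symm : ContMDiffOn (𝓡 n) (𝓡 n) ∞ toX.symm toX.target
  source_toX : toX.source = π '' toY.source
  fst_toY : ∀ y ∈ toY.source, (toY y).1 = toX (π y)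

/-- `π : Y → X` is a fibred manifold: a smooth surjection such that every point of `Y` lies in an
adapted chart. Every smooth fibre bundle is one. -/
structure IsFibredManifold (n m : ℕ) {X Y : Type*} [TopologicalSpace X] [TopologicalSpace Y]
    [ChartedSpace (EuclideanSpace ℝ (Fin n)) X]
    [ChartedSpace (EuclideanSpace ℝ (Fin (n + m))) Y] (π : Y → X) : Prop where
  smooth : ContMDiff (𝓡 (n + m)) (𝓡 n) ∞ π
  surjective : Function.Surjective π
  exists_chart : ∀ y : Y, ∃ ψ : AdaptedChart n m π, y ∈ ψ.toY.source

/-- A smooth local section of `π`, defined on the open set `dom` (values outside `dom` are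
irrelevant). -/
structure LocalSection (n m : ℕ) {X Y : Type*} [TopologicalSpace X] [TopologicalSpace Y]
    [ChartedSpace (EuclideanSpace ℝ (Fin n)) X]
    [ChartedSpace (EuclideanSpace ℝ (Fin (n + m))) Y] (π : Y → X) where
  toFun : X → Y
  dom : Set X
  isOpen_dom : IsOpen dom
  smooth : ContMDiffOn (𝓡 n) (𝓡 (n + m)) ∞ toFun dom
  section_eq : ∀ x ∈ dom, π (toFun x) = x

/-- A local section together with a point of its domain. -/
abbrev PointedSection (n m : ℕ) {X Y : Type*} [TopologicalSpace X] [TopologicalSpace Y]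
    [ChartedSpace (EuclideanSpace ℝ (Fin n)) X]
    [ChartedSpace (EuclideanSpace ℝ (Fin (n + m))) Y] (π : Y → X) :=
  {p : LocalSection n m π × X // p.2 ∈ p.1.dom}

variable {π : Y → X}

/-- The value `γ(x)`. -/
def PointedSection.value (p : PointedSection n m π) : Y := p.1.1.toFun p.1.2

/-- The local representative `y ∘ γ ∘ φ⁻¹` of a section in an adapted chart. -/
def AdaptedChart.rep (ψ : AdaptedChart n m π) (γ : LocalSection n m π)
    (a : EuclideanSpace ℝ (Fin n)) : EuclideanSpace ℝ (Fin m) :=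
  (ψ.toY (γ.toFun (ψ.toX.symm a))).2

/-- The coordinates `x^i(x)`, `y^σ_J = ∂_J (y^σ ∘ γ ∘ φ⁻¹) (φ(x))`, `|J| ≤ r`, of a section at a
point in an adapted chart. -/
def AdaptedChart.sectionCoord (ψ : AdaptedChart n m π) (r : ℕ) (p : PointedSection n m π) :
    JetCoord n m r :=
  jetLift r (ψ.rep p.1.1) (ψ.toX p.1.2)

/-- Two sections have the same `r`-jet at `x`: they have the same value there, and the same partial
derivatives up to order `r` in the adapted charts around this value. -/
def jetSetoid (r : ℕ) (π : Y → X) : Setoid (PointedSection n m π) where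
  r p p' := p.1.2 = p'.1.2 ∧ p.value = p'.value ∧
    ∀ ψ : AdaptedChart n m π, p.value ∈ ψ.toY.source → ψ.sectionCoord r p = ψ.sectionCoord r p'
  iseqv :=
    { refl := fun _ => ⟨rfl, rfl, fun _ _ => rfl⟩
      symm := fun h => ⟨h.1.symm, h.2.1.symm, fun ψ hψ => (h.2.2 ψ (h.2.1 ▸ hψ)).symm⟩
      trans := fun h h' => ⟨h.1.trans h'.1, h.2.1.trans h'.2.1, fun ψ hψ =>
        (h.2.2 ψ hψ).trans (h'.2.2 ψ (h.2.1 ▸ hψ))⟩ }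

/-- The set `J^r Y` of `r`-jets `j^r_x γ` of local sections of `π`. -/
def Jet (n m r : ℕ) {X Y : Type*} [TopologicalSpace X] [TopologicalSpace Y]
    [ChartedSpace (EuclideanSpace ℝ (Fin n)) X]
    [ChartedSpace (EuclideanSpace ℝ (Fin (n + m))) Y] (π : Y → X) :=
  Quotient (jetSetoid (n := n) (m := m) r π)

/-- The jet `j^r_x γ`. -/
def Jet.mk (r : ℕ) (p : PointedSection n m π) : Jet n m r π :=
  Quotient.mk (jetSetoid (n := n) (m := m) r π) p

/-- The projection `π^{r,0} : J^r Y → Y`. -/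
def Jet.target {r : ℕ} : Jet n m r π → Y :=
  Quotient.lift PointedSection.value fun _ _ h => h.2.1

/-- The domain `V^r = (π^{r,0})⁻¹(V)` of the associated chart. -/
def AdaptedChart.jetSource (ψ : AdaptedChart n m π) (r : ℕ) : Set (Jet n m r π) :=
  {j | j.target ∈ ψ.toY.source}

open Classical in
/-- The associated chart map `ψ^r` on `V^r` (with the value `0` outside `V^r`). -/
def AdaptedChart.jetChart (ψ : AdaptedChart n m π) (r : ℕ) : Jet n m r π → JetCoord n m r :=
  Quotient.lift
    (fun p : PointedSection n m π => if p.value ∈ ψ.toY.source then ψ.sectionCoord r p else 0)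
    (by
      intro p p' h
      by_cases hp : p.value ∈ ψ.toY.source
      · have hp' : p'.value ∈ ψ.toY.source := h.2.1 ▸ hp
        simp only [hp, hp', if_true]
        exact h.2.2 ψ hp
      · have hp' : p'.value ∉ ψ.toY.source := h.2.1 ▸ hp
        simp only [hp, hp', if_false])

/-- The image `ψ^r(V^r)` of the associated chart. -/
def AdaptedChart.jetTarget (ψ : AdaptedChart n m π) (r : ℕ) : Set (JetCoord n m r) :=
  ψ.jetChart r '' ψ.jetSource r

/-! ### Differential forms on jet bundles -/

/-- A smooth differential `q`-form on `J^r Y`, given by its representatives in the associated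
charts: `rep ψ` is a smooth form on `ψ^r(V^r)`, and on overlaps `rep ψ` is the pull-back of
`rep ψ'` by the transition map `T = ψ'^r ∘ (ψ^r)⁻¹`. -/
structure JetForm (n m r q : ℕ) {X Y : Type*} [TopologicalSpace X] [TopologicalSpace Y]
    [ChartedSpace (EuclideanSpace ℝ (Fin n)) X]
    [ChartedSpace (EuclideanSpace ℝ (Fin (n + m))) Y] (π : Y → X) where
  rep : AdaptedChart n m π → JetCoord n m r → JetCoord n m r [⋀^Fin q]→L[ℝ] ℝ
  smooth : ∀ ψ, ContDiffOn ℝ ∞ (rep ψ) (ψ.jetTarget r)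
  compatible : ∀ (ψ ψ' : AdaptedChart n m π) (T : JetCoord n m r → JetCoord n m r),
    (∀ j ∈ ψ.jetSource r ∩ ψ'.jetSource r, T (ψ.jetChart r j) = ψ'.jetChart r j) →
    ∀ j ∈ ψ.jetSource r ∩ ψ'.jetSource r,
      rep ψ (ψ.jetChart r j) = (rep ψ' (ψ'.jetChart r j)).compContinuousLinearMap
        (fderiv ℝ T (ψ.jetChart r j))

/-- The horizontalization `h = (j^r γ)_{*,x} ∘ (π^{r+1})_*` at `j^{r+1}_x γ`, in associated
charts. -/
def AdaptedChart.horizontal (ψ : AdaptedChart n m π) (r : ℕ) (p : PointedSection n m π) :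
    JetCoord n m (r + 1) →L[ℝ] JetCoord n m r :=
  (fderiv ℝ (jetLift r (ψ.rep p.1.1)) (ψ.toX p.1.2)).comp (ContinuousLinearMap.fst ℝ _ _)

/-- The map `p = (π^{r+1,r})_* - h` at `j^{r+1}_x γ`, in associated charts. -/
def AdaptedChart.vertical (ψ : AdaptedChart n m π) (r : ℕ) (p : PointedSection n m π) :
    JetCoord n m (r + 1) →L[ℝ] JetCoord n m r :=
  jetProj n m r - ψ.horizontal r p

/-- The contact component of order `k` at `j^{r+1}_x γ`, in the associated charts of `ψ`:
`(p_k ρ)(j^{r+1}_x γ)(ξ₁, …, ξ_q) = (1 / (k! (q-k)!)) ∑ τ, sign τ *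
ρ(j^r_x γ)(p ξ_{τ 1}, …, p ξ_{τ k}, h ξ_{τ (k+1)}, …, h ξ_{τ q})`. -/
def JetForm.contactComponent {r q : ℕ} (ρ : JetForm n m r q π) (k : ℕ) (ψ : AdaptedChart n m π)
    (p : PointedSection n m π) (ξ : Fin q → JetCoord n m (r + 1)) : ℝ :=
  (1 / ((k.factorial : ℝ) * ((q - k).factorial : ℝ))) *
    ∑ τ : Equiv.Perm (Fin q), ((Equiv.Perm.sign τ : ℤ) : ℝ) *
      ρ.rep ψ (ψ.jetChart r (Jet.mk r p)) (fun i : Fin q =>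
        if (i : ℕ) < k then ψ.vertical r p (ξ (τ i)) else ψ.horizontal r p (ξ (τ i)))

/-- `p_{q-n} ρ = 0` on `V^{r+1}`, for the adapted chart `(V, ψ)`. -/
def JetForm.IsStronglyContactOn {r q : ℕ} (ρ : JetForm n m r q π) (ψ : AdaptedChart n m π) :
    Prop :=
  ∀ p : PointedSection n m π, p.value ∈ ψ.toY.source → ∀ ξ : Fin q → JetCoord n m (r + 1),
    ρ.contactComponent (q - n) ψ p ξ = 0

/-- `ρ` is a strongly contact form: `p_{q-n} ρ = 0` on `J^{r+1} Y`. -/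
def JetForm.IsStronglyContact {r q : ℕ} (ρ : JetForm n m r q π) : Prop :=
  ∀ ψ : AdaptedChart n m π, ρ.IsStronglyContactOn ψ

theorem degree_eq {n q p s : ℕ} (hq : n + 1 ≤ q) (hps : p + s = q - n + 1) (hs : s < n) :
    p * 1 + (s * 2 + (n - 1 - s)) = q := by
  omega

/-- On `V^r`, the form `ρ` is the sum over `p + s = q - n + 1` (with `s ≤ n - 1`),
`|J_1|, …, |J_p| ≤ r - 1`, `|I_1|, …, |I_s| = r - 1` and `σ_1, …, σ_p`, `ν_1, …, ν_s` of
`ω^{σ_1}_{J_1} ∧ ⋯ ∧ ω^{σ_p}_{J_p} ∧ dω^{ν_1}_{I_1} ∧ ⋯ ∧ dω^{ν_s}_{I_s} ∧ Φ`,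
where the `Φ` are smooth `(n-1-s)`-forms on `V^r` depending on all these indices. -/
def JetForm.HasContactExpression {r q : ℕ} (hq : n + 1 ≤ q) (ρ : JetForm n m r q π)
    (ψ : AdaptedChart n m π) : Prop :=
  ∃ Φ : ∀ p s : ℕ, (Fin p → Fin m × LowIdx n r) → (Fin s → Fin m × TopIdx n r) →
      JetCoord n m r → JetCoord n m r [⋀^Fin (n - 1 - s)]→L[ℝ] ℝ,
    (∀ p s J I, ContDiffOn ℝ ∞ (Φ p s J I) (ψ.jetTarget r)) ∧
    ∀ z ∈ ψ.jetTarget r,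
      ρ.rep ψ z =
        ∑ ps : {ps : ℕ × ℕ // ps ∈ (Finset.HasAntidiagonal.antidiagonal (q - n + 1)).filter (fun ps => ps.2 < n)},
        ∑ J : Fin ps.1.1 → Fin m × LowIdx n r, ∑ I : Fin ps.1.2 → Fin m × TopIdx n r,
          castDeg
            (degree_eq hq (Finset.HasAntidiagonal.mem_antidiagonal.mp (Finset.mem_filter.mp ps.2).1)
              (Finset.mem_filter.mp ps.2).2)
            (iterWedge ps.1.1 (fun a => omega (J a).1 (J a).2 z)
              (iterWedge ps.1.2 (fun b => extDeriv (omega (I b).1 (I b).2.toLow) z)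
                (Φ ps.1.1 ps.1.2 J I z)))

end Jets

end JetForms

end

/-!
The statement is pointwise in the jet `z`, apart from the smoothness of the coefficients.

**Reduction to multilinear algebra.** Put `k = q - n`. By alternation, the contact component of
order `k` vanishes at all `(r+1)`-jets over `z` if and only if `ρ_z` vanishes whenever its first `k`
arguments are vertical and the others lie in one holonomic plane, i.e. in the span of the total
derivatives `D_i = ∂_i + ∑ y^σ_{Ji} ∂/∂y^σ_J` for some extension of `z` to a jet of order `r + 1`
(`VanishesOnHolonomic`, `isStronglyContactOn_iff`). Here one needs that each such extension is
the jet of a section, which can be taken polynomial in the chart (`exists_sectionCoord_eq`), and that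
partial derivatives commute (`fderiv_jetLift`).

**Sufficiency.** A contact form vanishes on a holonomic plane and its differential on pairs of
vectors of the plane. So an exterior product of `k + 1` such factors vanishes if at most `k` of its
arguments lie outside the plane (`VanishesToOrder`, `vanishesOnHolonomic_contactSum`).

**Necessity.** In the coframe `dx^i`, `ω^σ_J`, `dy^σ_I` (`|J| < r`, `|I| = r`) at `z` all conditions
have constant coefficients (`frame`), so the coefficients `Φ` are obtained from `ρ` by one fixed linear
map, and are smooth (`exists_contactSum`). At the origin the exterior algebra is treated
as a Fock space, with creation operators `e` (exterior products with coordinate forms) and annihilation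
operators `i` (contractions); see `FockModule`, `formsFock`. The contact forms are split off by
the Euler operator `∑ ω^σ_J ∧ (∂/∂ω^σ_J ⌟ ·)` (`mem_contactIdeal_of_homog`). For a form `x` in the
`dx^i` and the top order `dy^σ_I` only, it suffices to use planes with coefficients `y^σ_K = ∑ l, l_σ l^K`,
a finite sum over parameters `l`. The condition then says that the polynomial
`P(l_1, …, l_β) = (t(l_β) ⌟ ⋯ t(l_1) ⌟ x)`, where `t(l)` has the components `l_σ l^I`, is annihilated
by the products of sufficiently many of the operators `L_a = ∑ j, l_{aj} dx^j ∧ ·`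
(`VanishesOnShears`). The `L_a` and the dual operators `∑ j, ∂/∂l_{aj} (∂_j ⌟ ·)` generate, together
with the polarization operators, an action of the Lie superalgebra `gl(β|1)`, and an argument with
raising operators and weights shows that `P` is a sum of elements in the images of products of `L_a`
(`PolarizationAction`, `mem_images`). Reading monomials `l_σ l^I` as `dy^σ_I ∧` turns each
`L_a` into a factor `∑ j, dy^σ_{Ij} ∧ dx^j = -dω^σ_I`, which gives the required factors
(`mem_curvIdeal`, `mem_contactIdeal`).
-/

set_option linter.unusedSectionVars false

noncomputable section

namespace JetForms

open scoped TensorProduct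

/-! ### Anticommuting families -/

/-- A family of pairwise anticommuting elements of a ring, each of square zero. -/
structure Anticomm {R ι : Type*} [Ring R] (f : ι → R) : Prop where
  sq : ∀ a, f a * f a = 0
  swap : ∀ a b, f a * f b = -(f b * f a)

namespace Anticomm

variable {R ι : Type*} [Ring R] {f : ι → R}

theorem prod_perm (h : Anticomm f) {l l' : List ι} (hl : l.Perm l') :
    (l.map f).prod = (l'.map f).prod ∨ (l.map f).prod = -(l'.map f).prod := by
  induction hl with
  | nil => exact Or.inl rfl
  | cons a _ ih =>
    simp only [List.map_cons, List.prod_cons]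
    rcases ih with ih | ih
    · exact Or.inl (by rw [ih])
    · exact Or.inr (by rw [ih, mul_neg])
  | swap a b l =>
    right
    simp only [List.map_cons, List.prod_cons, ← mul_assoc]
    rw [h.swap b a, neg_mul]
  | trans _ _ ih₁ ih₂ =>
    rcases ih₁ with ih₁ | ih₁ <;> rcases ih₂ with ih₂ | ih₂ <;> rw [ih₁, ih₂] <;> simp

theorem mul_prod_eq_zero (h : Anticomm f) {a : ι} {l : List ι} (ha : a ∈ l) :
    f a * (l.map f).prod = 0 := by
  classical
  rcases h.prod_perm (List.perm_cons_erase ha) with e | e <;>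
    simp [e, ← mul_assoc, h.sq]

theorem prod_eq_zero_of_not_nodup (h : Anticomm f) {l : List ι} (hl : ¬l.Nodup) :
    (l.map f).prod = 0 := by
  induction l with
  | nil => simp at hl
  | cons a l ih =>
    rw [List.map_cons, List.prod_cons]
    by_cases ha : a ∈ l
    · exact h.mul_prod_eq_zero ha
    · rw [ih (fun hn => hl (List.nodup_cons.mpr ⟨ha, hn⟩)), mul_zero]

/-- Two products with a common factor multiply to zero. -/
theorem prod_mul_prod_eq_zero (h : Anticomm f) {a : ι} {l l' : List ι} (ha : a ∈ l)
    (ha' : a ∈ l') : (l.map f).prod * (l'.map f).prod = 0 := by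
  have h0 := h.prod_eq_zero_of_not_nodup (l := l ++ l')
    (fun hn => (List.disjoint_of_nodup_append hn) ha ha')
  simpa using h0

end Anticomm

/-! ### Polarization operators -/

/-- Operators on a real vector space `H` satisfying the relations of the Lie superalgebra
`gl(β|1)` acting on polynomials in `β` covectors `l₀, …, l_{β-1}` of an `n`-dimensional space with
values in exterior forms: `L a` is exterior multiplication by `l_a`, `δ a` is the adjoint operator
`∑ j, ∂/∂l_{aj} i_j`, `E a b` is the polarization `∑ j, l_{aj} ∂/∂l_{bj}` and `C` is `n` minus the
degree of the form. -/
structure PolarizationAction (β : ℕ) (H : Type*) [AddCommGroup H] [Module ℝ H] where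
  L : Fin β → Module.End ℝ H
  δ : Fin β → Module.End ℝ H
  E : Fin β → Fin β → Module.End ℝ H
  C : Module.End ℝ H
  anticomm : Anticomm L
  L_δ : ∀ a b x, L a (δ b x) = E a b x + (if a = b then C x else 0) - δ b (L a x)
  E_L : ∀ a b c x, E a b (L c x) = L c (E a b x) + if b = c then L a x else 0
  E_δ : ∀ a b c x, E a b (δ c x) = δ c (E a b x) - if a = c then δ b x else 0
  E_E : ∀ a b c x, E a a (E b c x) =
    E b c (E a a x) + (if a = b then E b c x else 0) - (if a = c then E b c x else 0)
  C_L : ∀ a x, C (L a x) = L a (C x) - L a x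
  C_δ : ∀ a x, C (δ a x) = δ a (C x) + δ a x
  C_E : ∀ a b x, C (E a b x) = E a b (C x)
  nonneg : ∀ a x (t : ℝ), t < 0 → E a a x = t • x → x = 0

namespace PolarizationAction

variable {β : ℕ} {H : Type*} [AddCommGroup H] [Module ℝ H] (A : PolarizationAction β H)

/-- The weight of the operator `L a`. -/
def wt (a : Fin β) : (Fin β → ℤ) × ℤ := (Pi.single a 1, -1)

/-- The vectors of weight `w`: homogeneous of degree `w.1 a` in `l_a`, with `C`-eigenvalue `w.2`. -/
def weight (w : (Fin β → ℤ) × ℤ) : Submodule ℝ H where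
  carrier := {x | (∀ a, A.E a a x = (w.1 a : ℝ) • x) ∧ A.C x = (w.2 : ℝ) • x}
  add_mem' := fun hx hy => ⟨fun a => by rw [map_add, hx.1, hy.1, smul_add],
    by rw [map_add, hx.2, hy.2, smul_add]⟩
  zero_mem' := by simp
  smul_mem' := fun t x hx => ⟨fun a => by rw [map_smul, hx.1, smul_comm],
    by rw [map_smul, hx.2, smul_comm]⟩

variable {A} {w : (Fin β → ℤ) × ℤ} {x : H}

theorem L_mem (a : Fin β) (hx : x ∈ A.weight w) : A.L a x ∈ A.weight (w + wt a) := by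
  refine ⟨fun b => ?_, ?_⟩
  · rw [A.E_L, hx.1, map_smul]
    by_cases h : b = a
    · subst h; simp [wt, add_smul]
    · simp [wt, h]
  · rw [A.C_L, hx.2, map_smul]
    simp [wt, add_smul, sub_eq_add_neg]

theorem δ_mem (a : Fin β) (hx : x ∈ A.weight w) : A.δ a x ∈ A.weight (w - wt a) := by
  refine ⟨fun b => ?_, ?_⟩
  · rw [A.E_δ, hx.1, map_smul]
    by_cases h : b = a
    · subst h; simp [wt, sub_smul]
    · simp [wt, h]
  · rw [A.C_δ, hx.2, map_smul]
    simp [wt, add_smul]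

theorem E_mem (a b : Fin β) (hx : x ∈ A.weight w) :
    A.E a b x ∈ A.weight (w + wt a - wt b) := by
  refine ⟨fun c => ?_, ?_⟩
  · rw [A.E_E, hx.1, map_smul]
    by_cases h : c = a <;> by_cases h' : c = b
    · subst h; subst h'; simp [wt]
    · subst h; simp [wt, h', add_smul]
    · subst h'; simp [wt, h, sub_smul]
    · simp [wt, h, h']
  · rw [A.C_E, hx.2, map_smul]
    simp [wt]

theorem prod_L_mem (l : List (Fin β)) (hx : x ∈ A.weight w) :
    (l.map A.L).prod x ∈ A.weight (w + (l.map wt).sum) := by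
  induction l with
  | nil => simpa using hx
  | cons a l ih =>
    have := L_mem a ih
    simpa [add_assoc, add_comm, add_left_comm] using this

theorem prod_δ_mem (l : List (Fin β)) (hx : x ∈ A.weight w) :
    (l.map A.δ).prod x ∈ A.weight (w - (l.map wt).sum) := by
  induction l with
  | nil => simpa using hx
  | cons a l ih =>
    have := δ_mem a ih
    simpa [sub_sub, add_assoc, add_comm, add_left_comm] using this

theorem eq_zero_of_neg (hx : x ∈ A.weight w) {a : Fin β} (ha : w.1 a < 0) : x = 0 :=
  A.nonneg a x (w.1 a) (by exact_mod_cast ha) (hx.1 a)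

variable (A)

/-- The product `L₀ ⋯ L_{β-1}`. -/
def fullL : Module.End ℝ H := ((List.finRange β).map A.L).prod

/-- The sum of the weights of all the `L a`. -/
def fullWt (β : ℕ) : (Fin β → ℤ) × ℤ := ((List.finRange β).map wt).sum

/-- The vectors `L₀ ⋯ L_{β-1} R` of weight `w`, with `R` of the corresponding weight. -/
def top (w : (Fin β → ℤ) × ℤ) : Submodule ℝ H := (A.weight (w - fullWt β)).map A.fullL

/-- The vectors obtained from `top` by `j` operators `δ`, of weight `w`. -/
def descent : ℕ → (Fin β → ℤ) × ℤ → Submodule ℝ H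
  | 0, w => A.top w
  | j + 1, w => ⨆ a, (descent j (w + wt a)).map (A.δ a)

variable {A}

theorem L_fullL (a : Fin β) : A.L a * A.fullL = 0 :=
  A.anticomm.mul_prod_eq_zero (List.mem_finRange a)

theorem L_top (a : Fin β) (hx : x ∈ A.top w) : A.L a x = 0 := by
  obtain ⟨y, -, rfl⟩ := hx
  exact congrArg (fun T : Module.End ℝ H => T y) (L_fullL a)

theorem E_prod_L_of_notMem (a b : Fin β) (l : List (Fin β)) (hb : b ∉ l) :
    A.E a b ((l.map A.L).prod x) = (l.map A.L).prod (A.E a b x) := by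
  induction l with
  | nil => simp
  | cons c l ih =>
    have hbc : b ≠ c := fun h => hb (h ▸ List.mem_cons_self)
    have ih := ih fun h => hb (List.mem_cons_of_mem _ h)
    simp only [List.map_cons, List.prod_cons, Module.End.mul_apply]
    rw [A.E_L, ih]
    simp [hbc]

theorem E_prod_δ_of_notMem (a b : Fin β) (l : List (Fin β)) (ha : a ∉ l) :
    A.E a b ((l.map A.δ).prod x) = (l.map A.δ).prod (A.E a b x) := by
  induction l with
  | nil => simp
  | cons c l ih =>
    have hbc : a ≠ c := fun h => ha (h ▸ List.mem_cons_self)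
    have ih := ih fun h => ha (List.mem_cons_of_mem _ h)
    simp only [List.map_cons, List.prod_cons, Module.End.mul_apply]
    rw [A.E_δ, ih]
    simp [hbc]

theorem fullL_eq (b : Fin β) :
    A.fullL = A.L b * (((List.finRange β).erase b).map A.L).prod ∨
    A.fullL = -(A.L b * (((List.finRange β).erase b).map A.L).prod) := by
  simpa [fullL] using A.anticomm.prod_perm (List.perm_cons_erase (List.mem_finRange b))

/-- The product `L₀ ⋯ L_{β-1}` commutes with the polarizations up to the trace. -/
theorem E_fullL (a b : Fin β) (x : H) :
    A.E a b (A.fullL x) = A.fullL (A.E a b x) + if a = b then A.fullL x else 0 := by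
  have key : ∀ y, A.E a b (A.L b ((((List.finRange β).erase b).map A.L).prod y)) =
      A.L b ((((List.finRange β).erase b).map A.L).prod (A.E a b y)) +
        if a = b then A.L b ((((List.finRange β).erase b).map A.L).prod y) else 0 := by
    intro y
    have hb : b ∉ (List.finRange β).erase b := (List.nodup_finRange β).not_mem_erase
    rw [A.E_L, E_prod_L_of_notMem _ _ _ hb, if_pos rfl]
    congr 1
    by_cases h : a = b
    · simp [h]
    · have ha : a ∈ (List.finRange β).erase b :=
        (List.mem_erase_of_ne h).mpr (List.mem_finRange a)
      rw [if_neg h]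
      exact congrArg (fun T : Module.End ℝ H => T y) (A.anticomm.mul_prod_eq_zero ha)
  rcases fullL_eq (A := A) b with h | h
  · rw [h]; exact key x
  · rw [h]
    simp only [LinearMap.neg_apply, Module.End.mul_apply, map_neg, key x]
    split_ifs <;> simp [add_comm]

theorem E_top (a b : Fin β) (hx : x ∈ A.top w) : A.E a b x ∈ A.top (w + wt a - wt b) := by
  obtain ⟨y, hy, rfl⟩ := hx
  rw [E_fullL]
  refine Submodule.add_mem _ ⟨A.E a b y, ?_, rfl⟩ ?_
  · rw [show w + wt a - wt b - fullWt β = w - fullWt β + wt a - wt b by abel]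
    exact E_mem a b hy
  · split_ifs with h
    · subst h; exact ⟨y, by simpa using hy, rfl⟩
    · exact Submodule.zero_mem _

theorem δ_descent {j : ℕ} (a : Fin β) (hx : x ∈ A.descent j w) :
    A.δ a x ∈ A.descent (j + 1) (w - wt a) :=
  Submodule.mem_iSup_of_mem a ⟨x, by simpa using hx, rfl⟩

theorem E_descent (j : ℕ) (a b : Fin β) : ∀ {w : (Fin β → ℤ) × ℤ} {x : H}, x ∈ A.descent j w →
    A.E a b x ∈ A.descent j (w + wt a - wt b) := by
  induction j with
  | zero => exact fun hx => E_top a b hx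
  | succ j ih =>
    intro w x hx
    refine Submodule.iSup_induction _
      (motive := fun x => A.E a b x ∈ A.descent (j + 1) _) hx ?_ ?_ ?_
    · rintro c _ ⟨y, hy, rfl⟩
      rw [A.E_δ]
      refine Submodule.sub_mem _ ?_ ?_
      · convert δ_descent c (ih hy) using 1
        congr 1; abel
      · split_ifs with h
        · subst h
          exact δ_descent b hy
        · exact Submodule.zero_mem _
    · simp
    · intro x y hx hy
      rw [map_add]; exact Submodule.add_mem _ hx hy

theorem mem_weight_of_mem_descent (j : ℕ) : ∀ {w : (Fin β → ℤ) × ℤ} {x : H}, x ∈ A.descent j w →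
    x ∈ A.weight w := by
  induction j with
  | zero =>
    rintro w _ ⟨y, hy, rfl⟩
    simpa [fullL, fullWt] using prod_L_mem (List.finRange β) hy
  | succ j ih =>
    intro w x hx
    refine Submodule.iSup_induction _ (motive := fun x => x ∈ A.weight w) hx ?_ ?_ ?_
    · rintro c _ ⟨y, hy, rfl⟩
      simpa using δ_mem c (ih hy)
    · exact Submodule.zero_mem _
    · exact fun x y => Submodule.add_mem _

/-- The operators `L a` undo one step of the descent: `top` is killed by `L a`, and
`L a δ b + δ b L a` is `E a b`, plus `C` if `a = b`. -/
theorem L_descent (j : ℕ) (a : Fin β) : ∀ {w : (Fin β → ℤ) × ℤ} {x : H},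
    x ∈ A.descent (j + 1) w → A.L a x ∈ A.descent j (w + wt a) := by
  induction j with
  | zero =>
    intro w x hx
    refine Submodule.iSup_induction _ (motive := fun x => A.L a x ∈ A.descent 0 _) hx ?_ ?_ ?_
    · rintro c _ ⟨y, hy, rfl⟩
      rw [A.L_δ, L_top a hy, map_zero, sub_zero]
      refine Submodule.add_mem _ ?_ ?_
      · rw [show w + wt a = w + wt c + wt a - wt c by abel]
        exact E_top a c hy
      · split_ifs with h
        · subst h; rw [(mem_weight_of_mem_descent 0 hy).2]; exact Submodule.smul_mem _ _ hy
        · exact Submodule.zero_mem _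
    · simp
    · intro x y hx hy
      rw [map_add]; exact Submodule.add_mem _ hx hy
  | succ j ih =>
    intro w x hx
    refine Submodule.iSup_induction _ (motive := fun x => A.L a x ∈ A.descent (j + 1) _) hx ?_ ?_ ?_
    · rintro c _ ⟨y, hy, rfl⟩
      rw [A.L_δ]
      refine Submodule.sub_mem _ (Submodule.add_mem _ ?_ ?_) ?_
      · convert E_descent (j + 1) a c hy using 1
        congr 1; abel
      · split_ifs with h
        · subst h; rw [(mem_weight_of_mem_descent _ hy).2]; exact Submodule.smul_mem _ _ hy
        · exact Submodule.zero_mem _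
      · convert δ_descent c (ih hy) using 1
        congr 1; abel
    · simp
    · intro x y hx hy
      rw [map_add]; exact Submodule.add_mem _ hx hy

theorem prod_L_descent (l : List (Fin β)) : ∀ {w : (Fin β → ℤ) × ℤ} {x : H},
    x ∈ A.descent l.length w → (l.reverse.map A.L).prod x ∈ A.top (w + (l.map wt).sum) := by
  induction l with
  | nil => intro w x hx; simpa [descent] using hx
  | cons a l ih =>
    intro w x hx
    have := ih (L_descent l.length a hx)
    simpa [add_assoc] using this

theorem snd_sum_wt (l : List (Fin β)) : ((l.map wt).sum).2 = -(l.length : ℤ) := by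
  induction l with
  | nil => simp
  | cons a l ih =>
    simp only [List.map_cons, List.sum_cons, Prod.snd_add, ih, wt, List.length_cons]
    push_cast
    ring

/-- If the raised vectors `E k e v`, `k < e`, lie in `top`, then moving `L k` through a product of
the `δ e`, `k < e`, to a vector `v` which it kills leaves only terms obtained from `top`. -/
theorem δ_L_prod_δ_mem {v : H} {k : Fin β} (hv : A.L k v = 0)
    (hE : ∀ e, k < e → A.E k e v ∈ A.top (w + wt k - wt e)) (l : List (Fin β))
    (hl : ∀ e ∈ l, k < e) (b : Fin β) :
    A.δ b (A.L k ((l.map A.δ).prod v)) ∈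
      A.descent l.length (w - (l.map wt).sum + wt k - wt b) := by
  induction l generalizing b with
  | nil => simp [hv]
  | cons e l ih =>
    have hke : k < e := hl e List.mem_cons_self
    have hl' : ∀ e ∈ l, k < e := fun e he => hl e (List.mem_cons_of_mem _ he)
    have hk : k ∉ l := fun h => lt_irrefl k (hl' k h)
    simp only [List.map_cons, List.prod_cons, Module.End.mul_apply, List.length_cons,
      List.sum_cons]
    rw [A.L_δ, if_neg hke.ne, add_zero, E_prod_δ_of_notMem _ _ _ hk]
    refine δ_descent b (Submodule.sub_mem _ ?_ ?_)
    · have : ∀ (l : List (Fin β)) {w' : (Fin β → ℤ) × ℤ} {x : H}, x ∈ A.descent 0 w' →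
          (l.map A.δ).prod x ∈ A.descent l.length (w' - (l.map wt).sum) := by
        intro l
        induction l with
        | nil => intro w' x hx; simpa using hx
        | cons c l ih =>
          intro w' x hx
          have := δ_descent c (ih hx)
          simp only [List.map_cons, List.prod_cons, Module.End.mul_apply, List.length_cons,
            List.sum_cons]
          rwa [show w' - (wt c + (l.map wt).sum) = w' - (l.map wt).sum - wt c by abel]
      have h := this l (hE e hke)
      rwa [show w - (wt e + (l.map wt).sum) + wt k = w + wt k - wt e - (l.map wt).sum by abel]
    · have := ih hl' e
      rwa [show w - (wt e + (l.map wt).sum) + wt k = w - (l.map wt).sum + wt k - wt e by abel]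

/-- If all the raised vectors `E k e v`, `k < e`, lie in `top`, then `L ⋯ L δ ⋯ δ v` is a positive
multiple of `v` up to `top`. The factor contributed by `k` is `λ_k + C`. -/
theorem exists_pos_prod_L_prod_δ {v : H} (hv : v ∈ A.weight w) (hw : 0 < w.2)
    (hw' : ∀ a, 0 ≤ w.1 a) (hL : ∀ a, A.L a v = 0)
    (hE : ∀ k e, k < e → A.E k e v ∈ A.top (w + wt k - wt e)) (l : List (Fin β))
    (hl : l.Pairwise (· < ·)) :
    ∃ c : ℝ, 0 < c ∧
      (l.reverse.map A.L).prod ((l.map A.δ).prod v) - c • v ∈ A.top w := by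
  induction l with
  | nil => exact ⟨1, one_pos, by simp⟩
  | cons k l ih =>
    rw [List.pairwise_cons] at hl
    obtain ⟨c, hc, h⟩ := ih hl.2
    have hk : k ∉ l := fun h => lt_irrefl k (hl.1 k h)
    set y := (l.map A.δ).prod v with hy
    have hyw := prod_δ_mem l hv
    have hEy : A.E k k y = (w.1 k : ℝ) • y := by
      rw [hy, E_prod_δ_of_notMem _ _ _ hk, hv.1, map_smul]
    have hCy : A.C y = ((w.2 + l.length : ℤ) : ℝ) • y := by
      rw [hyw.2]
      simp [snd_sum_wt, hy]
    have hpos : (0 : ℝ) < (w.1 k : ℝ) + ((w.2 + l.length : ℤ) : ℝ) := by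
      have h1 : (0 : ℤ) < w.1 k + (w.2 + l.length) := by have := hw' k; omega
      exact_mod_cast h1
    refine ⟨((w.1 k : ℝ) + ((w.2 + l.length : ℤ) : ℝ)) * c, mul_pos hpos hc, ?_⟩
    have h1 := prod_L_descent l (δ_L_prod_δ_mem (hL k) (hE k) l hl.1 k)
    rw [show w - (l.map wt).sum + wt k - wt k + (l.map wt).sum = w by abel] at h1
    have h3 := Submodule.sub_mem _ (Submodule.smul_mem _
      ((w.1 k : ℝ) + ((w.2 + l.length : ℤ) : ℝ)) h) h1
    convert h3 using 1
    simp only [List.reverse_cons, List.map_append, List.map_cons, List.map_nil, List.prod_append,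
      List.prod_cons, List.prod_nil, mul_one, Module.End.mul_apply]
    rw [← hy, A.L_δ, if_pos rfl, hEy, hCy, ← add_smul, map_sub, map_smul, smul_sub, smul_smul]
    abel

/-- The measure of a weight which the raising operators `E k e`, `k < e`, decrease: they move one
unit of degree from `l_e` to `l_k`. -/
def height (w : (Fin β → ℤ) × ℤ) : ℕ := ∑ a : Fin β, (a : ℕ) * (w.1 a).toNat

theorem height_lt {k e : Fin β} (hke : k < e) (hw : ∀ a, 0 ≤ w.1 a) (he : 1 ≤ w.1 e) :
    height (w + wt k - wt e) < height w := by
  have h : ∀ a : Fin β, (a : ℕ) * ((w + wt k - wt e).1 a).toNat + (if a = e then (e : ℕ) else 0) =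
      (a : ℕ) * (w.1 a).toNat + if a = k then (k : ℕ) else 0 := by
    intro a
    have hwa := hw a
    by_cases hk : a = k <;> by_cases he' : a = e
    · omega
    · subst hk
      have h1 : ((w + wt a - wt e).1 a).toNat = (w.1 a).toNat + 1 := by
        simp [wt, he']; omega
      rw [h1]; simp [he', mul_add]
    · subst he'
      have h1 : (w.1 a).toNat = ((w + wt k - wt a).1 a).toNat + 1 := by
        simp [wt, hk]; omega
      rw [h1]; simp [hk, mul_add]
    · simp [wt, hk, he']
  have hs := Finset.sum_congr rfl fun a (_ : a ∈ Finset.univ) => h a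
  rw [Finset.sum_add_distrib, Finset.sum_add_distrib, Finset.sum_ite_eq' , Finset.sum_ite_eq'] at hs
  simp only [Finset.mem_univ, if_true] at hs
  have : (k : ℕ) < e := hke
  unfold height
  omega

/-- A vector killed by all the operators `L a`, on which `C` is positive, is of the form
`L₀ ⋯ L_{β-1} R`. By induction on the height this holds for the raised vectors, which are also
killed by the `L a`; then `L ⋯ L δ ⋯ δ v` is a positive multiple of `v` up to such vectors. -/
theorem mem_top_of_L_eq_zero (N : ℕ) : ∀ {w : (Fin β → ℤ) × ℤ} {v : H}, height w ≤ N →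
    v ∈ A.weight w → 0 < w.2 → (∀ a, A.L a v = 0) → v ∈ A.top w := by
  induction N using Nat.strong_induction_on with
  | _ N ih =>
    intro w v hN hv hw hL
    by_cases hneg : ∃ a, w.1 a < 0
    · obtain ⟨a, ha⟩ := hneg
      rw [eq_zero_of_neg hv ha]; exact Submodule.zero_mem _
    push Not at hneg
    have hE : ∀ k e, k < e → A.E k e v ∈ A.top (w + wt k - wt e) := by
      intro k e hke
      have hmem := E_mem k e hv
      by_cases he : 1 ≤ w.1 e
      · have hlt := height_lt hke hneg he
        refine ih _ (lt_of_lt_of_le hlt hN) le_rfl hmem (by simpa [wt] using hw) fun a => ?_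
        have := A.E_L k e a v
        rw [hL, hL, map_zero, ite_self, add_zero] at this
        exact this.symm
      · have h0 : (w + wt k - wt e).1 e < 0 := by
          have := hneg e
          simp [wt, hke.ne']; omega
        rw [eq_zero_of_neg hmem h0]; exact Submodule.zero_mem _
    obtain ⟨c, hc, h⟩ := exists_pos_prod_L_prod_δ hv hw hneg hL hE (List.finRange β)
      (List.pairwise_lt_finRange β)
    have h1 : ((List.finRange β).reverse.map A.L).prod (((List.finRange β).map A.δ).prod v) ∈
        A.top w := by
      have hm := prod_δ_mem (List.finRange β) hv
      rcases A.anticomm.prod_perm (List.reverse_perm (List.finRange β)) with e | e <;> rw [e]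
      · exact ⟨_, hm, rfl⟩
      · exact Submodule.neg_mem _ ⟨_, hm, rfl⟩
    have h2 := Submodule.sub_mem _ h1 h
    rw [sub_sub_cancel] at h2
    exact (Submodule.smul_mem_iff _ hc.ne').mp h2

variable (A) in
/-- The sum of the images of the products of `j` distinct operators `L a`. -/
def images (j : ℕ) : Submodule ℝ H :=
  ⨆ l : {l : List (Fin β) // l.Nodup ∧ l.length = j}, LinearMap.range (l.1.map A.L).prod

theorem images_anti {i j : ℕ} (h : i ≤ j) : A.images j ≤ A.images i := by
  refine iSup_le fun ⟨l, hl, hlj⟩ => ?_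
  rintro _ ⟨y, rfl⟩
  refine Submodule.mem_iSup_of_mem ⟨l.take i, hl.sublist (List.take_sublist _ _), by simp; omega⟩ ?_
  refine ⟨((l.drop i).map A.L).prod y, ?_⟩
  rw [← Module.End.mul_apply, ← List.prod_append, ← List.map_append, List.take_append_drop]

/-- If `v` is killed by all products of `t + 1` operators `L a`, and `C v = c v` with `c > t`, then
`v` is a sum of images of products of `β - t` distinct operators `L a`. The induction subtracts
from `v` a vector `Q` of this kind such that `v - Q` is killed by all products of `t` operators. -/
theorem mem_images {v : H} (hv : v ∈ A.weight w) (t : ℕ) (htβ : t ≤ β) (hw : (t : ℤ) < w.2)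
    (hL : ∀ l : List (Fin β), l.Nodup → l.length = t + 1 → (l.map A.L).prod v = 0) :
    v ∈ A.images (β - t) := by
  classical
  induction t generalizing v with
  | zero =>
    obtain ⟨y, -, rfl⟩ := mem_top_of_L_eq_zero _ le_rfl hv (by simpa using hw) fun a => by
      simpa using hL [a] (by simp) (by simp)
    exact Submodule.mem_iSup_of_mem ⟨List.finRange β, List.nodup_finRange β, by simp⟩ ⟨y, rfl⟩
  | succ t ih =>
    -- For each `S` the vector `L_S v` is killed by all `L a`, hence equals `L_S Q` with `Q` in the
    -- image of the product over the complement of `S`.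
    have hex : ∀ S : Finset (Fin β), S.card = t + 1 → ∃ R : H,
        (Sᶜ.toList.map A.L).prod R ∈ A.weight w ∧
        (S.toList.map A.L).prod v = (S.toList.map A.L).prod ((Sᶜ.toList.map A.L).prod R) := by
      intro S hS
      have h1 := prod_L_mem S.toList hv
      have h2 : ∀ a, A.L a ((S.toList.map A.L).prod v) = 0 := by
        intro a
        rw [← Module.End.mul_apply]
        by_cases ha : a ∈ S
        · rw [A.anticomm.mul_prod_eq_zero (Finset.mem_toList.mpr ha)]; simp
        · rw [← List.prod_cons, ← List.map_cons]
          exact hL _ (List.nodup_cons.mpr ⟨by simpa using ha, S.nodup_toList⟩) (by simp [hS])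
      have h3 : 0 < (w + (S.toList.map wt).sum).2 := by
        rw [Prod.snd_add, snd_sum_wt, Finset.length_toList, hS]; push_cast at hw ⊢; omega
      obtain ⟨R, hR, hRv⟩ := mem_top_of_L_eq_zero _ le_rfl h1 h3 h2
      have hp : (List.finRange β).Perm (S.toList ++ Sᶜ.toList) := by
        refine (List.perm_ext_iff_of_nodup (List.nodup_finRange β) ?_).mpr fun a => by
          simp [em]
        refine List.Nodup.append S.nodup_toList Sᶜ.nodup_toList fun a h h' => ?_
        rw [Finset.mem_toList] at h h'
        exact (Finset.mem_compl.mp h') h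
      have hwt : fullWt β = (S.toList.map wt).sum + (Sᶜ.toList.map wt).sum := by
        rw [fullWt, (hp.map wt).sum_eq, List.map_append, List.sum_append]
      have hRw : (Sᶜ.toList.map A.L).prod R ∈ A.weight w := by
        have := prod_L_mem Sᶜ.toList hR
        rwa [hwt, show w + (S.toList.map wt).sum - ((S.toList.map wt).sum +
          (Sᶜ.toList.map wt).sum) + (Sᶜ.toList.map wt).sum = w by abel] at this
      rcases A.anticomm.prod_perm hp with e | e
      · refine ⟨R, hRw, ?_⟩
        rw [← hRv, fullL, e, List.map_append, List.prod_append, Module.End.mul_apply]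
      · refine ⟨-R, by rw [map_neg]; exact Submodule.neg_mem _ hRw, ?_⟩
        rw [← hRv, fullL, e, List.map_append, List.prod_append, LinearMap.neg_apply,
          Module.End.mul_apply, map_neg, map_neg]
    choose! R hRw hR using hex
    let 𝒮 := (Finset.univ : Finset (Finset (Fin β))).filter fun S => S.card = t + 1
    let Q : H := ∑ S ∈ 𝒮, (Sᶜ.toList.map A.L).prod (R S)
    have hQ : Q ∈ A.images (β - (t + 1)) := by
      refine Submodule.sum_mem _ fun S hS => ?_
      have hS : S.card = t + 1 := (Finset.mem_filter.mp hS).2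
      exact Submodule.mem_iSup_of_mem ⟨Sᶜ.toList, Sᶜ.nodup_toList, by
        simp [Finset.card_compl, hS]⟩ ⟨R S, rfl⟩
    have hQw : Q ∈ A.weight w :=
      Submodule.sum_mem _ fun S hS => hRw S (Finset.mem_filter.mp hS).2
    have hkill : ∀ l : List (Fin β), l.Nodup → l.length = t + 1 → (l.map A.L).prod (v - Q) = 0 := by
      intro l hl hlt
      have hcard : l.toFinset.card = t + 1 := by rw [List.toFinset_card_of_nodup hl, hlt]
      have hlQ : (l.map A.L).prod Q = (l.map A.L).prod ((l.toFinsetᶜ.toList.map A.L).prod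
          (R l.toFinset)) := by
        rw [map_sum]
        refine Finset.sum_eq_single_of_mem l.toFinset (by simp [𝒮, hcard]) fun S hS hne => ?_
        have hS : S.card = t + 1 := (Finset.mem_filter.mp hS).2
        obtain ⟨a, ha, haS⟩ : ∃ a ∈ l.toFinset, a ∉ S := by
          by_contra! hcon
          exact hne (Finset.eq_of_subset_of_card_le hcon (by omega)).symm
        rw [← Module.End.mul_apply, A.anticomm.prod_mul_prod_eq_zero (a := a) (by simpa using ha)
          (by simpa using haS)]
        simp
      have hp : l.Perm l.toFinset.toList :=
        (List.perm_ext_iff_of_nodup hl (Finset.nodup_toList _)).mpr fun a => by simp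
      rw [map_sub, hlQ, sub_eq_zero]
      rcases A.anticomm.prod_perm hp with e | e <;>
        simp only [e, LinearMap.neg_apply, neg_inj] <;> exact hR _ hcard
    have := ih (v := v - Q) (Submodule.sub_mem _ hv hQw) (by omega)
      (by push_cast at hw; omega) hkill
    have h2 := Submodule.add_mem _ (images_anti (by omega : β - (t + 1) ≤ β - t) this) hQ
    rwa [sub_add_cancel] at h2

end PolarizationAction

/-! ### Polynomials with values in a Fock module -/

/-- A real vector space with creation operators `e k` and annihilation operators `i k` satisfying
the canonical anticommutation relations. In the application the vectors are exterior forms, `e k`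
is exterior multiplication by a coordinate form and `i k` is the contraction with a coordinate
vector. -/
structure FockModule (κ : Type*) [DecidableEq κ] (Λ : Type*) [AddCommGroup Λ] [Module ℝ Λ] where
  e : κ → Module.End ℝ Λ
  i : κ → Module.End ℝ Λ
  e_anticomm : Anticomm e
  i_anticomm : Anticomm i
  i_e : ∀ k l x, i k (e l x) = (if k = l then x else 0) - e l (i k x)

namespace FockModule

section

variable {κ : Type*} [DecidableEq κ] {Λ : Type*} [AddCommGroup Λ] [Module ℝ Λ]
  (F : FockModule κ Λ)

theorem e_e (k l : κ) (x : Λ) : F.e k (F.e l x) = -F.e l (F.e k x) :=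
  congrArg (fun T : Module.End ℝ Λ => T x) (F.e_anticomm.swap k l)

theorem i_i (k l : κ) (x : Λ) : F.i k (F.i l x) = -F.i l (F.i k x) :=
  congrArg (fun T : Module.End ℝ Λ => T x) (F.i_anticomm.swap k l)

theorem i_i_self (k : κ) (x : Λ) : F.i k (F.i k x) = 0 :=
  congrArg (fun T : Module.End ℝ Λ => T x) (F.i_anticomm.sq k)

theorem e_i (k l : κ) (x : Λ) : F.e k (F.i l x) = (if k = l then x else 0) - F.i l (F.e k x) := by
  rw [F.i_e]; simp [eq_comm]

end

variable {n β : ℕ} {α τ γ : Type*} [DecidableEq τ] [DecidableEq γ]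
  {Λ : Type*} [AddCommGroup Λ] [Module ℝ Λ] (F : FockModule (Fin n ⊕ (τ ⊕ γ)) Λ)

/-- Polynomials with values in `Λ`, in the coordinates `l_{aj}` of `β` covectors `l_a` and in
further parameters indexed by `α` attached to each `a`. -/
abbrev PolyForm (β n : ℕ) (α Λ : Type*) [AddCommGroup Λ] [Module ℝ Λ] : Type _ :=
  MvPolynomial (Fin β × (Fin n ⊕ α)) ℝ ⊗[ℝ] Λ

/-- Multiplication by a polynomial. -/
def polyMul (p : MvPolynomial (Fin β × (Fin n ⊕ α)) ℝ) : Module.End ℝ (PolyForm β n α Λ) :=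
  TensorProduct.map (LinearMap.mulLeft ℝ p) LinearMap.id

/-- An operator acting on the coefficients of a polynomial. -/
def coeffOp (T : Module.End ℝ Λ) : Module.End ℝ (PolyForm β n α Λ) :=
  TensorProduct.map LinearMap.id T

@[simp] theorem polyMul_tmul (p q : MvPolynomial (Fin β × (Fin n ⊕ α)) ℝ) (φ : Λ) :
    polyMul p (q ⊗ₜ[ℝ] φ) = (p * q) ⊗ₜ[ℝ] φ := rfl

@[simp] theorem coeffOp_tmul (T : Module.End ℝ Λ) (q : MvPolynomial (Fin β × (Fin n ⊕ α)) ℝ)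
    (φ : Λ) : coeffOp T (q ⊗ₜ[ℝ] φ) = q ⊗ₜ[ℝ] T φ := rfl

/-- Exterior multiplication by the variable covector `l_a`. -/
def opL (a : Fin β) : Module.End ℝ (PolyForm β n α Λ) :=
  ∑ j : Fin n, polyMul (MvPolynomial.X (a, Sum.inl j)) * coeffOp (F.e (Sum.inl j))

/-- The operator `∑ j, ∂/∂l_{aj} i_j`. -/
def opδ (a : Fin β) : Module.End ℝ (PolyForm β n α Λ) :=
  ∑ j : Fin n, TensorProduct.map (MvPolynomial.pderiv (a, Sum.inl j)).toLinearMap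
    (F.i (Sum.inl j))

/-- The polarization `∑ j, l_{aj} ∂/∂l_{bj}`. -/
def opE (a b : Fin β) : Module.End ℝ (PolyForm β n α Λ) :=
  ∑ j : Fin n, polyMul (MvPolynomial.X (a, Sum.inl j)) *
    TensorProduct.map (MvPolynomial.pderiv (b, Sum.inl j)).toLinearMap LinearMap.id

/-- The operator `∑ j, i_j e_j`, i.e. `n` minus the degree in the `dx`. -/
def opC : Module.End ℝ (PolyForm β n α Λ) :=
  coeffOp (∑ j : Fin n, F.i (Sum.inl j) * F.e (Sum.inl j))

theorem opL_tmul (a : Fin β) (q : MvPolynomial (Fin β × (Fin n ⊕ α)) ℝ) (φ : Λ) :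
    F.opL a (q ⊗ₜ[ℝ] φ) =
      ∑ j, (MvPolynomial.X (a, Sum.inl j) * q) ⊗ₜ[ℝ] F.e (Sum.inl j) φ := by
  simp [opL, LinearMap.sum_apply]

theorem opδ_tmul (a : Fin β) (q : MvPolynomial (Fin β × (Fin n ⊕ α)) ℝ) (φ : Λ) :
    F.opδ a (q ⊗ₜ[ℝ] φ) =
      ∑ j, (MvPolynomial.pderiv (a, Sum.inl j) q) ⊗ₜ[ℝ] F.i (Sum.inl j) φ := by
  simp [opδ, LinearMap.sum_apply]

theorem opE_tmul (a b : Fin β) (q : MvPolynomial (Fin β × (Fin n ⊕ α)) ℝ) (φ : Λ) :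
    opE a b (q ⊗ₜ[ℝ] φ) =
      ∑ j, (MvPolynomial.X (a, Sum.inl j) * MvPolynomial.pderiv (b, Sum.inl j) q) ⊗ₜ[ℝ] φ := by
  simp [opE, LinearMap.sum_apply]

theorem opC_tmul (q : MvPolynomial (Fin β × (Fin n ⊕ α)) ℝ) (φ : Λ) :
    F.opC (q ⊗ₜ[ℝ] φ) = q ⊗ₜ[ℝ] ∑ j : Fin n, F.i (Sum.inl j) (F.e (Sum.inl j) φ) := by
  simp [opC, LinearMap.sum_apply]

theorem pderiv_X_mul (a b : Fin β) (j k : Fin n) (q : MvPolynomial (Fin β × (Fin n ⊕ α)) ℝ) :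
    MvPolynomial.pderiv (b, Sum.inl k) (MvPolynomial.X (a, Sum.inl j) * q) =
      MvPolynomial.X (a, Sum.inl j) * MvPolynomial.pderiv (b, Sum.inl k) q +
        if a = b ∧ j = k then q else 0 := by
  classical
  rw [Derivation.leibniz, MvPolynomial.pderiv_X]
  by_cases h : a = b ∧ j = k
  · obtain ⟨rfl, rfl⟩ := h; simp
  · simp [h]

theorem pderiv_comm {σ : Type*} (s t : σ) (q : MvPolynomial σ ℝ) :
    MvPolynomial.pderiv s (MvPolynomial.pderiv t q) =
      MvPolynomial.pderiv t (MvPolynomial.pderiv s q) := by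
  classical
  have h : ⁅(MvPolynomial.pderiv s : Derivation ℝ (MvPolynomial σ ℝ) (MvPolynomial σ ℝ)),
      (MvPolynomial.pderiv t : Derivation ℝ (MvPolynomial σ ℝ) (MvPolynomial σ ℝ))⁆ = 0 := by
    refine MvPolynomial.derivation_ext fun u => ?_
    simp only [Derivation.commutator_apply, MvPolynomial.pderiv_X, Derivation.coe_zero,
      Pi.zero_apply, Pi.single_apply]
    split_ifs <;> simp
  have := congrArg (fun D : Derivation ℝ _ _ => D q) h
  simpa [Derivation.commutator_apply, sub_eq_zero] using this

theorem opL_opδ (a b : Fin β) (x : PolyForm β n α Λ) :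
    F.opL a (F.opδ b x) = opE a b x + (if a = b then F.opC x else 0) - F.opδ b (F.opL a x) := by
  induction x using TensorProduct.induction_on with
  | zero => simp
  | add x y hx hy => simp only [map_add, hx, hy]; split_ifs <;> abel
  | tmul q φ =>
    simp only [opδ_tmul, opL_tmul, map_sum, opE_tmul, opC_tmul, pderiv_X_mul, F.i_e,
      TensorProduct.add_tmul, TensorProduct.tmul_sub, Finset.sum_add_distrib,
      Finset.sum_sub_distrib, Sum.inl.injEq]
    rw [Finset.sum_comm]
    by_cases h : a = b
    · subst h
      simp [TensorProduct.tmul_sum, TensorProduct.ite_tmul, TensorProduct.tmul_ite,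
        Finset.sum_ite_eq, Finset.sum_ite_eq']
      abel
    · simp [h, TensorProduct.tmul_ite]

theorem opE_opL (a b c : Fin β) (x : PolyForm β n α Λ) :
    opE a b (F.opL c x) = F.opL c (opE a b x) + if b = c then F.opL a x else 0 := by
  induction x using TensorProduct.induction_on with
  | zero => simp
  | add x y hx hy => simp only [map_add, hx, hy]; split_ifs <;> abel
  | tmul q φ =>
    simp only [opL_tmul, map_sum, opE_tmul, pderiv_X_mul, mul_add,
      TensorProduct.add_tmul, Finset.sum_add_distrib]
    rw [Finset.sum_comm]
    refine congrArg₂ (· + ·) ?_ ?_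
    · simp only [mul_left_comm]
    · by_cases h : b = c
      · subst h
        simp [TensorProduct.ite_tmul]
      · simp [h, Ne.symm h]

theorem opE_opδ (a b c : Fin β) (x : PolyForm β n α Λ) :
    opE a b (F.opδ c x) = F.opδ c (opE a b x) - if a = c then F.opδ b x else 0 := by
  induction x using TensorProduct.induction_on with
  | zero => simp
  | add x y hx hy => simp only [map_add, hx, hy]; split_ifs <;> abel
  | tmul q φ =>
    simp only [opδ_tmul, map_sum, opE_tmul, pderiv_X_mul,
      TensorProduct.add_tmul, Finset.sum_add_distrib]
    rw [eq_sub_iff_add_eq]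
    refine congrArg₂ (· + ·) ?_ ?_
    · rw [Finset.sum_comm]
      exact Finset.sum_congr rfl fun j _ => Finset.sum_congr rfl fun k _ => by rw [pderiv_comm]
    · by_cases h : a = c
      · subst h
        simp [TensorProduct.ite_tmul]
      · simp [h]

theorem opE_opE (a b c : Fin β) (x : PolyForm β n α Λ) :
    opE a a (opE b c x) = opE b c (opE a a x) + (if a = b then opE b c x else 0) -
      (if a = c then opE b c x else 0) := by
  induction x using TensorProduct.induction_on with
  | zero => simp
  | add x y hx hy => simp only [map_add, hx, hy]; split_ifs <;> abel
  | tmul q φ =>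
    simp only [map_sum, opE_tmul, pderiv_X_mul, mul_add,
      TensorProduct.add_tmul, Finset.sum_add_distrib]
    have h1 : ∑ x, ∑ y, (MvPolynomial.X (a, Sum.inl y) * (MvPolynomial.X (b, Sum.inl x) *
        MvPolynomial.pderiv (a, Sum.inl y) (MvPolynomial.pderiv (c, Sum.inl x) q))) ⊗ₜ[ℝ] φ =
        ∑ x, ∑ y, (MvPolynomial.X (b, Sum.inl y) * (MvPolynomial.X (a, Sum.inl x) *
        MvPolynomial.pderiv (c, Sum.inl y) (MvPolynomial.pderiv (a, Sum.inl x) q))) ⊗ₜ[ℝ] φ := by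
      rw [Finset.sum_comm]
      exact Finset.sum_congr rfl fun j _ => Finset.sum_congr rfl fun k _ => by
        rw [pderiv_comm, mul_left_comm]
    rw [h1]
    by_cases h : a = b <;> by_cases h' : a = c
    · subst h; subst h'
      simp [TensorProduct.ite_tmul]
    · subst h
      simp [TensorProduct.ite_tmul, h']
    · subst h'
      simp [TensorProduct.ite_tmul, h, Ne.symm h]
    · simp [h, Ne.symm h, h']

theorem sum_i_e_e (j : Fin n) (φ : Λ) :
    ∑ k : Fin n, F.i (Sum.inl k) (F.e (Sum.inl k) (F.e (Sum.inl j) φ)) =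
      F.e (Sum.inl j) (∑ k : Fin n, F.i (Sum.inl k) (F.e (Sum.inl k) φ)) - F.e (Sum.inl j) φ := by
  rw [map_sum, eq_sub_iff_add_eq]
  have : ∀ k : Fin n, F.i (Sum.inl k) (F.e (Sum.inl k) (F.e (Sum.inl j) φ)) =
      F.e (Sum.inl j) (F.i (Sum.inl k) (F.e (Sum.inl k) φ)) -
        if k = j then F.e (Sum.inl j) φ else 0 := by
    intro k
    rw [F.e_e (Sum.inl k), map_neg, F.i_e (Sum.inl k) (Sum.inl j)]
    by_cases h : k = j <;> simp [h]
  simp [this]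

theorem sum_i_e_i (j : Fin n) (φ : Λ) :
    ∑ k : Fin n, F.i (Sum.inl k) (F.e (Sum.inl k) (F.i (Sum.inl j) φ)) =
      F.i (Sum.inl j) (∑ k : Fin n, F.i (Sum.inl k) (F.e (Sum.inl k) φ)) + F.i (Sum.inl j) φ := by
  rw [map_sum]
  have : ∀ k : Fin n, F.i (Sum.inl k) (F.e (Sum.inl k) (F.i (Sum.inl j) φ)) =
      F.i (Sum.inl j) (F.i (Sum.inl k) (F.e (Sum.inl k) φ)) +
        if k = j then F.i (Sum.inl j) φ else 0 := by
    intro k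
    rw [F.e_i (Sum.inl k), map_sub, F.i_i (Sum.inl k) (Sum.inl j)]
    by_cases h : k = j <;> simp [h, add_comm]
  simp [this, Finset.sum_add_distrib]

theorem opC_opL (a : Fin β) (x : PolyForm β n α Λ) :
    F.opC (F.opL a x) = F.opL a (F.opC x) - F.opL a x := by
  induction x using TensorProduct.induction_on with
  | zero => simp
  | add x y hx hy => simp only [map_add, hx, hy]; abel
  | tmul q φ =>
    simp [opL_tmul, opC_tmul, sum_i_e_e, TensorProduct.tmul_sub, Finset.sum_sub_distrib]

theorem opC_opδ (a : Fin β) (x : PolyForm β n α Λ) :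
    F.opC (F.opδ a x) = F.opδ a (F.opC x) + F.opδ a x := by
  induction x using TensorProduct.induction_on with
  | zero => simp
  | add x y hx hy => simp only [map_add, hx, hy]; abel
  | tmul q φ =>
    simp [opδ_tmul, opC_tmul, sum_i_e_i, TensorProduct.tmul_add, Finset.sum_add_distrib]

theorem opC_opE (a b : Fin β) (x : PolyForm β n α Λ) :
    F.opC (opE a b x) = opE a b (F.opC x) := by
  induction x using TensorProduct.induction_on with
  | zero => simp
  | add x y hx hy => simp only [map_add, hx, hy]
  | tmul q φ => simp [opE_tmul, opC_tmul]

theorem opL_opL (a b : Fin β) (x : PolyForm β n α Λ) :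
    F.opL a (F.opL b x) = -F.opL b (F.opL a x) := by
  induction x using TensorProduct.induction_on with
  | zero => simp
  | add x y hx hy => simp only [map_add, hx, hy]; abel
  | tmul q φ =>
    simp only [opL_tmul, map_sum]
    rw [Finset.sum_comm, ← Finset.sum_neg_distrib]
    refine Finset.sum_congr rfl fun j _ => ?_
    rw [← Finset.sum_neg_distrib]
    refine Finset.sum_congr rfl fun k _ => ?_
    rw [F.e_e, TensorProduct.tmul_neg, mul_left_comm]

/-- Every polynomial with values in `Λ` is a finite sum of monomials with coefficients in `Λ`. -/
theorem exists_eq_sum_monomial (x : PolyForm β n α Λ) :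
    ∃ c : (Fin β × (Fin n ⊕ α) →₀ ℕ) →₀ Λ,
      (c.sum fun u φ => MvPolynomial.monomial u (1 : ℝ) ⊗ₜ[ℝ] φ) = x := by
  simpa using TensorProduct.eq_repr_basis_left (MvPolynomial.basisMonomials _ ℝ) x

theorem coeff_eq_zero_of_sum_monomial (s : Finset (Fin β × (Fin n ⊕ α) →₀ ℕ))
    (c : (Fin β × (Fin n ⊕ α) →₀ ℕ) → Λ)
    (h : (∑ u ∈ s, MvPolynomial.monomial u (1 : ℝ) ⊗ₜ[ℝ] c u : PolyForm β n α Λ) = 0) :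
    ∀ u ∈ s, c u = 0 := by
  classical
  intro u hu
  let d : (Fin β × (Fin n ⊕ α) →₀ ℕ) →₀ Λ :=
    Finsupp.onFinset s (fun u => if u ∈ s then c u else 0) fun v hv => by
      by_contra hvs; simp [hvs] at hv
  have hd : d = 0 := by
    refine TensorProduct.sum_tmul_basis_left_eq_zero
      (MvPolynomial.basisMonomials (Fin β × (Fin n ⊕ α)) ℝ) d ?_
    rw [Finsupp.onFinset_sum _ fun _ => TensorProduct.tmul_zero _ _]
    refine Eq.trans (Finset.sum_congr rfl fun v hv => ?_) h
    simp [hv]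
  have := DFunLike.congr_fun hd u
  simpa [d, hu] using this

theorem opE_monomial (a : Fin β) (u : Fin β × (Fin n ⊕ α) →₀ ℕ) (φ : Λ) :
    opE a a (MvPolynomial.monomial u (1 : ℝ) ⊗ₜ[ℝ] φ) =
      ((∑ j : Fin n, u (a, Sum.inl j) : ℕ) : ℝ) •
        (MvPolynomial.monomial u (1 : ℝ) ⊗ₜ[ℝ] φ) := by
  rw [opE_tmul]
  simp only [MvPolynomial.X_mul_pderiv_monomial]
  rw [← TensorProduct.sum_tmul, ← Finset.sum_smul, Nat.cast_smul_eq_nsmul]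
  rfl

theorem opE_self_nonneg (a : Fin β) (x : PolyForm β n α Λ) (t : ℝ) (ht : t < 0)
    (hx : opE a a x = t • x) : x = 0 := by
  obtain ⟨c, rfl⟩ := exists_eq_sum_monomial x
  have h := coeff_eq_zero_of_sum_monomial c.support
    (fun u => (((∑ j : Fin n, u (a, Sum.inl j) : ℕ) : ℝ) - t) • c u) (by
      rw [← sub_eq_zero] at hx
      rw [← hx]
      simp only [Finsupp.sum, map_sum, opE_monomial, Finset.smul_sum, ← Finset.sum_sub_distrib,
        TensorProduct.tmul_smul, TensorProduct.tmul_sub, sub_smul])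
  refine Finset.sum_eq_zero fun u hu => ?_
  have h1 := h u hu
  have h2 : (0 : ℝ) < ((∑ j : Fin n, u (a, Sum.inl j) : ℕ) : ℝ) - t := by
    have : (0 : ℝ) ≤ ((∑ j : Fin n, u (a, Sum.inl j) : ℕ) : ℝ) := Nat.cast_nonneg _
    linarith
  simp [(smul_eq_zero.mp h1).resolve_left h2.ne']

theorem opL_anticomm : Anticomm (F.opL (β := β) (α := α)) where
  swap a b := LinearMap.ext fun x => F.opL_opL a b x
  sq a := LinearMap.ext fun x => by
    have h := F.opL_opL a a x
    rw [eq_neg_iff_add_eq_zero, ← two_smul ℝ] at h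
    exact (smul_eq_zero.mp h).resolve_left two_ne_zero

variable (β α) in
/-- The polarization operators on polynomials with values in exterior forms. -/
def polarization : PolarizationAction β (PolyForm β n α Λ) where
  L := F.opL
  δ := F.opδ
  E := opE
  C := F.opC
  anticomm := F.opL_anticomm
  L_δ := F.opL_opδ
  E_L := F.opE_opL
  E_δ := F.opE_opδ
  E_E := opE_opE
  C_L := F.opC_opL
  C_δ := F.opC_opδ
  C_E := F.opC_opE
  nonneg := opE_self_nonneg

/-! ### Evaluation -/

/-- The value of a polynomial at given covectors and parameters. -/
def evalForm (l : Fin β → Fin n ⊕ α → ℝ) : PolyForm β n α Λ →ₗ[ℝ] Λ :=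
  (TensorProduct.lid ℝ Λ).toLinearMap ∘ₗ
    TensorProduct.map (MvPolynomial.aeval fun p => l p.1 p.2).toLinearMap LinearMap.id

theorem evalForm_tmul (l : Fin β → Fin n ⊕ α → ℝ) (q : MvPolynomial (Fin β × (Fin n ⊕ α)) ℝ)
    (φ : Λ) : evalForm l (q ⊗ₜ[ℝ] φ) = (MvPolynomial.aeval fun p => l p.1 p.2) q • φ := rfl

theorem evalForm_opL (l : Fin β → Fin n ⊕ α → ℝ) (a : Fin β) (x : PolyForm β n α Λ) :
    evalForm l (F.opL a x) = ∑ j : Fin n, l a (Sum.inl j) • F.e (Sum.inl j) (evalForm l x) := by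
  induction x using TensorProduct.induction_on with
  | zero => simp
  | add x y hx hy => simp only [map_add, hx, hy, smul_add, Finset.sum_add_distrib]
  | tmul q φ => simp [opL_tmul, evalForm_tmul, mul_smul]

theorem eq_zero_of_evalForm (x : PolyForm β n α Λ) (h : ∀ l, evalForm l x = 0) : x = 0 := by
  obtain ⟨c, rfl⟩ := exists_eq_sum_monomial x
  refine Finset.sum_eq_zero fun u hu => ?_
  suffices c u = 0 by simp [this]
  rw [← Module.forall_dual_apply_eq_zero_iff ℝ]
  intro f
  have hp : (∑ v ∈ c.support, MvPolynomial.monomial v (f (c v)) :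
      MvPolynomial (Fin β × (Fin n ⊕ α)) ℝ) = 0 := by
    refine MvPolynomial.funext fun l => ?_
    have := congrArg f (h fun a j => l (a, j))
    simp only [Finsupp.sum, map_sum, evalForm_tmul, MvPolynomial.aeval_monomial, map_zero,
      map_smul, map_one, one_mul, smul_eq_mul] at this
    simp only [map_sum, MvPolynomial.eval_monomial, map_zero]
    rw [← this]
    exact Finset.sum_congr rfl fun v _ => mul_comm _ _
  have := congrArg (MvPolynomial.coeff u) hp
  classical
  simp only [MvPolynomial.coeff_sum, MvPolynomial.coeff_monomial, MvPolynomial.coeff_zero,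
    Finset.sum_ite_eq', hu, if_true] at this
  exact this

end FockModule

namespace FockModule

/-! ### From polynomials back to exterior forms -/

variable {n β : ℕ} {α τ γ : Type*} [DecidableEq τ] [DecidableEq γ] [DecidableEq α] [Fintype τ]
  {Λ : Type*} [AddCommGroup Λ] [Module ℝ Λ] (F : FockModule (Fin n ⊕ (τ ⊕ γ)) Λ)
  (μ : τ → Multiset (Fin n ⊕ α))

/-- The creation operator of the index `k` with `μ k = M`, and `0` if there is none. -/
def dyOp (M : Multiset (Fin n ⊕ α)) : Module.End ℝ Λ :=
  ∑ k : τ, if μ k = M then F.e (Sum.inr (Sum.inl k)) else 0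

variable {μ} in
theorem dyOp_apply (hμ : Function.Injective μ) (k : τ) :
    F.dyOp μ (μ k) = F.e (Sum.inr (Sum.inl k)) := by
  simp [dyOp, hμ.eq_iff]

theorem dyOp_anti (M M' : Multiset (Fin n ⊕ α)) :
    F.dyOp μ M * F.dyOp μ M' = -(F.dyOp μ M' * F.dyOp μ M) := by
  simp only [dyOp, Finset.sum_mul, Finset.mul_sum]
  rw [Finset.sum_comm, ← Finset.sum_neg_distrib]
  refine Finset.sum_congr rfl fun k _ => ?_
  rw [← Finset.sum_neg_distrib]
  refine Finset.sum_congr rfl fun k' _ => ?_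
  split_ifs <;> simp [F.e_anticomm.swap (Sum.inr (Sum.inl k)) (Sum.inr (Sum.inl k'))]

theorem dyOp_e (M : Multiset (Fin n ⊕ α)) (j : Fin n) (x : Λ) :
    F.dyOp μ M (F.e (Sum.inl j) x) = -F.e (Sum.inl j) (F.dyOp μ M x) := by
  simp only [dyOp, LinearMap.sum_apply, map_sum, ← Finset.sum_neg_distrib]
  refine Finset.sum_congr rfl fun k _ => ?_
  split_ifs <;> simp [F.e_e _ (Sum.inl j)]

/-- The multi-index of the variables attached to `a` in the exponent `u`. -/
def idx (u : Fin β × (Fin n ⊕ α) →₀ ℕ) (a : Fin β) : Multiset (Fin n ⊕ α) :=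
  Finsupp.toMultiset (u.curry a)

theorem idx_single_add (a b : Fin β) (s : Fin n ⊕ α) (u : Fin β × (Fin n ⊕ α) →₀ ℕ) :
    idx (Finsupp.single (a, s) 1 + u) b = if a = b then s ::ₘ idx u b else idx u b := by
  have h : (Finsupp.single (a, s) 1 + u).curry b =
      (if a = b then Finsupp.single s 1 else 0) + u.curry b := by
    ext t
    by_cases h : a = b
    · subst h; simp [Finsupp.curry_apply, Finsupp.single_apply]
    · simp [Finsupp.curry_apply, h]
  rw [idx, h, map_add]
  split_ifs with h
  · simp [idx]
  · simp [idx]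

/-- The coefficient extraction `l₁^{J₁} ⋯ l_k^{J_k} ⊗ φ ↦ dy_{J₁} ∧ ⋯ ∧ dy_{J_k} ∧ φ`, where the
list `m` prescribes the covectors and their order. -/
def extract (m : List (Fin β)) : PolyForm β n α Λ →ₗ[ℝ] Λ :=
  TensorProduct.lift ((MvPolynomial.basisMonomials (Fin β × (Fin n ⊕ α)) ℝ).constr ℝ
    ((m.map fun a u => F.dyOp μ (idx u a)).prod))

theorem extract_monomial (m : List (Fin β)) (u : Fin β × (Fin n ⊕ α) →₀ ℕ) (φ : Λ) :
    F.extract μ m (MvPolynomial.monomial u 1 ⊗ₜ[ℝ] φ) =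
      ((m.map fun a => F.dyOp μ (idx u a)).prod) φ := by
  have h := (MvPolynomial.basisMonomials (Fin β × (Fin n ⊕ α)) ℝ).constr_basis ℝ
    ((m.map fun a u => F.dyOp μ (idx u a)).prod) u
  rw [MvPolynomial.coe_basisMonomials] at h
  rw [extract, TensorProduct.lift.tmul, h, Pi.list_prod_apply, List.map_map]
  rfl

/-- Two linear maps on `PolyForm` agree if they agree on monomials. -/
theorem linearMap_ext_monomial {Λ' : Type*} [AddCommGroup Λ'] [Module ℝ Λ']
    {A B : PolyForm β n α Λ →ₗ[ℝ] Λ'}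
    (h : ∀ u φ, A (MvPolynomial.monomial u 1 ⊗ₜ[ℝ] φ) = B (MvPolynomial.monomial u 1 ⊗ₜ[ℝ] φ)) :
    A = B := by
  refine LinearMap.ext fun x => ?_
  obtain ⟨c, rfl⟩ := exists_eq_sum_monomial x
  simp only [Finsupp.sum, map_sum, h]

theorem extract_perm {m m' : List (Fin β)} (h : m.Perm m') :
    F.extract μ m = F.extract μ m' ∨ F.extract μ m = -F.extract μ m' := by
  have hA : Anticomm (fun a (u : Fin β × (Fin n ⊕ α) →₀ ℕ) => F.dyOp μ (idx u a)) := by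
    refine ⟨fun a => ?_, fun a b => ?_⟩
    · funext u
      have h := F.dyOp_anti μ (idx u a) (idx u a)
      rw [eq_neg_iff_add_eq_zero, ← two_smul ℝ] at h
      exact (smul_eq_zero.mp h).resolve_left two_ne_zero
    · funext u
      exact F.dyOp_anti μ _ _
  have key := hA.prod_perm h
  refine key.imp (fun e => ?_) (fun e => ?_)
  · rw [extract, extract, e]
  · refine linearMap_ext_monomial fun u φ => ?_
    have hu := congrFun e u
    rw [Pi.neg_apply, Pi.list_prod_apply, Pi.list_prod_apply, List.map_map, List.map_map] at hu
    rw [LinearMap.neg_apply, extract_monomial, extract_monomial]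
    exact congrArg (fun T : Module.End ℝ Λ => T φ) hu

/-- The polynomials in which the variables attached to `a` occur with multi-index `M`. -/
def fixedIdx (a : Fin β) (M : Multiset (Fin n ⊕ α)) : Submodule ℝ (PolyForm β n α Λ) :=
  Submodule.span ℝ {z | ∃ u φ, idx u a = M ∧ z = MvPolynomial.monomial u 1 ⊗ₜ[ℝ] φ}

theorem X_mul_monomial (s : Fin β × (Fin n ⊕ α)) (u : Fin β × (Fin n ⊕ α) →₀ ℕ) :
    MvPolynomial.X s * MvPolynomial.monomial u (1 : ℝ) =
      MvPolynomial.monomial (Finsupp.single s 1 + u) 1 := by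
  rw [MvPolynomial.X, MvPolynomial.monomial_mul, one_mul]

variable {F μ} {a b : Fin β} {M : Multiset (Fin n ⊕ α)} {z : PolyForm β n α Λ}

theorem extract_cons (m : List (Fin β)) (hz : z ∈ fixedIdx a M) :
    F.extract μ (a :: m) z = F.dyOp μ M (F.extract μ m z) := by
  induction hz using Submodule.span_induction with
  | mem x h =>
    obtain ⟨u, φ, rfl, rfl⟩ := h
    rw [extract_monomial, extract_monomial]; rfl
  | zero => simp
  | add x y _ _ hx hy => rw [map_add, map_add, map_add, hx, hy]
  | smul t x _ hx => rw [map_smul, map_smul, map_smul, hx]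

theorem extract_X (m : List (Fin β)) (ha : a ∉ m) (s : Fin n ⊕ α) (z : PolyForm β n α Λ) :
    F.extract μ m (polyMul (MvPolynomial.X (a, s)) z) = F.extract μ m z := by
  have : F.extract μ m ∘ₗ polyMul (MvPolynomial.X (a, s)) = F.extract μ m := by
    refine linearMap_ext_monomial fun u φ => ?_
    rw [LinearMap.comp_apply, polyMul_tmul, X_mul_monomial, extract_monomial, extract_monomial]
    congr 2
    refine List.map_congr_left fun b hb => ?_
    rw [idx_single_add, if_neg (fun h : a = b => ha (h ▸ hb))]
  exact LinearMap.congr_fun this z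

theorem extract_e (m : List (Fin β)) (j : Fin n) (z : PolyForm β n α Λ) :
    F.extract μ m (coeffOp (F.e (Sum.inl j)) z) =
      (-1 : ℝ) ^ m.length • F.e (Sum.inl j) (F.extract μ m z) := by
  have : F.extract μ m ∘ₗ coeffOp (F.e (Sum.inl j)) =
      (-1 : ℝ) ^ m.length • (F.e (Sum.inl j) ∘ₗ F.extract μ m) := by
    refine linearMap_ext_monomial fun u φ => ?_
    rw [LinearMap.comp_apply, coeffOp_tmul, extract_monomial, LinearMap.smul_apply,
      LinearMap.comp_apply, extract_monomial]
    induction m with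
    | nil => simp
    | cons b m ih =>
      simp only [List.map_cons, List.prod_cons, Module.End.mul_apply, ih, map_smul, dyOp_e,
        List.length_cons, pow_succ]
      simp
  exact LinearMap.congr_fun this z

theorem map_mem_fixedIdx {M' : Multiset (Fin n ⊕ α)} {A : Module.End ℝ (PolyForm β n α Λ)}
    (h : ∀ u φ, idx u a = M → A (MvPolynomial.monomial u 1 ⊗ₜ[ℝ] φ) ∈ fixedIdx a M')
    (hz : z ∈ fixedIdx a M) : A z ∈ fixedIdx a M' := by
  induction hz using Submodule.span_induction with
  | mem x hx => obtain ⟨u, φ, hu, rfl⟩ := hx; exact h u φ hu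
  | zero => simp
  | add x y _ _ hx hy => rw [map_add]; exact Submodule.add_mem _ hx hy
  | smul t x _ hx => rw [map_smul]; exact Submodule.smul_mem _ _ hx

theorem X_mem_fixedIdx (s : Fin n ⊕ α) (hz : z ∈ fixedIdx a M) :
    polyMul (MvPolynomial.X (a, s)) z ∈ fixedIdx a (s ::ₘ M) :=
  map_mem_fixedIdx (fun u φ hu => by
    rw [polyMul_tmul, X_mul_monomial]
    exact Submodule.subset_span ⟨_, φ, by rw [idx_single_add, if_pos rfl, hu], rfl⟩) hz

theorem X_mem_fixedIdx_of_ne (hb : b ≠ a) (s : Fin n ⊕ α) (hz : z ∈ fixedIdx a M) :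
    polyMul (MvPolynomial.X (b, s)) z ∈ fixedIdx a M :=
  map_mem_fixedIdx (fun u φ hu => by
    rw [polyMul_tmul, X_mul_monomial]
    exact Submodule.subset_span ⟨_, φ, by rw [idx_single_add, if_neg hb, hu], rfl⟩) hz

theorem coeffOp_mem_fixedIdx (T : Module.End ℝ Λ) (hz : z ∈ fixedIdx a M) :
    coeffOp T z ∈ fixedIdx a M :=
  map_mem_fixedIdx (fun u φ hu => Submodule.subset_span ⟨u, T φ, hu, rfl⟩) hz

theorem prod_opL_mem_fixedIdx (l : List (Fin β)) (ha : a ∉ l) (hz : z ∈ fixedIdx a M) :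
    (l.map F.opL).prod z ∈ fixedIdx a M := by
  induction l with
  | nil => simpa using hz
  | cons b l ih =>
    have hb : b ≠ a := fun h => ha (h ▸ List.mem_cons_self)
    have ih := ih fun h => ha (List.mem_cons_of_mem _ h)
    rw [List.map_cons, List.prod_cons, Module.End.mul_apply, opL, LinearMap.sum_apply]
    exact Submodule.sum_mem _ fun j _ => X_mem_fixedIdx_of_ne hb _ (coeffOp_mem_fixedIdx _ ih)

variable (F μ)

/-- The operator of exterior multiplication by `∑ j, dy_{Mj} ∧ dx^j`. -/
def curvOp (M : Multiset (Fin n ⊕ α)) : Module.End ℝ Λ :=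
  ∑ j : Fin n, F.dyOp μ (Sum.inl j ::ₘ M) * F.e (Sum.inl j)

/-- The multiples of products of `s` of the forms `∑ j, dy_{Mj} ∧ dx^j`. -/
def curvIdeal : ℕ → Submodule ℝ Λ
  | 0 => ⊤
  | s + 1 => ⨆ M, (curvIdeal s).map (F.curvOp μ M)

variable {F μ}

/-- Extraction turns each factor `L a = ∑ j, l_{aj} dx^j ∧ ·` into, up to sign, a factor
`∑ j, dy_{Mj} ∧ dx^j ∧ ·`, where `M` is the exponent of `l_a` in the monomial to
which `L a` is applied. -/
theorem extract_prod_opL (l m : List (Fin β)) (h : (l ++ m).Nodup)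
    (u : Fin β × (Fin n ⊕ α) →₀ ℕ) (φ : Λ) :
    F.extract μ (l ++ m) ((l.map F.opL).prod (MvPolynomial.monomial u 1 ⊗ₜ[ℝ] φ)) ∈
      F.curvIdeal μ l.length := by
  induction l with
  | nil => exact Submodule.mem_top
  | cons a l ih =>
    rw [List.cons_append, List.nodup_cons] at h
    have ih := ih h.2
    have hal : a ∉ l := fun h' => h.1 (List.mem_append_left _ h')
    set y := (l.map F.opL).prod (MvPolynomial.monomial u (1 : ℝ) ⊗ₜ[ℝ] φ) with hy
    have hyZ : y ∈ fixedIdx a (idx u a) :=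
      prod_opL_mem_fixedIdx l hal (Submodule.subset_span ⟨u, φ, rfl, rfl⟩)
    have key : F.extract μ (a :: (l ++ m)) (F.opL a y) =
        (-1 : ℝ) ^ (l ++ m).length • F.curvOp μ (idx u a) (F.extract μ (l ++ m) y) := by
      rw [opL, LinearMap.sum_apply, map_sum, curvOp, LinearMap.sum_apply, Finset.smul_sum]
      refine Finset.sum_congr rfl fun j _ => ?_
      rw [Module.End.mul_apply, extract_cons _ (X_mem_fixedIdx _ (coeffOp_mem_fixedIdx _ hyZ)),
        extract_X _ h.1, extract_e, map_smul, Module.End.mul_apply]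
    rw [List.map_cons, List.prod_cons, Module.End.mul_apply, ← hy, List.cons_append, key]
    exact Submodule.smul_mem _ _ (Submodule.mem_iSup_of_mem (idx u a) ⟨_, ih, rfl⟩)

theorem extract_images {s : ℕ} {z : PolyForm β n α Λ} (hz : z ∈ (F.polarization β α).images s) :
    F.extract μ (List.finRange β) z ∈ F.curvIdeal μ s := by
  refine Submodule.iSup_induction _
    (motive := fun z => F.extract μ (List.finRange β) z ∈ F.curvIdeal μ s) hz ?_ ?_ ?_
  · rintro ⟨l, hl, rfl⟩ _ ⟨y, rfl⟩
    obtain ⟨c, rfl⟩ := exists_eq_sum_monomial y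
    simp only [Finsupp.sum, map_sum]
    refine Submodule.sum_mem _ fun u _ => ?_
    let m := (List.finRange β).filter (· ∉ l)
    have hnd : (l ++ m).Nodup := by
      refine List.Nodup.append hl ((List.nodup_finRange β).filter _) fun a h h' => ?_
      simp [m, h] at h'
    have hp : (List.finRange β).Perm (l ++ m) :=
      (List.perm_ext_iff_of_nodup (List.nodup_finRange β) hnd).mpr fun a => by simp [m, em]
    rcases F.extract_perm μ hp with e | e <;> rw [e]
    · exact extract_prod_opL l m hnd u (c u)
    · exact Submodule.neg_mem _ (extract_prod_opL l m hnd u (c u))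
  · simp
  · intro x y hx hy
    rw [map_add]; exact Submodule.add_mem _ hx hy

/-! ### The polynomial attached to a form -/

variable (F μ)

/-- The contraction with the variable vector `∑ k, l_a^{μ k} ∂_k`. -/
def opT (a : Fin β) : Module.End ℝ (PolyForm β n α Λ) :=
  ∑ k : τ, polyMul ((μ k).map fun s => MvPolynomial.X (a, s)).prod *
    coeffOp (F.i (Sum.inr (Sum.inl k)))

variable {F μ}

theorem polyMul_mul (p q : MvPolynomial (Fin β × (Fin n ⊕ α)) ℝ) :
    (polyMul (p * q) : Module.End ℝ (PolyForm β n α Λ)) = polyMul p * polyMul q := by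
  refine linearMap_ext_monomial fun u φ => ?_
  simp [mul_assoc]

theorem polyMul_one : (polyMul 1 : Module.End ℝ (PolyForm β n α Λ)) = 1 :=
  linearMap_ext_monomial fun u φ => by simp

theorem prod_X_mem_fixedIdx (N : Multiset (Fin n ⊕ α)) (hz : z ∈ fixedIdx a M) :
    polyMul (N.map fun s => MvPolynomial.X (a, s)).prod z ∈ fixedIdx a (N + M) := by
  induction N using Multiset.induction_on with
  | empty => simpa [polyMul_one] using hz
  | cons s N ih =>
    rw [Multiset.map_cons, Multiset.prod_cons, polyMul_mul, Multiset.cons_add]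
    exact X_mem_fixedIdx s ih

theorem prod_X_mem_fixedIdx_of_ne (hb : b ≠ a) (N : Multiset (Fin n ⊕ α))
    (hz : z ∈ fixedIdx a M) :
    polyMul (N.map fun s => MvPolynomial.X (b, s)).prod z ∈ fixedIdx a M := by
  induction N using Multiset.induction_on with
  | empty => simpa [polyMul_one] using hz
  | cons s N ih =>
    rw [Multiset.map_cons, Multiset.prod_cons, polyMul_mul]
    exact X_mem_fixedIdx_of_ne hb s ih

theorem extract_prod_X (m : List (Fin β)) (ha : a ∉ m) (N : Multiset (Fin n ⊕ α))
    (z : PolyForm β n α Λ) :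
    F.extract μ m (polyMul (N.map fun s => MvPolynomial.X (a, s)).prod z) = F.extract μ m z := by
  induction N using Multiset.induction_on with
  | empty => simp [polyMul_one]
  | cons s N ih =>
    rw [Multiset.map_cons, Multiset.prod_cons, polyMul_mul, Module.End.mul_apply,
      extract_X m ha, ih]

theorem prod_opT_mem_fixedIdx (l : List (Fin β)) (ha : a ∉ l) (hz : z ∈ fixedIdx a M) :
    (l.map (F.opT μ)).prod z ∈ fixedIdx a M := by
  induction l with
  | nil => simpa using hz
  | cons b l ih =>
    have hb : b ≠ a := fun h => ha (h ▸ List.mem_cons_self)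
    have ih := ih fun h => ha (List.mem_cons_of_mem _ h)
    rw [List.map_cons, List.prod_cons, Module.End.mul_apply, opT, LinearMap.sum_apply]
    exact Submodule.sum_mem _ fun k _ =>
      prod_X_mem_fixedIdx_of_ne hb _ (coeffOp_mem_fixedIdx _ ih)

theorem coeffOp_polyMul (T : Module.End ℝ Λ) (p : MvPolynomial (Fin β × (Fin n ⊕ α)) ℝ)
    (z : PolyForm β n α Λ) : coeffOp T (polyMul p z) = polyMul p (coeffOp T z) := by
  induction z using TensorProduct.induction_on with
  | zero => simp
  | add x y hx hy => simp only [map_add, hx, hy]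
  | tmul q φ => simp

theorem coeffOp_coeffOp (T S : Module.End ℝ Λ) (z : PolyForm β n α Λ) :
    coeffOp T (coeffOp S z) = coeffOp (T * S) z := by
  induction z using TensorProduct.induction_on with
  | zero => simp
  | add x y hx hy => simp only [map_add, hx, hy]
  | tmul q φ => simp

theorem coeffOp_neg (T : Module.End ℝ Λ) (z : PolyForm β n α Λ) :
    coeffOp (-T) z = -coeffOp T z := by
  induction z using TensorProduct.induction_on with
  | zero => simp
  | add x y hx hy => simp only [map_add, hx, hy, neg_add]
  | tmul q φ => simp [TensorProduct.tmul_neg]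

theorem coeffOp_i_prod_opT (k : τ) (l : List (Fin β)) (φ : Λ) :
    coeffOp (F.i (Sum.inr (Sum.inl k))) ((l.map (F.opT μ)).prod (1 ⊗ₜ[ℝ] φ)) =
      (-1 : ℝ) ^ l.length • (l.map (F.opT μ)).prod (1 ⊗ₜ[ℝ] F.i (Sum.inr (Sum.inl k)) φ) := by
  induction l with
  | nil => simp
  | cons b l ih =>
    have hcomm : ∀ z, coeffOp (F.i (Sum.inr (Sum.inl k))) (F.opT μ b z) =
        -F.opT μ b (coeffOp (F.i (Sum.inr (Sum.inl k))) z) := by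
      intro z
      simp only [opT, LinearMap.sum_apply, map_sum, Module.End.mul_apply, coeffOp_polyMul,
        coeffOp_coeffOp, ← Finset.sum_neg_distrib]
      refine Finset.sum_congr rfl fun k' _ => ?_
      rw [F.i_anticomm.swap, coeffOp_neg, map_neg]
    rw [List.map_cons, List.prod_cons, Module.End.mul_apply, hcomm, ih, map_smul,
      List.length_cons, pow_succ, Module.End.mul_apply, mul_neg_one]
    exact (neg_smul _ _).symm

/-- Extracting the coefficients of the polynomial attached to a form returns a multiple of the form,
if the form is homogeneous of the matching degree in the `dy`. -/
theorem exists_extract_prod_opT (hμ : Function.Injective μ) (b : ℕ) : ∃ c : ℝ, c ≠ 0 ∧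
    ∀ (m : List (Fin β)) (y : Λ), m.Nodup → m.length = b →
      ∑ k : τ, F.e (Sum.inr (Sum.inl k)) (F.i (Sum.inr (Sum.inl k)) y) = (b : ℝ) • y →
      F.extract μ m ((m.map (F.opT μ)).prod (1 ⊗ₜ[ℝ] y)) = c • y := by
  induction b with
  | zero =>
    refine ⟨1, one_ne_zero, fun m y _ hm _ => ?_⟩
    rw [List.length_eq_zero_iff] at hm
    subst hm
    have := F.extract_monomial μ ([] : List (Fin β)) 0 y
    simpa using this
  | succ b ih =>
    obtain ⟨c, hc, ih⟩ := ih
    refine ⟨(-1) ^ b * c * (b + 1), mul_ne_zero (mul_ne_zero (by simp) hc)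
      (by positivity), fun m y hm hlen hy => ?_⟩
    obtain ⟨a, m, rfl⟩ := List.exists_cons_of_length_eq_add_one hlen
    rw [List.nodup_cons] at hm
    simp only [List.length_cons, add_left_inj] at hlen
    have h1 : (1 ⊗ₜ[ℝ] y : PolyForm β n α Λ) ∈ fixedIdx a 0 :=
      Submodule.subset_span ⟨0, y, map_zero _, rfl⟩
    have h2 := prod_opT_mem_fixedIdx (F := F) (μ := μ) m hm.1 h1
    have hterm : ∀ k : τ, F.extract μ (a :: m)
        (polyMul ((μ k).map fun s => MvPolynomial.X (a, s)).prod
          (coeffOp (F.i (Sum.inr (Sum.inl k))) ((m.map (F.opT μ)).prod (1 ⊗ₜ[ℝ] y)))) =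
        ((-1) ^ b * c) • F.e (Sum.inr (Sum.inl k)) (F.i (Sum.inr (Sum.inl k)) y) := by
      intro k
      have h3 : ∑ k' : τ, F.e (Sum.inr (Sum.inl k')) (F.i (Sum.inr (Sum.inl k'))
          (F.i (Sum.inr (Sum.inl k)) y)) = (b : ℝ) • F.i (Sum.inr (Sum.inl k)) y := by
        have := congrArg (F.i (Sum.inr (Sum.inl k))) hy
        rw [map_sum, map_smul] at this
        have h4 : ∀ k' : τ, F.e (Sum.inr (Sum.inl k')) (F.i (Sum.inr (Sum.inl k'))
            (F.i (Sum.inr (Sum.inl k)) y)) =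
            F.i (Sum.inr (Sum.inl k)) (F.e (Sum.inr (Sum.inl k')) (F.i (Sum.inr (Sum.inl k')) y)) -
              if k = k' then F.i (Sum.inr (Sum.inl k)) y else 0 := by
          intro k'
          rw [F.i_e, F.i_i (Sum.inr (Sum.inl k')), map_neg]
          by_cases h : k = k'
          · subst h; simp
          · simp [h]
        simp only [h4, Finset.sum_sub_distrib, this]
        simp [add_smul]
      rw [extract_cons m (prod_X_mem_fixedIdx _ (coeffOp_mem_fixedIdx _ h2)), add_zero,
        extract_prod_X m hm.1, coeffOp_i_prod_opT, map_smul, ih m _ hm.2 hlen h3, dyOp_apply F hμ,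
        hlen, smul_smul, map_smul]
    rw [List.map_cons, List.prod_cons, Module.End.mul_apply, opT, LinearMap.sum_apply, map_sum]
    simp only [Module.End.mul_apply]
    rw [Finset.sum_congr rfl fun k _ => hterm k, ← Finset.smul_sum, hy, smul_smul]
    push_cast; rfl

end FockModule

namespace FockModule

variable {n β : ℕ} {α τ γ : Type*} [DecidableEq τ] [DecidableEq γ] [DecidableEq α] [Fintype τ]
  {Λ : Type*} [AddCommGroup Λ] [Module ℝ Λ] {F : FockModule (Fin n ⊕ (τ ⊕ γ)) Λ}
  {μ : τ → Multiset (Fin n ⊕ α)}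

theorem opE_X (a b : Fin β) (s : Fin n ⊕ α) (z : PolyForm β n α Λ) :
    opE b b (polyMul (MvPolynomial.X (a, s)) z) =
      polyMul (MvPolynomial.X (a, s)) (opE b b z) +
        if b = a ∧ s.isLeft then polyMul (MvPolynomial.X (a, s)) z else 0 := by
  induction z using TensorProduct.induction_on with
  | zero => simp
  | add x y hx hy => simp only [map_add, hx, hy]; split_ifs <;> abel
  | tmul q φ =>
    rcases s with j | s
    · simp only [polyMul_tmul, opE_tmul, pderiv_X_mul, mul_add, TensorProduct.add_tmul,
        Finset.sum_add_distrib, map_sum]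
      refine congrArg₂ (· + ·) ?_ ?_
      · simp only [mul_left_comm]
      · by_cases h : b = a
        · subst h; simp [TensorProduct.ite_tmul]
        · simp [h, Ne.symm h]
    · have h : ∀ k : Fin n, MvPolynomial.pderiv (b, (Sum.inl k : Fin n ⊕ α))
          (MvPolynomial.X (a, Sum.inr s) * q) =
          MvPolynomial.X (a, Sum.inr s) * MvPolynomial.pderiv (b, Sum.inl k) q := by
        intro k
        rw [Derivation.leibniz, MvPolynomial.pderiv_X_of_ne (by simp)]
        simp
      simp only [polyMul_tmul, opE_tmul, h, map_sum, mul_left_comm]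
      simp

theorem opE_prod_X (a b : Fin β) (M : Multiset (Fin n ⊕ α)) (z : PolyForm β n α Λ) :
    opE b b (polyMul (M.map fun s => MvPolynomial.X (a, s)).prod z) =
      polyMul (M.map fun s => MvPolynomial.X (a, s)).prod (opE b b z) +
        if b = a then (M.countP (fun s => s.isLeft) : ℝ) •
          polyMul (M.map fun s => MvPolynomial.X (a, s)).prod z else 0 := by
  induction M using Multiset.induction_on with
  | empty => simp [polyMul_one]
  | cons s M ih =>
    rw [Multiset.map_cons, Multiset.prod_cons, polyMul_mul, Module.End.mul_apply, opE_X, ih]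
    by_cases h : b = a
    · by_cases hs : s.isLeft
      · simp [h, hs, add_smul, add_assoc]
      · simp [h, hs]
    · simp [h]

theorem opE_coeffOp (b : Fin β) (T : Module.End ℝ Λ) (z : PolyForm β n α Λ) :
    opE b b (coeffOp T z) = coeffOp T (opE b b z) := by
  induction z using TensorProduct.induction_on with
  | zero => simp
  | add x y hx hy => simp only [map_add, hx, hy]
  | tmul q φ => simp [opE_tmul]

theorem opT_mem_weight {r : ℕ} (hr : ∀ k, (μ k).countP (fun s => s.isLeft) = r) (a : Fin β)
    {w : (Fin β → ℤ) × ℤ} {z : PolyForm β n α Λ} (hz : z ∈ (F.polarization β α).weight w) :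
    F.opT μ a z ∈ (F.polarization β α).weight (w + (Pi.single a (r : ℤ), 0)) := by
  refine ⟨fun b => ?_, ?_⟩
  · have hz' : opE b b z = (w.1 b : ℝ) • z := hz.1 b
    change opE b b (F.opT μ a z) = _
    simp only [opT, LinearMap.sum_apply, Module.End.mul_apply, map_sum, opE_prod_X, opE_coeffOp,
      hz', hr, Finset.smul_sum]
    refine Finset.sum_congr rfl fun k _ => ?_
    by_cases h : b = a
    · subst h; simp [add_smul]
    · simp [h]
  · have hz' : F.opC z = (w.2 : ℝ) • z := hz.2
    change F.opC (F.opT μ a z) = _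
    have hcomm : ∀ k : τ, (∑ j : Fin n, F.i (Sum.inl j) * F.e (Sum.inl j)) *
        F.i (Sum.inr (Sum.inl k)) =
        F.i (Sum.inr (Sum.inl k)) * ∑ j : Fin n, F.i (Sum.inl j) * F.e (Sum.inl j) := by
      intro k
      rw [Finset.sum_mul, Finset.mul_sum]
      refine Finset.sum_congr rfl fun j _ => LinearMap.ext fun x => ?_
      simp only [Module.End.mul_apply]
      rw [F.e_i (Sum.inl j), F.i_i (Sum.inr (Sum.inl k))]
      simp
    have : F.opC (F.opT μ a z) = F.opT μ a (F.opC z) := by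
      simp only [opT, opC, LinearMap.sum_apply, Module.End.mul_apply, map_sum, coeffOp_polyMul,
        coeffOp_coeffOp, hcomm]
    rw [this, hz', map_smul]
    simp

theorem exists_prod_opT_mem_weight {r : ℕ} (hr : ∀ k, (μ k).countP (fun s => s.isLeft) = r)
    (l : List (Fin β)) {c : ℕ} {y : Λ}
    (hy : ∑ j : Fin n, F.i (Sum.inl j) (F.e (Sum.inl j) y) = (c : ℝ) • y) :
    ∃ w : (Fin β → ℤ) × ℤ, w.2 = c ∧
      (l.map (F.opT μ)).prod (1 ⊗ₜ[ℝ] y) ∈ (F.polarization β α).weight w := by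
  induction l with
  | nil =>
    refine ⟨(0, c), rfl, fun b => ?_, ?_⟩
    · change opE b b (1 ⊗ₜ[ℝ] y) = _
      simp [opE_tmul]
    · change F.opC (1 ⊗ₜ[ℝ] y) = _
      rw [opC_tmul, hy]
      simp
  | cons a l ih =>
    obtain ⟨w, hw, h⟩ := ih
    refine ⟨w + (Pi.single a (r : ℤ), 0), ?_, ?_⟩
    · rw [Prod.snd_add, hw, add_zero]
    · rw [List.map_cons, List.prod_cons, Module.End.mul_apply]
      exact opT_mem_weight hr a h

variable (F μ) in
/-- Exterior multiplication by the covector `∑ j, l_j dx^j`. -/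
def covec (l : Fin n ⊕ α → ℝ) : Module.End ℝ Λ := ∑ j : Fin n, l (Sum.inl j) • F.e (Sum.inl j)

variable (F μ) in
/-- The contraction with the vector `∑ k, l^{μ k} ∂_k`. -/
def powVec (l : Fin n ⊕ α → ℝ) : Module.End ℝ Λ :=
  ∑ k : τ, ((μ k).map l).prod • F.i (Sum.inr (Sum.inl k))

theorem evalForm_polyMul (l : Fin β → Fin n ⊕ α → ℝ) (p : MvPolynomial (Fin β × (Fin n ⊕ α)) ℝ)
    (z : PolyForm β n α Λ) : evalForm l (polyMul p z) =
      (MvPolynomial.aeval fun p => l p.1 p.2) p • evalForm l z := by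
  induction z using TensorProduct.induction_on with
  | zero => simp
  | add x y hx hy => simp only [map_add, hx, hy, smul_add]
  | tmul q φ => simp [evalForm_tmul, mul_smul]

theorem evalForm_coeffOp (l : Fin β → Fin n ⊕ α → ℝ) (T : Module.End ℝ Λ)
    (z : PolyForm β n α Λ) : evalForm l (coeffOp T z) = T (evalForm l z) := by
  induction z using TensorProduct.induction_on with
  | zero => simp
  | add x y hx hy => simp only [map_add, hx, hy]
  | tmul q φ => simp [evalForm_tmul]

theorem evalForm_prod_opT (l : Fin β → Fin n ⊕ α → ℝ) (m : List (Fin β)) (y : Λ) :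
    evalForm l ((m.map (F.opT μ)).prod (1 ⊗ₜ[ℝ] y)) =
      (m.map fun a => F.powVec μ (l a)).prod y := by
  induction m with
  | nil => simp [evalForm_tmul]
  | cons a m ih =>
    simp only [List.map_cons, List.prod_cons, Module.End.mul_apply]
    rw [← ih, opT, LinearMap.sum_apply, map_sum, powVec, LinearMap.sum_apply]
    refine Finset.sum_congr rfl fun k _ => ?_
    rw [Module.End.mul_apply, evalForm_polyMul, evalForm_coeffOp, LinearMap.smul_apply,
      map_multiset_prod, Multiset.map_map]
    simp

theorem evalForm_prod_opL (l : Fin β → Fin n ⊕ α → ℝ) (m : List (Fin β))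
    (z : PolyForm β n α Λ) :
    evalForm l ((m.map F.opL).prod z) = (m.map fun a => F.covec (l a)).prod (evalForm l z) := by
  induction m with
  | nil => simp
  | cons a m ih =>
    simp only [List.map_cons, List.prod_cons, Module.End.mul_apply]
    rw [← ih, evalForm_opL, covec, LinearMap.sum_apply]
    rfl

/-- A form `y`, homogeneous of degree `n - c` in the `dx` and of degree `β` in the `dy`, is a
multiple of products of `β + 1 - c` forms `∑ j, dy_{Mj} ∧ dx^j` as soon as
`l_{a₁} ∧ ⋯ ∧ l_{a_c} ∧ (t_1 ⌟ ⋯ t_β ⌟ y) = 0` for all covectors `l_1, …, l_β`, the vectors `t_a`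
with coordinates `l_a^{μ k}` and any `c` distinct indices. -/
theorem mem_curvIdeal {r : ℕ} (hμ : Function.Injective μ)
    (hr : ∀ k, (μ k).countP (fun s => s.isLeft) = r) {c : ℕ} (hc : c ≤ β) {y : Λ}
    (hy : ∑ j : Fin n, F.i (Sum.inl j) (F.e (Sum.inl j) y) = (c : ℝ) • y)
    (hy' : ∑ k : τ, F.e (Sum.inr (Sum.inl k)) (F.i (Sum.inr (Sum.inl k)) y) = (β : ℝ) • y)
    (H : ∀ (l : Fin β → Fin n ⊕ α → ℝ) (S : List (Fin β)), S.Nodup → S.length = c →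
      (S.map fun a => F.covec (l a)).prod
        (((List.finRange β).map fun a => F.powVec μ (l a)).prod y) = 0) :
    y ∈ F.curvIdeal μ (β + 1 - c) := by
  set P : PolyForm β n α Λ := ((List.finRange β).map (F.opT μ)).prod (1 ⊗ₜ[ℝ] y) with hP
  have hkill : ∀ S : List (Fin β), S.Nodup → S.length = c → (S.map F.opL).prod P = 0 := by
    intro S hS hSc
    refine eq_zero_of_evalForm _ fun l => ?_
    rw [evalForm_prod_opL, hP, evalForm_prod_opT]
    exact H l S hS hSc
  have hPmem : F.extract μ (List.finRange β) P ∈ F.curvIdeal μ (β + 1 - c) := by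
    rcases c with _ | c
    · have := hkill [] List.nodup_nil rfl
      simp only [List.map_nil, List.prod_nil, Module.End.one_apply] at this
      rw [this, map_zero]
      exact Submodule.zero_mem _
    · obtain ⟨w, hw, hPw⟩ := exists_prod_opT_mem_weight (F := F) hr (List.finRange β) hy
      have := PolarizationAction.mem_images hPw c (by omega) (by rw [hw]; push_cast; omega)
        fun S hS hSc => hkill S hS hSc
      rw [show β + 1 - (c + 1) = β - c by omega]
      exact extract_images this
  obtain ⟨t, ht, h⟩ := exists_extract_prod_opT (F := F) (β := β) hμ β
  rw [hP, h _ y (List.nodup_finRange β) (List.length_finRange) hy'] at hPmem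
  exact (Submodule.smul_mem_iff _ ht).mp hPmem

end FockModule

namespace FockModule

/-! ### Grading by the numbers of the three kinds of coordinate forms -/

variable {n : ℕ} {α τ γ : Type*} [DecidableEq τ] [DecidableEq γ] [DecidableEq α]
  [Fintype τ] [Fintype γ]
  {Λ : Type*} [AddCommGroup Λ] [Module ℝ Λ] {F : FockModule (Fin n ⊕ (τ ⊕ γ)) Λ}
  {μ : τ → Multiset (Fin n ⊕ α)}

/-- The degree of a coordinate form: `dx`, top order `dy`, and contact forms are counted
separately. -/
def gdeg : Fin n ⊕ (τ ⊕ γ) → ℤ × ℤ × ℤ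
  | Sum.inl _ => (1, 0, 0)
  | Sum.inr (Sum.inl _) => (0, 1, 0)
  | Sum.inr (Sum.inr _) => (0, 0, 1)

variable (F) in
/-- The homogeneous elements of degree `w`, as joint eigenvectors of the number operators. -/
def homog (w : ℤ × ℤ × ℤ) : Submodule ℝ Λ where
  carrier := {x | ∀ f : ℤ × ℤ × ℤ →+ ℝ, ∑ k, f (gdeg k) • F.e k (F.i k x) = f w • x}
  add_mem' := fun hx hy f => by
    simp only [map_add, smul_add, Finset.sum_add_distrib, hx f, hy f]
  zero_mem' := fun f => by simp
  smul_mem' := fun t x hx f => by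
    simp only [map_smul]
    rw [smul_comm, ← hx f, Finset.smul_sum]
    exact Finset.sum_congr rfl fun k _ => smul_comm _ _ _

theorem e_mem_homog {w : ℤ × ℤ × ℤ} {x : Λ} (l : Fin n ⊕ (τ ⊕ γ)) (hx : x ∈ F.homog w) :
    F.e l x ∈ F.homog (w + gdeg l) := by
  intro f
  have h : ∀ k, f (gdeg k) • F.e k (F.i k (F.e l x)) =
      F.e l (f (gdeg k) • F.e k (F.i k x)) + if k = l then f (gdeg l) • F.e l x else 0 := by
    intro k
    rw [F.i_e, map_sub, F.e_e k l]
    by_cases h : k = l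
    · subst h; simp [add_comm]
    · simp [h]
  simp only [h, Finset.sum_add_distrib, ← map_sum, hx f]
  simp [add_smul]

theorem i_mem_homog {w : ℤ × ℤ × ℤ} {x : Λ} (l : Fin n ⊕ (τ ⊕ γ)) (hx : x ∈ F.homog w) :
    F.i l x ∈ F.homog (w - gdeg l) := by
  intro f
  have h : ∀ k, f (gdeg k) • F.e k (F.i k (F.i l x)) =
      F.i l (f (gdeg k) • F.e k (F.i k x)) - if l = k then f (gdeg l) • F.i l x else 0 := by
    intro k
    rw [map_smul, F.i_e l k, F.i_i k l, map_neg]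
    by_cases h : l = k
    · subst h; simp [F.i_i_self]
    · simp [h]
  simp only [h, Finset.sum_sub_distrib, ← map_sum, hx f]
  simp [sub_smul]

theorem sum_inl_of_homog {w : ℤ × ℤ × ℤ} {x : Λ} (hx : x ∈ F.homog w) :
    ∑ j : Fin n, F.e (Sum.inl j) (F.i (Sum.inl j) x) = (w.1 : ℝ) • x := by
  have := hx ((Int.castAddHom ℝ).comp (AddMonoidHom.fst ℤ (ℤ × ℤ)))
  simpa [Fintype.sum_sum_type, gdeg] using this

theorem sum_inr_inl_of_homog {w : ℤ × ℤ × ℤ} {x : Λ} (hx : x ∈ F.homog w) :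
    ∑ k : τ, F.e (Sum.inr (Sum.inl k)) (F.i (Sum.inr (Sum.inl k)) x) = (w.2.1 : ℝ) • x := by
  have := hx ((Int.castAddHom ℝ).comp
    ((AddMonoidHom.fst ℤ ℤ).comp (AddMonoidHom.snd ℤ (ℤ × ℤ))))
  simpa [Fintype.sum_sum_type, gdeg] using this

theorem sum_inr_inr_of_homog {w : ℤ × ℤ × ℤ} {x : Λ} (hx : x ∈ F.homog w) :
    ∑ k : γ, F.e (Sum.inr (Sum.inr k)) (F.i (Sum.inr (Sum.inr k)) x) = (w.2.2 : ℝ) • x := by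
  have := hx ((Int.castAddHom ℝ).comp
    ((AddMonoidHom.snd ℤ ℤ).comp (AddMonoidHom.snd ℤ (ℤ × ℤ))))
  simpa [Fintype.sum_sum_type, gdeg] using this

theorem sum_i_e_of_homog {w : ℤ × ℤ × ℤ} {x : Λ} (hx : x ∈ F.homog w) :
    ∑ j : Fin n, F.i (Sum.inl j) (F.e (Sum.inl j) x) = ((n : ℝ) - w.1) • x := by
  simp [F.i_e, Finset.sum_sub_distrib, sum_inl_of_homog hx, sub_smul, Nat.cast_smul_eq_nsmul]

/-- An eigenvalue of a number operator is one of `0, …, N - 1` if the products of `N` annihilation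
operators vanish. -/
theorem eq_zero_of_num {ι : Type*} [Fintype ι] (f : ι → Fin n ⊕ (τ ⊕ γ))
    (hf : Function.Injective f) (N : ℕ) : ∀ (t : ℤ) (x : Λ),
    ∑ s, F.e (f s) (F.i (f s) x) = (t : ℝ) • x →
    (∀ l : List ι, l.length = N → (l.map fun s => F.i (f s)).prod x = 0) →
    (∀ j : ℕ, j < N → t ≠ j) → x = 0 := by
  classical
  induction N with
  | zero => intro t x _ h _; simpa using h [] rfl
  | succ N ih =>
    intro t x hx h ht
    have hi : ∀ s, F.i (f s) x = 0 := by
      intro s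
      refine ih (t - 1) (F.i (f s) x) ?_ (fun l hl => ?_) fun j hj h1 => ?_
      · have h1 : ∀ s', F.e (f s') (F.i (f s') (F.i (f s) x)) =
            F.i (f s) (F.e (f s') (F.i (f s') x)) - if s = s' then F.i (f s) x else 0 := by
          intro s'
          rw [F.i_e, F.i_i (f s'), map_neg]
          by_cases h : s = s'
          · subst h; simp
          · simp [hf.eq_iff, h]
        simp only [h1, Finset.sum_sub_distrib, ← map_sum, hx]
        simp [sub_smul]
      · simpa using h (l ++ [s]) (by simp [hl])
      · exact ht (j + 1) (by omega) (by push_cast; omega)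
    simp only [hi, map_zero, Finset.sum_const_zero] at hx
    have ht0 : (t : ℝ) ≠ 0 := by exact_mod_cast ht 0 (by omega)
    exact (smul_eq_zero.mp hx.symm).resolve_left ht0

theorem prod_i_eq_zero {ι : Type*} [Fintype ι] (f : ι → Fin n ⊕ (τ ⊕ γ)) (l : List ι)
    (hl : ¬l.Nodup) : (l.map fun s => F.i (f s)).prod = 0 :=
  Anticomm.prod_eq_zero_of_not_nodup
    ⟨fun s => F.i_anticomm.sq (f s), fun s s' => F.i_anticomm.swap (f s) (f s')⟩ hl

theorem eq_zero_of_num_notMem {ι : Type*} [Fintype ι] (f : ι → Fin n ⊕ (τ ⊕ γ))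
    (hf : Function.Injective f) {t : ℤ} {x : Λ}
    (hx : ∑ s, F.e (f s) (F.i (f s) x) = (t : ℝ) • x) (ht : t < 0 ∨ (Fintype.card ι : ℤ) < t) :
    x = 0 := by
  refine eq_zero_of_num f hf (Fintype.card ι + 1) t x hx (fun l hl => ?_) fun j hj => by omega
  rw [prod_i_eq_zero f l fun h => by have := h.length_le_card; omega, LinearMap.zero_apply]

theorem eq_zero_of_homog {w : ℤ × ℤ × ℤ} {x : Λ} (hx : x ∈ F.homog w)
    (hw : w.1 < 0 ∨ (n : ℤ) < w.1 ∨ w.2.1 < 0 ∨ w.2.2 < 0) : x = 0 := by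
  have h1 : Function.Injective (fun j : Fin n => (Sum.inl j : Fin n ⊕ (τ ⊕ γ))) := fun a b h => by
    simpa using h
  have h2 : Function.Injective (fun j : τ => (Sum.inr (Sum.inl j) : Fin n ⊕ (τ ⊕ γ))) :=
    fun a b h => by simpa using h
  have h3 : Function.Injective (fun j : γ => (Sum.inr (Sum.inr j) : Fin n ⊕ (τ ⊕ γ))) :=
    fun a b h => by simpa using h
  rcases hw with h | h | h | h
  · exact eq_zero_of_num_notMem _ h1 (sum_inl_of_homog hx) (Or.inl h)
  · exact eq_zero_of_num_notMem _ h1 (sum_inl_of_homog hx) (Or.inr (by simpa using h))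
  · exact eq_zero_of_num_notMem _ h2 (sum_inr_inl_of_homog hx) (Or.inl h)
  · exact eq_zero_of_num_notMem _ h3 (sum_inr_inr_of_homog hx) (Or.inl h)

variable {ε : Λ →ₗ[ℝ] ℝ}

theorem apply_eq_zero_of_homog (hε : ∀ k x, ε (F.e k x) = 0) {w : ℤ × ℤ × ℤ} {x : Λ}
    (hx : x ∈ F.homog w) (hw : w ≠ 0) : ε x = 0 := by
  have key : ∀ f : ℤ × ℤ × ℤ →+ ℝ, f w * ε x = 0 := by
    intro f
    have := congrArg ε (hx f)
    simpa [map_sum, hε] using this.symm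
  have k1 := key ((Int.castAddHom ℝ).comp (AddMonoidHom.fst ℤ (ℤ × ℤ)))
  have k2 := key ((Int.castAddHom ℝ).comp
    ((AddMonoidHom.fst ℤ ℤ).comp (AddMonoidHom.snd ℤ (ℤ × ℤ))))
  have k3 := key ((Int.castAddHom ℝ).comp
    ((AddMonoidHom.snd ℤ ℤ).comp (AddMonoidHom.snd ℤ (ℤ × ℤ))))
  by_contra hne
  refine hw (Prod.ext ?_ (Prod.ext ?_ ?_))
  · simpa [hne] using k1
  · simpa [hne] using k2
  · simpa [hne] using k3

/-- The product `i₀ ⋯ i_{n-1}` of the contractions with the coordinate vectors of the base. -/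
def baseContr (F : FockModule (Fin n ⊕ (τ ⊕ γ)) Λ) : Module.End ℝ Λ :=
  ((List.finRange n).map fun j => F.i (Sum.inl j)).prod

/-- An operator shifting the degree by `d`. -/
def IsHomog (F : FockModule (Fin n ⊕ (τ ⊕ γ)) Λ) (A : Module.End ℝ Λ) (d : ℤ × ℤ × ℤ) : Prop :=
  ∀ w x, x ∈ F.homog w → A x ∈ F.homog (w + d)

theorem IsHomog.mul {A B : Module.End ℝ Λ} {d d' : ℤ × ℤ × ℤ} (hA : F.IsHomog A d)
    (hB : F.IsHomog B d') : F.IsHomog (A * B) (d + d') := fun w x hx => by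
  have := hA _ _ (hB _ _ hx)
  rwa [add_assoc, add_comm d'] at this

theorem IsHomog.list_prod {ι : Type*} {f : ι → Module.End ℝ Λ} {d : ℤ × ℤ × ℤ} (l : List ι)
    (h : ∀ s ∈ l, F.IsHomog (f s) d) : F.IsHomog (l.map f).prod (l.length • d) := by
  induction l with
  | nil => intro w x hx; simpa using hx
  | cons a l ih =>
    have := (h a List.mem_cons_self).mul (ih fun s hs => h s (List.mem_cons_of_mem _ hs))
    rw [List.map_cons, List.prod_cons, List.length_cons, succ_nsmul']
    exact this

theorem isHomog_i (k : Fin n ⊕ (τ ⊕ γ)) : F.IsHomog (F.i k) (-gdeg k) := fun w x hx => by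
  rw [← sub_eq_add_neg]; exact i_mem_homog k hx

theorem isHomog_covec (l : Fin n ⊕ α → ℝ) : F.IsHomog (F.covec l) (1, 0, 0) := fun w x hx => by
  rw [covec, LinearMap.sum_apply]
  exact Submodule.sum_mem _ fun j _ => Submodule.smul_mem _ _ (e_mem_homog (Sum.inl j) hx)

theorem isHomog_powVec (l : Fin n ⊕ α → ℝ) : F.IsHomog (F.powVec μ l) (0, -1, 0) :=
  fun w x hx => by
    rw [powVec, LinearMap.sum_apply]
    exact Submodule.sum_mem _ fun k _ =>
      Submodule.smul_mem _ _ (isHomog_i (Sum.inr (Sum.inl k)) _ _ hx)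

theorem isHomog_baseContr : F.IsHomog F.baseContr (-n, 0, 0) := by
  have := IsHomog.list_prod (F := F) (f := fun j : Fin n => F.i (Sum.inl j)) (d := (-1, 0, 0))
    (List.finRange n) fun j _ => by simpa [gdeg] using isHomog_i (F := F) (Sum.inl j)
  simpa [baseContr] using this

/-- A form of degree `n` in the `dx` alone is determined by its coefficient. -/
theorem eq_zero_of_baseContr
    (hvac : ∀ x, (∀ k, F.i k x = 0) → ε x = 0 → x = 0) {z : Λ} (hz : z ∈ F.homog (n, 0, 0))
    (h : ε (F.baseContr z) = 0) : z = 0 := by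
  have h0 : F.baseContr z = 0 := by
    have hmem := isHomog_baseContr _ _ hz
    refine hvac _ (fun k => ?_) h
    refine eq_zero_of_homog (i_mem_homog k hmem) ?_
    rcases k with j | k | k <;> simp [gdeg]
  have hinj : Function.Injective (fun j : Fin n => (Sum.inl j : Fin n ⊕ (τ ⊕ γ))) :=
    fun a b h => by simpa using h
  refine eq_zero_of_num (fun j : Fin n => Sum.inl j) hinj n n z (by simpa using sum_inl_of_homog hz)
    (fun l hl => ?_) fun j hj => by omega
  by_cases hnd : l.Nodup
  · have hp : l.Perm (List.finRange n) := by
      refine (List.perm_ext_iff_of_nodup hnd (List.nodup_finRange n)).mpr fun a => ?_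
      refine ⟨fun _ => List.mem_finRange a, fun _ => ?_⟩
      have hc : l.toFinset = Finset.univ := by
        rw [← Finset.card_eq_iff_eq_univ, List.toFinset_card_of_nodup hnd, hl, Fintype.card_fin]
      have := Finset.mem_univ a
      rwa [← hc, List.mem_toFinset] at this
    have hA : Anticomm fun j : Fin n => F.i (Sum.inl j) :=
      ⟨fun s => F.i_anticomm.sq _, fun s s' => F.i_anticomm.swap _ _⟩
    rcases hA.prod_perm hp with e | e
    · rw [e]; exact h0
    · rw [e, LinearMap.neg_apply, neg_eq_zero]; exact h0
  · rw [prod_i_eq_zero _ l hnd, LinearMap.zero_apply]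

/-! ### The algebraic structure theorem -/

theorem powVec_anticomm : Anticomm (F.powVec μ) := by
  have h : ∀ l l', F.powVec μ l * F.powVec μ l' = -(F.powVec μ l' * F.powVec μ l) := by
    intro l l'
    simp only [powVec, Finset.sum_mul, Finset.mul_sum]
    rw [Finset.sum_comm, ← Finset.sum_neg_distrib]
    refine Finset.sum_congr rfl fun k _ => ?_
    rw [← Finset.sum_neg_distrib]
    refine Finset.sum_congr rfl fun k' _ => ?_
    have := F.i_anticomm.swap (Sum.inr (Sum.inl k')) (Sum.inr (Sum.inl k))
    simp only [smul_mul_smul_comm, this, smul_neg, neg_neg, mul_comm]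
  refine ⟨fun l => ?_, h⟩
  have h := h l l
  rw [eq_neg_iff_add_eq_zero, ← two_smul ℝ] at h
  exact (smul_eq_zero.mp h).resolve_left two_ne_zero

theorem powVec_covec (l l' : Fin n ⊕ α → ℝ) :
    F.powVec μ l * F.covec l' = -(F.covec l' * F.powVec μ l) := by
  simp only [powVec, covec, Finset.sum_mul, Finset.mul_sum]
  rw [Finset.sum_comm, ← Finset.sum_neg_distrib]
  refine Finset.sum_congr rfl fun k _ => ?_
  rw [← Finset.sum_neg_distrib]
  refine Finset.sum_congr rfl fun j _ => ?_
  have : F.i (Sum.inr (Sum.inl k)) * F.e (Sum.inl j) =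
      -(F.e (Sum.inl j) * F.i (Sum.inr (Sum.inl k))) := LinearMap.ext fun x => by
    simp [F.i_e]
  rw [smul_mul_smul_comm, smul_mul_smul_comm, this, smul_neg, mul_comm]

theorem i_covec (j : Fin n) (l : Fin n ⊕ α → ℝ) :
    F.i (Sum.inl j) * F.covec l = l (Sum.inl j) • 1 - F.covec l * F.i (Sum.inl j) := by
  refine LinearMap.ext fun x => ?_
  simp only [covec, Module.End.mul_apply, LinearMap.sum_apply, map_sum, LinearMap.smul_apply,
    map_smul, F.i_e, LinearMap.sub_apply, smul_sub, Finset.sum_sub_distrib]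
  simp

theorem i_powVec (j : Fin n) (l : Fin n ⊕ α → ℝ) :
    F.i (Sum.inl j) * F.powVec μ l = -(F.powVec μ l * F.i (Sum.inl j)) := by
  simp only [powVec, Finset.sum_mul, Finset.mul_sum]
  rw [← Finset.sum_neg_distrib]
  refine Finset.sum_congr rfl fun k _ => ?_
  rw [mul_smul_comm, smul_mul_assoc, F.i_anticomm.swap (Sum.inl j), smul_neg]

variable (F μ) in
/-- The operator `l ∧ (t ⌟ ·)`, where `t` is the vector with coordinates `l^{μ k}`. -/
def shear (l : Fin n ⊕ α → ℝ) : Module.End ℝ Λ := F.covec l * F.powVec μ l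

variable (F μ) in
/-- The contraction with the `j`-th vector `∂_j + ∑ l, l_j t(l)` of a holonomic plane. -/
def planeVec (ls : List (Fin n ⊕ α → ℝ)) (j : Fin n) : Module.End ℝ Λ :=
  F.i (Sum.inl j) + (ls.map fun l => l (Sum.inl j) • F.powVec μ l).sum

/-- The shear `1 + l ∧ (t ⌟ ·)` carries the contraction with `∂_j` to that with `∂_j + l_j t`. -/
theorem i_shear (j : Fin n) (l : Fin n ⊕ α → ℝ) :
    F.i (Sum.inl j) * (1 + F.shear μ l) =
      (1 + F.shear μ l) * (F.i (Sum.inl j) + l (Sum.inl j) • F.powVec μ l) := by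
  have h1 : F.i (Sum.inl j) * F.shear μ l =
      l (Sum.inl j) • F.powVec μ l + F.shear μ l * F.i (Sum.inl j) := by
    rw [shear, ← mul_assoc, i_covec, sub_mul, smul_mul_assoc, one_mul, mul_assoc, i_powVec,
      mul_neg, sub_neg_eq_add, mul_assoc]
  have h2 : F.shear μ l * F.powVec μ l = 0 := by
    rw [shear, mul_assoc, powVec_anticomm.sq, mul_zero]
  rw [mul_add, mul_one, h1, add_mul, one_mul, mul_add, mul_smul_comm, h2, smul_zero, add_zero]
  abel

theorem powVec_shear (l l' : Fin n ⊕ α → ℝ) :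
    F.powVec μ l * F.shear μ l' = F.shear μ l' * F.powVec μ l := by
  rw [shear, ← mul_assoc, powVec_covec, neg_mul, mul_assoc, powVec_anticomm.swap, mul_neg,
    neg_neg, mul_assoc]

theorem i_prod_shear (j : Fin n) (ls : List (Fin n ⊕ α → ℝ)) :
    F.i (Sum.inl j) * (ls.map fun l => 1 + F.shear μ l).prod =
      (ls.map fun l => 1 + F.shear μ l).prod * F.planeVec μ ls j := by
  induction ls with
  | nil => simp [planeVec]
  | cons l ls ih =>
    have hcomm : Commute (F.powVec μ l) (ls.map fun l => 1 + F.shear μ l).prod := by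
      refine Commute.list_prod_right _ _ fun T hT => ?_
      obtain ⟨l', -, rfl⟩ := List.mem_map.mp hT
      exact (Commute.one_right _).add_right (powVec_shear l l')
    have h : (F.i (Sum.inl j) + l (Sum.inl j) • F.powVec μ l) *
        (ls.map fun l => 1 + F.shear μ l).prod =
        (ls.map fun l => 1 + F.shear μ l).prod * F.planeVec μ (l :: ls) j := by
      rw [add_mul, ih, smul_mul_assoc, hcomm.eq, ← mul_smul_comm, ← mul_add, planeVec, planeVec,
        List.map_cons, List.sum_cons, add_assoc, add_comm (List.sum _)]
    rw [List.map_cons, List.prod_cons, ← mul_assoc, i_shear, mul_assoc, h, mul_assoc]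

/-- The exponential of the shear carries the coordinate plane to the holonomic plane. -/
theorem baseContr_prod_shear (ls : List (Fin n ⊕ α → ℝ)) :
    F.baseContr * (ls.map fun l => 1 + F.shear μ l).prod =
      (ls.map fun l => 1 + F.shear μ l).prod *
        ((List.finRange n).map (F.planeVec μ ls)).prod := by
  rw [baseContr]
  induction List.finRange n with
  | nil => simp
  | cons j js ih =>
    rw [List.map_cons, List.prod_cons, mul_assoc, ih, ← mul_assoc, i_prod_shear, mul_assoc,
      List.map_cons, List.prod_cons]

theorem apply_prod_shear (hε : ∀ k x, ε (F.e k x) = 0) (ls : List (Fin n ⊕ α → ℝ)) (x : Λ) :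
    ε ((ls.map fun l => 1 + F.shear μ l).prod x) = ε x := by
  induction ls with
  | nil => simp
  | cons l ls ih =>
    rw [List.map_cons, List.prod_cons, Module.End.mul_apply, LinearMap.add_apply, map_add,
      Module.End.one_apply, ih, shear, Module.End.mul_apply, covec, LinearMap.sum_apply, map_sum]
    simp [hε]

variable (F μ ε) in
/-- The form `x` vanishes on `k` vertical vectors and a holonomic plane. -/
def VanishesOnPlanes (k : ℕ) (x : Λ) : Prop :=
  ∀ vs : List (Module.End ℝ Λ),
    (∀ v ∈ vs, (∃ l, v = F.powVec μ l) ∨ ∃ g, v = F.i (Sum.inr (Sum.inr g))) → vs.length = k →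
    ∀ ls : List (Fin n ⊕ α → ℝ),
      ε (((List.finRange n).map (F.planeVec μ ls)).prod (vs.prod x)) = 0

variable (F μ ε) in
/-- The form `x` is killed by the operators obtained from `VanishesOnPlanes` by taking the part
which is multilinear in the parameters of the planes. -/
def VanishesOnShears (k : ℕ) (x : Λ) : Prop :=
  ∀ vs : List (Module.End ℝ Λ),
    (∀ v ∈ vs, (∃ l, v = F.powVec μ l) ∨ ∃ g, v = F.i (Sum.inr (Sum.inr g))) → vs.length = k →
    ∀ ls : List (Fin n ⊕ α → ℝ), ε (F.baseContr ((ls.map (F.shear μ)).prod (vs.prod x))) = 0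

theorem VanishesOnPlanes.vanishesOnShears (hε : ∀ k x, ε (F.e k x) = 0) {k : ℕ} {x : Λ}
    (h : F.VanishesOnPlanes μ ε k x) : F.VanishesOnShears μ ε k x := by
  intro vs hvs hk ls
  -- Both `l :: ls` and `ls` are admissible lists of parameters: the difference replaces a factor
  -- `1 + shear l` by `shear l`.
  have key : ∀ (ls : List (Fin n ⊕ α → ℝ)) (A : Module.End ℝ Λ),
      (∀ ls : List (Fin n ⊕ α → ℝ),
        ε (F.baseContr (A ((ls.map fun l => 1 + F.shear μ l).prod (vs.prod x)))) = 0) →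
      ε (F.baseContr (A ((ls.map (F.shear μ)).prod (vs.prod x)))) = 0 := by
    intro ls
    induction ls with
    | nil => intro A hA; simpa using hA []
    | cons l ls ih =>
      intro A hA
      have := ih (A * F.shear μ l) fun ls' => by
        have h1 := hA (l :: ls')
        have h2 := hA ls'
        simp only [List.map_cons, List.prod_cons, Module.End.mul_apply, LinearMap.add_apply,
          Module.End.one_apply, map_add, h2, zero_add] at h1
        simpa using h1
      simpa using this
  refine key ls 1 fun ls => ?_
  have := LinearMap.congr_fun (F.baseContr_prod_shear (μ := μ) ls) (vs.prod x)
  rw [Module.End.mul_apply, Module.End.mul_apply] at this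
  rw [Module.End.one_apply, this, apply_prod_shear hε]
  exact h vs hvs hk ls

variable (F μ) in
/-- The multiples of `p` contact forms and `s` forms `∑ j, dy_{Mj} ∧ dx^j`. -/
def contactSpan : ℕ → ℕ → Submodule ℝ Λ
  | 0, s => F.curvIdeal μ s
  | p + 1, s => ⨆ g, (contactSpan p s).map (F.e (Sum.inr (Sum.inr g)))

variable (F μ) in
/-- The multiples of `k` factors, each of which is a contact form or one of the forms
`∑ j, dy_{Mj} ∧ dx^j`. -/
def contactIdeal (k : ℕ) : Submodule ℝ Λ :=
  ⨆ ps : {ps : ℕ × ℕ // ps.1 + ps.2 = k}, F.contactSpan μ ps.1.1 ps.1.2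

theorem e_mem_contactIdeal {k : ℕ} (g : γ) {x : Λ} (hx : x ∈ F.contactIdeal μ k) :
    F.e (Sum.inr (Sum.inr g)) x ∈ F.contactIdeal μ (k + 1) := by
  refine Submodule.iSup_induction _
    (motive := fun x => F.e (Sum.inr (Sum.inr g)) x ∈ F.contactIdeal μ (k + 1)) hx ?_ ?_ ?_
  · rintro ⟨⟨p, s⟩, hps⟩ y hy
    simp only at hps
    exact Submodule.mem_iSup_of_mem ⟨(p + 1, s), by simp only; omega⟩
      (Submodule.mem_iSup_of_mem g ⟨y, hy, rfl⟩)
  · simp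
  · intro x y hx hy
    rw [map_add]; exact Submodule.add_mem _ hx hy

theorem prod_covec_mul_prod_powVec (S : List (Fin n ⊕ α → ℝ)) :
    (S.map F.covec).prod * (S.map (F.powVec μ)).prod = (S.map (F.shear μ)).prod ∨
    (S.map F.covec).prod * (S.map (F.powVec μ)).prod = -(S.map (F.shear μ)).prod := by
  induction S with
  | nil => simp
  | cons l S ih =>
    have h : (S.map F.covec).prod * F.powVec μ l = F.powVec μ l * (S.map F.covec).prod ∨
        (S.map F.covec).prod * F.powVec μ l = -(F.powVec μ l * (S.map F.covec).prod) := by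
      clear ih
      induction S with
      | nil => simp
      | cons l' S ih =>
        have hc : F.covec l' * F.powVec μ l = -(F.powVec μ l * F.covec l') := by
          rw [powVec_covec, neg_neg]
        rw [List.map_cons, List.prod_cons, mul_assoc]
        rcases ih with ih | ih
        · right; rw [ih, ← mul_assoc, hc, neg_mul, mul_assoc]
        · left; rw [ih, mul_neg, ← mul_assoc, hc, neg_mul, neg_neg, mul_assoc]
    simp only [List.map_cons, List.prod_cons]
    have e : F.covec l * (S.map F.covec).prod * (F.powVec μ l * (S.map (F.powVec μ)).prod) =
        F.covec l * ((S.map F.covec).prod * F.powVec μ l) * (S.map (F.powVec μ)).prod := by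
      simp only [mul_assoc]
    have e' : F.covec l * (F.powVec μ l * (S.map F.covec).prod) * (S.map (F.powVec μ)).prod =
        F.shear μ l * ((S.map F.covec).prod * (S.map (F.powVec μ)).prod) := by
      simp only [shear, mul_assoc]
    rcases h with h | h <;> rcases ih with ih | ih <;> rw [e, h] <;>
      simp only [mul_neg, neg_mul, e', ih] <;> simp

/-- The structure theorem for a homogeneous form. -/
theorem mem_contactIdeal_of_homog (hμ : Function.Injective μ) {r : ℕ}
    (hr : ∀ k, (μ k).countP (fun s => s.isLeft) = r)
    (hvac : ∀ x, (∀ k, F.i k x = 0) → ε x = 0 → x = 0) (p : ℕ) : ∀ {a b : ℤ} {k : ℕ} {x : Λ},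
    x ∈ F.homog (a, b, p) → a + b + p = n + k → F.VanishesOnShears μ ε k x →
    x ∈ F.contactIdeal μ (k + 1) := by
  induction p with
  | zero =>
    intro a b k x hx hq h
    by_cases hdeg : a < 0 ∨ (n : ℤ) < a ∨ b < 0
    · rw [eq_zero_of_homog hx (by simp only; tauto)]
      exact Submodule.zero_mem _
    push Not at hdeg
    obtain ⟨c, hc⟩ : ∃ c : ℕ, (c : ℤ) = n - a := ⟨(n - a).toNat, by omega⟩
    obtain ⟨β, rfl⟩ : ∃ β : ℕ, (β : ℤ) = b := ⟨b.toNat, by omega⟩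
    push_cast at hq
    have hcβ : c ≤ β := by omega
    refine Submodule.mem_iSup_of_mem ⟨(0, k + 1), by simp⟩ ?_
    change x ∈ F.curvIdeal μ (k + 1)
    rw [show k + 1 = β + 1 - c by omega]
    refine mem_curvIdeal hμ hr hcβ ?_ (by simpa using sum_inr_inl_of_homog hx) ?_
    · rw [sum_i_e_of_homog hx]
      have : (c : ℝ) = (n : ℝ) - (a : ℝ) := by exact_mod_cast hc
      rw [this]
    · intro l S hS hSc
      have hz : (S.map fun a => F.covec (l a)).prod
          (((List.finRange β).map fun a => F.powVec μ (l a)).prod x) ∈ F.homog (n, 0, 0) := by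
        have h1 := IsHomog.list_prod (F := F) (List.finRange β)
          (fun a _ => isHomog_powVec (F := F) (μ := μ) (l a)) _ _ hx
        have h2 := IsHomog.list_prod (F := F) S (fun a _ => isHomog_covec (F := F) (l a)) _ _ h1
        convert h2 using 2
        simp [hSc, hc]
      refine eq_zero_of_baseContr hvac hz ?_
      let m := (List.finRange β).filter (· ∉ S)
      have hnd : (S ++ m).Nodup := by
        refine List.Nodup.append hS ((List.nodup_finRange β).filter _) fun a h h' => ?_
        simp [m, h] at h'
      have hp : (List.finRange β).Perm (S ++ m) :=
        (List.perm_ext_iff_of_nodup (List.nodup_finRange β) hnd).mpr fun a => by simp [m, em]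
      have hA : Anticomm fun a => F.powVec μ (l a) :=
        ⟨fun a => powVec_anticomm.sq _, fun a a' => powVec_anticomm.swap _ _⟩
      have hlen : m.length = k := by
        have := hp.length_eq
        simp only [List.length_finRange, List.length_append] at this
        omega
      have h0 := h (m.map fun a => F.powVec μ (l a)) (fun v hv => by
        obtain ⟨a, -, rfl⟩ := List.mem_map.mp hv
        exact Or.inl ⟨_, rfl⟩) (by simp [hlen]) (S.map l)
      have h1 := prod_covec_mul_prod_powVec (F := F) (μ := μ) (S.map l)
      simp only [List.map_map, Function.comp_def] at h0 h1
      have h2 : ε (F.baseContr ((S.map fun a => F.covec (l a)).prod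
          ((S.map fun a => F.powVec μ (l a)).prod
            ((m.map fun a => F.powVec μ (l a)).prod x)))) = 0 := by
        rw [← Module.End.mul_apply (S.map fun a => F.covec (l a)).prod]
        rcases h1 with h1 | h1 <;> rw [h1]
        · exact h0
        · rw [LinearMap.neg_apply, map_neg, map_neg, h0, neg_zero]
      rcases hA.prod_perm hp with e | e <;> rw [e, List.map_append, List.prod_append]
      · exact h2
      · rw [LinearMap.neg_apply, map_neg, map_neg, map_neg, neg_eq_zero]
        exact h2
  | succ p ih =>
    intro a b k x hx hq h
    have hsum := sum_inr_inr_of_homog hx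
    simp only at hsum
    have hp : ((p + 1 : ℕ) : ℤ) ≠ 0 := by omega
    refine (Submodule.smul_mem_iff (s := (((p + 1 : ℕ) : ℤ) : ℝ)) _ (by exact_mod_cast hp)).mp ?_
    rw [← hsum]
    refine Submodule.sum_mem _ fun g _ => ?_
    rcases k with _ | k
    · refine Submodule.mem_iSup_of_mem ⟨(1, 0), rfl⟩ (Submodule.mem_iSup_of_mem g ⟨_, ?_, rfl⟩)
      exact Submodule.mem_top
    · refine e_mem_contactIdeal g (ih (a := a) (b := b) ?_ (by push_cast at hq ⊢; omega) ?_)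
      · have := i_mem_homog (Sum.inr (Sum.inr g)) hx
        simpa [gdeg] using this
      · intro vs hvs hk ls
        have := h (vs ++ [F.i (Sum.inr (Sum.inr g))]) (fun v hv => by
          rcases List.mem_append.mp hv with hv | hv
          · exact hvs v hv
          · exact Or.inr ⟨g, by simpa using hv⟩) (by simp [hk]) ls
        simpa using this

/-- A form of degree `n + k` which vanishes on `k` vertical vectors and any holonomic plane is a
multiple of products of `k + 1` contact forms and forms `∑ j, dy_{Mj} ∧ dx^j`. -/
theorem mem_contactIdeal (hμ : Function.Injective μ) {r : ℕ}
    (hr : ∀ k, (μ k).countP (fun s => s.isLeft) = r) (hε : ∀ k x, ε (F.e k x) = 0)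
    (hvac : ∀ x, (∀ k, F.i k x = 0) → ε x = 0 → x = 0) {k : ℕ} {x : Λ}
    (hx : x ∈ ⨆ w : {w : ℤ × ℤ × ℤ // w.1 + w.2.1 + w.2.2 = n + k}, F.homog w.1)
    (h : F.VanishesOnPlanes μ ε k x) : x ∈ F.contactIdeal μ (k + 1) := by
  classical
  have h' := h.vanishesOnShears hε
  obtain ⟨y, hy, rfl⟩ := (Submodule.mem_iSup_iff_exists_finsupp _ _).mp hx
  refine Submodule.sum_mem _ fun w hw => ?_
  have hyw := hy w
  by_cases hp : w.1.2.2 < 0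
  · simp only [eq_zero_of_homog hyw (Or.inr (Or.inr (Or.inr hp)))]
    exact Submodule.zero_mem _
  obtain ⟨p, hp⟩ : ∃ p : ℕ, (p : ℤ) = w.1.2.2 := ⟨w.1.2.2.toNat, by omega⟩
  refine mem_contactIdeal_of_homog hμ hr hvac p (a := w.1.1) (b := w.1.2.1)
    (by rw [hp]; exact hyw) (by rw [hp]; exact w.2) fun vs hvs hk ls => ?_
  -- A homogeneous operator followed by `ε` sees one homogeneous component only.
  obtain ⟨d, hd⟩ : ∃ d, F.IsHomog (F.baseContr * ((ls.map (F.shear μ)).prod * vs.prod)) d := by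
    have h1 : ∃ d, F.IsHomog vs.prod d := by
      clear hk
      induction vs with
      | nil => exact ⟨0, fun w x hx => by simpa using hx⟩
      | cons v vs ih =>
        obtain ⟨d, hd⟩ := ih fun v hv => hvs v (List.mem_cons_of_mem _ hv)
        rw [List.prod_cons]
        rcases hvs v List.mem_cons_self with ⟨l, rfl⟩ | ⟨g, rfl⟩
        · exact ⟨_, (isHomog_powVec l).mul hd⟩
        · exact ⟨_, (isHomog_i _).mul hd⟩
    obtain ⟨d, hd⟩ := h1
    exact ⟨_, isHomog_baseContr.mul ((IsHomog.list_prod ls fun l _ =>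
      (isHomog_covec l).mul (isHomog_powVec l)).mul hd)⟩
  by_cases hwd : w.1 + d = 0
  · have h0 := h' vs hvs hk ls
    simp only [Finsupp.sum, map_sum] at h0
    rw [Finset.sum_eq_single_of_mem w hw fun w' _ hne => ?_] at h0
    · exact h0
    · refine apply_eq_zero_of_homog hε (hd _ _ (hy w')) fun h0 => hne (Subtype.ext ?_)
      exact add_right_cancel (h0.trans hwd.symm)
  · exact apply_eq_zero_of_homog hε (hd _ _ hyw) hwd

end FockModule

/-! ### Formulas for exterior products -/

section Wedge

variable {E E' : Type*} [NormedAddCommGroup E] [NormedSpace ℝ E] [NormedAddCommGroup E']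
  [NormedSpace ℝ E']

/-- The exterior product of the alternatizations of `A` and `B` is the alternatization of
`A ⊗ B`. -/
theorem wedge_apply_of_alternatization {a b c : ℕ} (h : a + b = c) {α : E [⋀^Fin a]→L[ℝ] ℝ}
    {β : E [⋀^Fin b]→L[ℝ] ℝ} {A : MultilinearMap ℝ (fun _ : Fin a => E) ℝ}
    {B : MultilinearMap ℝ (fun _ : Fin b => E) ℝ}
    (hA : α.toAlternatingMap = MultilinearMap.alternatization A)
    (hB : β.toAlternatingMap = MultilinearMap.alternatization B) (v : Fin c → E) :
    wedge h α β v = ∑ τ : Equiv.Perm (Fin c), ((Equiv.Perm.sign τ : ℤ) : ℝ) *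
      (A (fun i => v (τ (finCongr h (Fin.castAdd b i)))) *
        B (fun j => v (τ (finCongr h (Fin.natAdd a j))))) := by
  let e : Fin a ⊕ Fin b ≃ Fin c := finSumFinEquiv.trans (finCongr h)
  have h1 : wedge h α β v = (LinearMap.mul' ℝ ℝ)
      (α.toAlternatingMap.domCoprod β.toAlternatingMap (fun i => v (e i))) := rfl
  rw [h1, hA, hB, ← MultilinearMap.domCoprod_alternization, MultilinearMap.alternatization_apply,
    map_sum]
  refine Fintype.sum_equiv e.permCongr _ _ fun σ => ?_
  rw [Equiv.Perm.sign_permCongr]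
  have h2 : (LinearMap.mul' ℝ ℝ) ((Equiv.Perm.sign σ) •
      (MultilinearMap.domDomCongr σ (MultilinearMap.domCoprod A B)) fun i => v (e i)) =
      ((Equiv.Perm.sign σ : ℤ) : ℝ) * (A (fun i => v (e (σ (Sum.inl i)))) *
        B (fun j => v (e (σ (Sum.inr j))))) := by
    rcases Int.units_eq_one_or (Equiv.Perm.sign σ) with hs | hs <;> simp [hs]
  refine h2.trans ?_
  congr 2
  · congr 1; funext i
    congr 1
    simp only [Equiv.permCongr_apply]
    congr 2
    exact (e.symm_apply_apply (Sum.inl i)).symm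
  · congr 1; funext i
    congr 1
    simp only [Equiv.permCongr_apply]
    congr 2
    exact (e.symm_apply_apply (Sum.inr i)).symm

theorem toAlternatingMap_eq_alternatization {a : ℕ} (α : E [⋀^Fin a]→L[ℝ] ℝ) :
    α.toAlternatingMap = MultilinearMap.alternatization
      ((a.factorial : ℝ)⁻¹ • α.toAlternatingMap.toMultilinearMap) := by
  have h : MultilinearMap.alternatization ((a.factorial : ℝ)⁻¹ •
      α.toAlternatingMap.toMultilinearMap) = (a.factorial : ℝ)⁻¹ •
        MultilinearMap.alternatization α.toAlternatingMap.toMultilinearMap := by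
    ext v
    simp only [MultilinearMap.alternatization_apply, AlternatingMap.smul_apply, Finset.smul_sum]
    refine Finset.sum_congr rfl fun σ _ => ?_
    rw [smul_comm]; rfl
  rw [h, AlternatingMap.coe_alternatization, Fintype.card_fin, ← Nat.cast_smul_eq_nsmul ℝ,
    smul_smul, inv_mul_cancel₀ (by exact_mod_cast a.factorial_ne_zero), one_smul]

theorem wedge_apply {a b c : ℕ} (h : a + b = c) (α : E [⋀^Fin a]→L[ℝ] ℝ)
    (β : E [⋀^Fin b]→L[ℝ] ℝ) (v : Fin c → E) :
    wedge h α β v = ((a.factorial : ℝ)⁻¹ * (b.factorial : ℝ)⁻¹) *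
      ∑ τ : Equiv.Perm (Fin c), ((Equiv.Perm.sign τ : ℤ) : ℝ) *
        (α (fun i => v (τ (finCongr h (Fin.castAdd b i)))) *
          β (fun j => v (τ (finCongr h (Fin.natAdd a j))))) := by
  rw [wedge_apply_of_alternatization h (toAlternatingMap_eq_alternatization α)
    (toAlternatingMap_eq_alternatization β), Finset.mul_sum]
  refine Finset.sum_congr rfl fun τ _ => ?_
  simp only [smul_apply, smul_eq_mul]
  change _ * ((_ * α _) * (_ * β _)) = _
  ring

theorem wedge_add {a b c : ℕ} (h : a + b = c) (α : E [⋀^Fin a]→L[ℝ] ℝ)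
    (β β' : E [⋀^Fin b]→L[ℝ] ℝ) : wedge h α (β + β') = wedge h α β + wedge h α β' := by
  ext v
  simp only [wedge_apply, ContinuousAlternatingMap.add_apply, mul_add, Finset.sum_add_distrib]

theorem wedge_smul {a b c : ℕ} (h : a + b = c) (α : E [⋀^Fin a]→L[ℝ] ℝ) (t : ℝ)
    (β : E [⋀^Fin b]→L[ℝ] ℝ) : wedge h α (t • β) = t • wedge h α β := by
  ext v
  simp only [wedge_apply, ContinuousAlternatingMap.smul_apply, smul_eq_mul, Finset.mul_sum]
  refine Finset.sum_congr rfl fun _ _ => by ring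

theorem add_wedge {a b c : ℕ} (h : a + b = c) (α α' : E [⋀^Fin a]→L[ℝ] ℝ)
    (β : E [⋀^Fin b]→L[ℝ] ℝ) : wedge h (α + α') β = wedge h α β + wedge h α' β := by
  ext v
  simp only [wedge_apply, ContinuousAlternatingMap.add_apply, add_mul, mul_add,
    Finset.sum_add_distrib]

theorem smul_wedge {a b c : ℕ} (h : a + b = c) (t : ℝ) (α : E [⋀^Fin a]→L[ℝ] ℝ)
    (β : E [⋀^Fin b]→L[ℝ] ℝ) : wedge h (t • α) β = t • wedge h α β := by
  ext v
  simp only [wedge_apply, ContinuousAlternatingMap.smul_apply, smul_eq_mul, Finset.mul_sum]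
  refine Finset.sum_congr rfl fun _ _ => by ring

theorem wedge_compContinuousLinearMap {a b c : ℕ} (h : a + b = c) (α : E [⋀^Fin a]→L[ℝ] ℝ)
    (β : E [⋀^Fin b]→L[ℝ] ℝ) (C : E' →L[ℝ] E) :
    (wedge h α β).compContinuousLinearMap C =
      wedge h (α.compContinuousLinearMap C) (β.compContinuousLinearMap C) := by
  ext v
  simp only [ContinuousAlternatingMap.compContinuousLinearMap_apply, wedge_apply]
  rfl

/-- The alternating `1`-form defined by a linear form. -/
def oneForm (f : E →L[ℝ] ℝ) : E [⋀^Fin 1]→L[ℝ] ℝ :=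
  ContinuousAlternatingMap.ofSubsingleton ℝ E ℝ (0 : Fin 1) f

@[simp]
theorem oneForm_apply (f : E →L[ℝ] ℝ) (v : Fin 1 → E) : oneForm f v = f (v 0) := rfl

/-- The expansion of `f ∧ β` along the first factor. -/
theorem wedge_oneForm_apply {b : ℕ} (h : 1 + b = b + 1) (f : E →L[ℝ] ℝ)
    (β : E [⋀^Fin b]→L[ℝ] ℝ) (v : Fin (b + 1) → E) :
    wedge h (oneForm f) β v =
      ∑ i : Fin (b + 1), (-1) ^ (i : ℕ) * (f (v i) * β (fun j => v (i.succAbove j))) := by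
  have e1 : ∀ i, finCongr h (Fin.castAdd b i) = 0 := fun i => by
    ext; simp
  have e2 : ∀ j : Fin b, finCongr h (Fin.natAdd 1 j) = j.succ := fun j => by
    ext; simp
  rw [wedge_apply]
  simp only [e1, e2, oneForm_apply]
  rw [Equiv.Perm.decomposeFin.symm.sum_comp
    (fun σ => ((Equiv.Perm.sign σ : ℤ) : ℝ) * (f (v (σ 0)) * β fun j => v (σ j.succ))) |>.symm,
    Fintype.sum_prod_type, Finset.mul_sum]
  refine Finset.sum_congr rfl fun p _ => ?_
  have key : ∀ e : Equiv.Perm (Fin b),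
      ((Equiv.Perm.sign (Equiv.Perm.decomposeFin.symm (p, e)) : ℤ) : ℝ) *
        (f (v (Equiv.Perm.decomposeFin.symm (p, e) 0)) *
          β fun j => v (Equiv.Perm.decomposeFin.symm (p, e) j.succ)) =
      (-1) ^ (p : ℕ) * (f (v p) * β (fun j => v (p.succAbove j))) := by
    intro e
    have hp : ∃ s : Equiv.Perm (Fin b), (∀ j, Equiv.swap 0 p j.succ = p.succAbove (s j)) ∧
        ((Equiv.Perm.sign s : ℤ) : ℝ) * (if p = 0 then 1 else -1) = (-1) ^ (p : ℕ) := by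
      induction p using Fin.cases with
      | zero => exact ⟨1, fun j => by simp, by simp⟩
      | succ i =>
        cases b with
        | zero => exact i.elim0
        | succ b =>
          refine ⟨i.cycleRange, fun j => (Fin.succAbove_cycleRange i j).symm, ?_⟩
          rw [Fin.sign_cycleRange, if_neg (Fin.succ_ne_zero i)]
          simp [pow_succ]
    obtain ⟨s, hs, hsign⟩ := hp
    have h3 : (β fun j => v (Equiv.Perm.decomposeFin.symm (p, e) j.succ)) =
        ((Equiv.Perm.sign (e.trans s) : ℤ) : ℝ) * β (fun j => v (p.succAbove j)) := by
      have := β.toAlternatingMap.map_perm (fun j => v (p.succAbove j)) (e.trans s)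
      have h4 : (fun j => v (Equiv.Perm.decomposeFin.symm (p, e) j.succ)) =
          (fun j => v (p.succAbove j)) ∘ (e.trans s) := by
        funext j
        simp [Equiv.Perm.decomposeFin_symm_apply_succ, hs]
      rw [h4]
      refine this.trans ?_
      rcases Int.units_eq_one_or (Equiv.Perm.sign (e.trans s)) with hs | hs <;> rw [hs] <;> simp
    rw [h3, Equiv.Perm.decomposeFin_symm_apply_zero, Equiv.Perm.decomposeFin.symm_sign, ← hsign,
      Equiv.Perm.sign_trans]
    rcases Int.units_eq_one_or (Equiv.Perm.sign e) with he | he <;>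
    rcases Int.units_eq_one_or (Equiv.Perm.sign s) with hs | hs <;>
    split_ifs <;> simp [he, hs]
  rw [Finset.sum_congr rfl fun e _ => key e]
  simp only [Finset.sum_const, Finset.card_univ, Fintype.card_perm, Fintype.card_fin, nsmul_eq_mul,
    Nat.factorial_one, Nat.cast_one, inv_one, one_mul]
  rw [← mul_assoc, inv_mul_cancel₀ (by exact_mod_cast b.factorial_ne_zero), one_mul]

/-- Associativity for two linear forms. Written as alternatizations of multilinear maps, both sides
come from the same product of three factors. -/
theorem wedge_oneForm_oneForm_wedge {b c d : ℕ} (h : 1 + b = c) (h' : 1 + c = d) (h₂ : 1 + 1 = 2)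
    (h₃ : 2 + b = d) (f g : E →L[ℝ] ℝ) (β : E [⋀^Fin b]→L[ℝ] ℝ) :
    wedge h₃ (wedge h₂ (oneForm f) (oneForm g)) β =
      wedge h' (oneForm f) (wedge h (oneForm g) β) := by
  have alt : ∀ {a b c : ℕ} (h : a + b = c) {α : E [⋀^Fin a]→L[ℝ] ℝ} {β : E [⋀^Fin b]→L[ℝ] ℝ}
      {A : MultilinearMap ℝ (fun _ : Fin a => E) ℝ} {B : MultilinearMap ℝ (fun _ : Fin b => E) ℝ},
      α.toAlternatingMap = MultilinearMap.alternatization A →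
      β.toAlternatingMap = MultilinearMap.alternatization B →
      (wedge h α β).toAlternatingMap = MultilinearMap.alternatization
        ((LinearMap.mul' ℝ ℝ).compMultilinearMap (A.domCoprod B)
          |>.domDomCongr (finSumFinEquiv.trans (finCongr h))) := by
    intro a b c h α β A B hA hB
    ext v
    refine (wedge_apply_of_alternatization h hA hB v).trans ?_
    rw [MultilinearMap.alternatization_apply]
    refine Finset.sum_congr rfl fun τ _ => ?_
    rcases Int.units_eq_one_or (Equiv.Perm.sign τ) with hs | hs <;> simp [hs]
  have one : ∀ f : E →L[ℝ] ℝ, (oneForm f).toAlternatingMap = MultilinearMap.alternatization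
      (oneForm f).toAlternatingMap.toMultilinearMap := by
    intro f
    have := toAlternatingMap_eq_alternatization (oneForm f)
    simpa using this
  ext v
  rw [wedge_apply_of_alternatization h₃ (alt h₂ (one f) (one g))
    (toAlternatingMap_eq_alternatization β),
    wedge_apply_of_alternatization h' (one f) (alt h (one g)
      (toAlternatingMap_eq_alternatization β))]
  subst h
  refine Finset.sum_congr rfl fun τ _ => ?_
  congr 1
  simp only [MultilinearMap.domDomCongr_apply, LinearMap.compMultilinearMap_apply,
    MultilinearMap.domCoprod_apply, LinearMap.mul'_apply]
  rw [mul_assoc]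
  congr 1
  congr 1
  congr 1
  funext j
  congr 2
  ext
  simp
  omega

end Wedge

/-! ### The Fock module of exterior forms -/

section Forms

variable {E : Type*} [NormedAddCommGroup E] [NormedSpace ℝ E]

variable (E) in
/-- Families of alternating forms, one of each degree. -/
abbrev Forms : Type _ := (q : ℕ) → E [⋀^Fin q]→L[ℝ] ℝ

/-- Exterior multiplication `η ∧ ·` by a form of degree `e`. -/
def wedgeOp {e : ℕ} (η : E [⋀^Fin e]→L[ℝ] ℝ) : Module.End ℝ (Forms E) where
  toFun x q := if h : e ≤ q then wedge (Nat.add_sub_cancel' h) η (x (q - e)) else 0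
  map_add' x y := by
    funext q
    by_cases h : e ≤ q <;> simp [h, wedge_add]
  map_smul' t x := by
    funext q
    by_cases h : e ≤ q <;> simp [h, wedge_smul]

theorem wedgeOp_apply {e d q : ℕ} (h : e + d = q) (η : E [⋀^Fin e]→L[ℝ] ℝ) (x : Forms E) :
    wedgeOp η x q = wedge h η (x d) := by
  obtain rfl : d = q - e := by omega
  exact dif_pos (by omega)

theorem wedgeOp_apply_of_lt {e d : ℕ} (η : E [⋀^Fin e]→L[ℝ] ℝ) {x : Forms E}
    (hx : ∀ q < d, x q = 0) {q : ℕ} (hq : q < e + d) : wedgeOp η x q = 0 := by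
  by_cases h : e ≤ q
  · rw [wedgeOp_apply (Nat.add_sub_cancel' h), hx _ (by omega),
      ← zero_smul ℝ (0 : E [⋀^Fin (q - e)]→L[ℝ] ℝ), wedge_smul, zero_smul]
  · exact dif_neg h

/-- The contraction `v ⌟ ·`. -/
def contr (v : E) : Module.End ℝ (Forms E) where
  toFun x q := (x (q + 1)).curryLeft v
  map_add' x y := by funext q; ext w; rfl
  map_smul' t x := by funext q; ext w; rfl

theorem contr_apply (v : E) (x : Forms E) (q : ℕ) (w : Fin q → E) :
    contr v x q w = x (q + 1) (Matrix.vecCons v w) := rfl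

theorem contr_add (v w : E) : contr (v + w) = contr v + contr w := by
  refine LinearMap.ext fun x => funext fun q => ?_
  exact map_add (x (q + 1)).curryLeft v w

theorem contr_smul (t : ℝ) (v : E) : contr (t • v) = t • contr v := by
  refine LinearMap.ext fun x => funext fun q => ?_
  exact map_smul (x (q + 1)).curryLeft t v

variable (E) in
/-- The contraction, as a linear function of the vector. -/
def contrₗ : E →ₗ[ℝ] Module.End ℝ (Forms E) where
  toFun := contr
  map_add' := contr_add
  map_smul' := contr_smul

theorem contr_contr (v w : E) (x : Forms E) : contr v (contr w x) = -contr w (contr v x) := by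
  funext q
  ext u
  have h := (x (q + 2)).toAlternatingMap.map_swap (Matrix.vecCons w (Matrix.vecCons v u))
    (i := 0) (j := 1) (by simp)
  have e : (Matrix.vecCons w (Matrix.vecCons v u)) ∘ Equiv.swap (0 : Fin (q + 2)) 1 =
      Matrix.vecCons v (Matrix.vecCons w u) := by
    funext j
    refine Fin.cases ?_ (fun j => ?_) j
    · simp
    · refine Fin.cases ?_ (fun j => ?_) j
      · simp
      · simp only [Function.comp_apply]
        rw [Equiv.swap_apply_of_ne_of_ne (by simp) (by simp [Fin.ext_iff])]
        simp
  rw [e] at h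
  have h : x (q + 2) (Matrix.vecCons v (Matrix.vecCons w u)) =
      -x (q + 2) (Matrix.vecCons w (Matrix.vecCons v u)) := h
  change x (q + 2) (Matrix.vecCons w (Matrix.vecCons v u)) =
    -x (q + 2) (Matrix.vecCons v (Matrix.vecCons w u))
  rw [h, neg_neg]

theorem contr_contr_self (v : E) (x : Forms E) : contr v (contr v x) = 0 := by
  have h := contr_contr v v x
  rw [eq_neg_iff_add_eq_zero, ← two_smul ℝ] at h
  exact (smul_eq_zero.mp h).resolve_left two_ne_zero

/-- Contractions are antiderivations. -/
theorem contr_wedgeOp (v : E) (f : E →L[ℝ] ℝ) (x : Forms E) :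
    contr v (wedgeOp (oneForm f) x) = f v • x - wedgeOp (oneForm f) (contr v x) := by
  funext q
  ext u
  rw [contr_apply, wedgeOp_apply (Nat.add_comm 1 q), wedge_oneForm_apply, Fin.sum_univ_succ]
  change _ = f v * x q u - wedgeOp (oneForm f) (contr v x) q u
  simp only [Fin.coe_ofNat_eq_mod, Nat.zero_mod, pow_zero, one_mul, Matrix.cons_val_zero,
    Fin.succAbove_zero, Matrix.cons_val_succ, Fin.val_succ, pow_succ, mul_neg, mul_one, neg_mul,
    Finset.sum_neg_distrib, sub_eq_add_neg]
  congr 2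
  cases q with
  | zero => simp [wedgeOp_apply_of_lt (d := 0) (oneForm f) (x := contr v x)]
  | succ q =>
    rw [wedgeOp_apply (Nat.add_comm 1 q), wedge_oneForm_apply]
    refine Finset.sum_congr rfl fun i _ => ?_
    rw [contr_apply]
    congr 3
    funext j
    refine Fin.cases ?_ (fun j => ?_) j
    · simp
    · simp

/-- The coefficient of a family of forms in degree `0`. -/
def vacuum : Forms E →ₗ[ℝ] ℝ where
  toFun x := x 0 Fin.elim0
  map_add' _ _ := rfl
  map_smul' _ _ := rfl

theorem vacuum_apply (x : Forms E) (v : Fin 0 → E) : vacuum x = x 0 v :=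
  congrArg (x 0) (Subsingleton.elim _ _)

theorem vacuum_wedgeOp (f : E →L[ℝ] ℝ) (x : Forms E) : vacuum (wedgeOp (oneForm f) x) = 0 := by
  rw [vacuum_apply _ Fin.elim0, wedgeOp_apply_of_lt (d := 0) (oneForm f) (by simp) (by simp)]
  rfl

theorem apply_succ_eq (x : Forms E) (q : ℕ) (w : Fin (q + 1) → E) :
    x (q + 1) w = contr (w 0) x q (Fin.tail w) := by
  rw [contr_apply]
  congr 1
  exact (Fin.cons_self_tail w).symm

theorem wedgeOp_anticomm (f g : E →L[ℝ] ℝ) (x : Forms E) :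
    wedgeOp (oneForm f) (wedgeOp (oneForm g) x) = -wedgeOp (oneForm g) (wedgeOp (oneForm f) x) := by
  rw [eq_neg_iff_add_eq_zero]
  funext q
  induction q generalizing x with
  | zero =>
    ext w
    have := vacuum_wedgeOp f (wedgeOp (oneForm g) x)
    have h := vacuum_wedgeOp g (wedgeOp (oneForm f) x)
    rw [vacuum_apply _ w] at this h
    simp [this, h]
  | succ q ih =>
    ext w
    rw [apply_succ_eq]
    simp only [map_add, contr_wedgeOp, map_sub, map_smul]
    have := congrArg (fun y => y (Fin.tail w)) (ih (contr (w 0) x))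
    simp only [Pi.add_apply, ContinuousAlternatingMap.add_apply] at this
    simp only [Pi.add_apply, Pi.sub_apply, Pi.smul_apply, ContinuousAlternatingMap.add_apply,
      ContinuousAlternatingMap.sub_apply, ContinuousAlternatingMap.smul_apply, Pi.zero_apply,
      ContinuousAlternatingMap.coe_zero]
    simp only [Pi.zero_apply, ContinuousAlternatingMap.coe_zero] at this
    linear_combination this

theorem wedgeOp_wedgeOp_self (f : E →L[ℝ] ℝ) (x : Forms E) :
    wedgeOp (oneForm f) (wedgeOp (oneForm f) x) = 0 := by
  have h := wedgeOp_anticomm f f x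
  rw [eq_neg_iff_add_eq_zero, ← two_smul ℝ] at h
  exact (smul_eq_zero.mp h).resolve_left two_ne_zero

/-- The iterated contraction of a form computes its values. -/
theorem vacuum_prod_contr {q : ℕ} (x : Forms E) (w : Fin q → E) :
    vacuum (((List.ofFn w).reverse.map contr).prod x) = x q w := by
  induction q generalizing x with
  | zero => simp [vacuum_apply _ w]
  | succ q ih =>
    rw [List.ofFn_succ, List.reverse_cons, List.map_append, List.prod_append, Module.End.mul_apply,
      ih, apply_succ_eq]
    simp [Fin.tail_def]

theorem anticomm_wedgeOp {κ : Type*} (f : κ → E →L[ℝ] ℝ) :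
    Anticomm fun k => (wedgeOp (oneForm (f k)) : Module.End ℝ (Forms E)) := by
  refine ⟨fun k => ?_, fun k l => ?_⟩
  · refine LinearMap.ext fun x => ?_
    exact wedgeOp_wedgeOp_self (f k) x
  · refine LinearMap.ext fun x => ?_
    exact wedgeOp_anticomm (f k) (f l) x

theorem anticomm_contr {κ : Type*} (v : κ → E) :
    Anticomm fun k => (contr (v k) : Module.End ℝ (Forms E)) := by
  refine ⟨fun k => ?_, fun k l => ?_⟩
  · refine LinearMap.ext fun x => ?_
    exact contr_contr_self (v k) x
  · refine LinearMap.ext fun x => ?_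
    exact contr_contr (v k) (v l) x

variable {κ : Type*} [Fintype κ] [DecidableEq κ] [FiniteDimensional ℝ E]

/-- A coordinate function of a basis, as a continuous linear form. -/
def coordCLM (b : Module.Basis κ ℝ E) (k : κ) : E →L[ℝ] ℝ :=
  LinearMap.toContinuousLinearMap (b.coord k)

theorem coordCLM_apply (b : Module.Basis κ ℝ E) (k : κ) (v : E) : coordCLM b k v = b.repr v k := rfl

/-- The exterior forms of a vector space with a basis, with the exterior products with coordinate
forms and the contractions with basis vectors. -/
def formsFock (b : Module.Basis κ ℝ E) : FockModule κ (Forms E) where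
  e k := wedgeOp (oneForm (coordCLM b k))
  i k := contr (b k)
  e_anticomm := anticomm_wedgeOp _
  i_anticomm := anticomm_contr _
  i_e k l x := by
    rw [contr_wedgeOp, coordCLM_apply, Module.Basis.repr_self, Finsupp.single_apply]
    split_ifs <;> simp

theorem formsFock_e (b : Module.Basis κ ℝ E) (k : κ) :
    (formsFock b).e k = wedgeOp (oneForm (coordCLM b k)) := rfl

theorem formsFock_i (b : Module.Basis κ ℝ E) (k : κ) : (formsFock b).i k = contr (b k) := rfl

theorem contr_eq_sum (b : Module.Basis κ ℝ E) (v : E) :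
    contr v = ∑ k, b.repr v k • contr (b k) := by
  conv_lhs => rw [← b.sum_repr v]
  change contrₗ E _ = ∑ k, _ • contrₗ E _
  simp only [map_sum, map_smul]

theorem eq_zero_of_contr (b : Module.Basis κ ℝ E) (x : Forms E) (h : ∀ k, (formsFock b).i k x = 0)
    (h0 : vacuum x = 0) : x = 0 := by
  funext q
  ext w
  cases q with
  | zero => exact (vacuum_apply x w).symm.trans h0
  | succ q =>
    rw [apply_succ_eq, contr_eq_sum b, LinearMap.sum_apply]
    simp only [LinearMap.smul_apply, ← formsFock_i b, h, smul_zero, Finset.sum_const_zero]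
    rfl

/-- Euler's formula. -/
theorem sum_wedgeOp_contr (b : Module.Basis κ ℝ E) (x : Forms E) (q : ℕ) :
    (∑ k, (formsFock b).e k ((formsFock b).i k x)) q = (q : ℝ) • x q := by
  induction q generalizing x with
  | zero =>
    ext w
    have := map_sum vacuum (fun k => (formsFock b).e k ((formsFock b).i k x)) Finset.univ
    rw [vacuum_apply _ w] at this
    rw [this]
    simp [formsFock_e, vacuum_wedgeOp]
  | succ q ih =>
    ext w
    rw [apply_succ_eq, map_sum]
    have h : ∀ k, contr (w 0) ((formsFock b).e k ((formsFock b).i k x)) =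
        b.repr (w 0) k • contr (b k) x + (formsFock b).e k ((formsFock b).i k (contr (w 0) x)) := by
      intro k
      rw [formsFock_e, contr_wedgeOp, formsFock_i, contr_contr, map_neg, sub_neg_eq_add,
        coordCLM_apply]
    have h' : ∑ k, b.repr (w 0) k • contr (b k) x = contr (w 0) x := by
      rw [contr_eq_sum b (w 0), LinearMap.sum_apply]; rfl
    simp only [h, Finset.sum_add_distrib, h']
    rw [Pi.add_apply, ih (contr (w 0) x)]
    simp only [ContinuousAlternatingMap.add_apply, ContinuousAlternatingMap.smul_apply,
      smul_eq_mul, apply_succ_eq x]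
    push_cast; ring

theorem castDeg_apply (x : Forms E) {a b : ℕ} (h : a = b) : castDeg h (x a) = x b := by
  subst h; rfl

theorem prod_wedgeOp_apply {e d : ℕ} (s : ℕ) (η : Fin s → E [⋀^Fin e]→L[ℝ] ℝ) (x : Forms E) :
    (List.ofFn fun a => wedgeOp (η a)).prod x (s * e + d) = iterWedge s η (x d) := by
  induction s with
  | zero => exact (castDeg_apply x (by simp)).symm
  | succ s ih =>
    rw [List.ofFn_succ, List.prod_cons, Module.End.mul_apply,
      wedgeOp_apply (d := s * e + d) (by ring), ih]
    rfl

theorem prod_wedgeOp_apply_of_lt {e d : ℕ} (s : ℕ) (η : Fin s → E [⋀^Fin e]→L[ℝ] ℝ) (x : Forms E)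
    (hx : ∀ q < d, x q = 0) {q : ℕ} (hq : q < s * e + d) :
    (List.ofFn fun a => wedgeOp (η a)).prod x q = 0 := by
  induction s generalizing q with
  | zero => exact hx q (by omega)
  | succ s ih =>
    rw [List.ofFn_succ, List.prod_cons, Module.End.mul_apply]
    refine wedgeOp_apply_of_lt (d := s * e + d) _ (fun q hq => ih _ hq) ?_
    rw [add_mul] at hq
    omega

theorem iterWedge_add {e d : ℕ} (s : ℕ) (η : Fin s → E [⋀^Fin e]→L[ℝ] ℝ)
    (x y : E [⋀^Fin d]→L[ℝ] ℝ) : iterWedge s η (x + y) = iterWedge s η x + iterWedge s η y := by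
  have h := fun x : E [⋀^Fin d]→L[ℝ] ℝ => prod_wedgeOp_apply (d := d) s η (Pi.single d x)
  simp only [Pi.single_eq_same] at h
  rw [← h, ← h, ← h, Pi.single_add, map_add, Pi.add_apply]

theorem iterWedge_smul {e d : ℕ} (s : ℕ) (η : Fin s → E [⋀^Fin e]→L[ℝ] ℝ) (t : ℝ)
    (x : E [⋀^Fin d]→L[ℝ] ℝ) : iterWedge s η (t • x) = t • iterWedge s η x := by
  have h := fun x : E [⋀^Fin d]→L[ℝ] ℝ => prod_wedgeOp_apply (d := d) s η (Pi.single d x)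
  simp only [Pi.single_eq_same] at h
  rw [← h, ← h, Pi.single_smul, map_smul, Pi.smul_apply]

theorem castDeg_add {a b : ℕ} (h : a = b) (x y : E [⋀^Fin a]→L[ℝ] ℝ) :
    castDeg h (x + y) = castDeg h x + castDeg h y := by
  subst h; rfl

theorem castDeg_smul {a b : ℕ} (h : a = b) (t : ℝ) (x : E [⋀^Fin a]→L[ℝ] ℝ) :
    castDeg h (t • x) = t • castDeg h x := by
  subst h; rfl

variable {E' : Type*} [NormedAddCommGroup E'] [NormedSpace ℝ E']

theorem castDeg_compContinuousLinearMap {a b : ℕ} (h : a = b) (x : E [⋀^Fin a]→L[ℝ] ℝ)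
    (C : E' →L[ℝ] E) :
    (castDeg h x).compContinuousLinearMap C = castDeg h (x.compContinuousLinearMap C) := by
  subst h; rfl

theorem iterWedge_compContinuousLinearMap {e d : ℕ} (s : ℕ) (η : Fin s → E [⋀^Fin e]→L[ℝ] ℝ)
    (x : E [⋀^Fin d]→L[ℝ] ℝ) (C : E' →L[ℝ] E) :
    (iterWedge s η x).compContinuousLinearMap C =
      iterWedge s (fun a => (η a).compContinuousLinearMap C) (x.compContinuousLinearMap C) := by
  induction s with
  | zero => exact castDeg_compContinuousLinearMap _ _ _
  | succ s ih =>
    rw [iterWedge, wedge_compContinuousLinearMap, ih]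
    rfl

end Forms

section Grading

variable {E : Type*} [NormedAddCommGroup E] [NormedSpace ℝ E] [FiniteDimensional ℝ E]
  {n : ℕ} {τ γ : Type*} [DecidableEq τ] [DecidableEq γ] [Fintype τ] [Fintype γ]

/-- A form of degree `q` is a sum of homogeneous components. -/
theorem single_mem_iSup_homog (b : Module.Basis (Fin n ⊕ (τ ⊕ γ)) ℝ E) (q : ℕ)
    (x : E [⋀^Fin q]→L[ℝ] ℝ) : (Pi.single q x : Forms E) ∈
      ⨆ w : {w : ℤ × ℤ × ℤ // w.1 + w.2.1 + w.2.2 = q}, (formsFock b).homog w.1 := by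
  induction q with
  | zero =>
    refine Submodule.mem_iSup_of_mem ⟨0, by simp⟩ fun f => ?_
    have : ∀ k, (formsFock b).i k (Pi.single 0 x : Forms E) = 0 := fun k => by
      funext q; ext w
      rw [formsFock_i, contr_apply, Pi.single_eq_of_ne (by omega)]
      rfl
    simp [this]
  | succ q ih =>
    have hE : (Pi.single (q + 1) x : Forms E) = ((q + 1 : ℕ) : ℝ)⁻¹ • ∑ k, (formsFock b).e k
        (Pi.single q ((formsFock b).i k (Pi.single (q + 1) x : Forms E) q) : Forms E) := by
      have h1 : ∀ k, (Pi.single q ((formsFock b).i k (Pi.single (q + 1) x : Forms E) q) : Forms E) =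
          (formsFock b).i k (Pi.single (q + 1) x : Forms E) := by
        intro k
        funext p
        by_cases hp : p = q
        · subst hp; simp
        · rw [Pi.single_eq_of_ne hp]
          ext w
          rw [formsFock_i, contr_apply, Pi.single_eq_of_ne (by omega)]
          rfl
      simp only [h1]
      funext p
      rw [Pi.smul_apply, sum_wedgeOp_contr]
      by_cases hp : p = q + 1
      · subst hp
        rw [smul_smul, inv_mul_cancel₀ (by positivity), one_smul]
      · rw [Pi.single_eq_of_ne hp, smul_zero, smul_zero]
    rw [hE]
    refine Submodule.smul_mem _ _ (Submodule.sum_mem _ fun k _ => ?_)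
    refine Submodule.iSup_induction _
      (motive := fun x => (formsFock b).e k x ∈ _) (ih _) ?_ (by simp) ?_
    · rintro ⟨w, hw⟩ y hy
      refine Submodule.mem_iSup_of_mem ⟨w + FockModule.gdeg k, ?_⟩ (FockModule.e_mem_homog k hy)
      rcases k with j | k | k <;> simp [FockModule.gdeg] <;> omega
    · intro x y hx hy
      rw [map_add]; exact Submodule.add_mem _ hx hy

end Grading

/-! ### Linear coordinates on the jet space -/

section Coordinates

variable {n m r : ℕ}

/-- Multi-indices with `|J| = r`. -/
abbrev FullIdx (n r : ℕ) : Type := {J : Multiset (Fin n) // Multiset.card J = r}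

instance fintypeFullIdx (n r : ℕ) : Fintype (FullIdx n r) :=
  Fintype.ofInjective (fun J => (⟨J.1, J.2.le⟩ : MultiIdx n r)) fun _ _ h =>
    Subtype.ext (Subtype.mk.inj h)

/-- The indices of the coordinates `x^i`, of the coordinates `y^σ_J` with `|J| = r`, and of the
coordinates `y^σ_J` with `|J| < r`. -/
abbrev CoordIdx (n m r : ℕ) : Type := Fin n ⊕ ((Fin m × FullIdx n r) ⊕ (Fin m × LowIdx n r))

/-- The decomposition of a point of the jet space into its three kinds of coordinates. -/
def coordEquiv (n m r : ℕ) : JetCoord n m r ≃ₗ[ℝ] (CoordIdx n m r → ℝ) where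
  toFun z := Sum.elim (fun i => z.1 i)
    (Sum.elim (fun p => z.2 (p.1, ⟨p.2.1, p.2.2.le⟩)) fun p => z.2 (p.1, p.2.toIdx))
  map_add' x y := by ext (i | p | p) <;> simp
  map_smul' t x := by ext (i | p | p) <;> simp
  invFun c := (WithLp.toLp 2 fun i => c (Sum.inl i), fun p =>
    if h : Multiset.card p.2.1 = r then c (Sum.inr (Sum.inl (p.1, ⟨p.2.1, h⟩)))
    else c (Sum.inr (Sum.inr (p.1, ⟨p.2.1, lt_of_le_of_ne p.2.2 h⟩))))
  left_inv z := by
    refine Prod.ext (by ext; simp) (funext fun p => ?_)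
    dsimp only
    split_ifs <;> rfl
  right_inv c := by
    ext (i | p | p)
    · simp
    · simp [p.2.2]
    · have : Multiset.card p.2.1 ≠ r := p.2.2.ne
      simp [LowIdx.toIdx, this]

/-- The basis of the jet space dual to its linear coordinates. -/
def jetBasis (n m r : ℕ) : Module.Basis (CoordIdx n m r) ℝ (JetCoord n m r) :=
  Module.Basis.ofEquivFun (coordEquiv n m r)

theorem coordEquiv_inl (z : JetCoord n m r) (i : Fin n) :
    coordEquiv n m r z (Sum.inl i) = z.1 i := rfl

theorem coordEquiv_full (z : JetCoord n m r) (p : Fin m × FullIdx n r) :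
    coordEquiv n m r z (Sum.inr (Sum.inl p)) = z.2 (p.1, ⟨p.2.1, p.2.2.le⟩) := rfl

theorem coordEquiv_low (z : JetCoord n m r) (p : Fin m × LowIdx n r) :
    coordEquiv n m r z (Sum.inr (Sum.inr p)) = z.2 (p.1, p.2.toIdx) := rfl

theorem jetBasis_repr (z : JetCoord n m r) (k : CoordIdx n m r) :
    (jetBasis n m r).repr z k = coordEquiv n m r z k := by
  simp [jetBasis]

/-- The coordinate form `dx^i`. -/
def dx (i : Fin n) : JetCoord n m r →L[ℝ] ℝ :=
  (EuclideanSpace.proj (𝕜 := ℝ) i).comp (ContinuousLinearMap.fst ℝ _ _)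

/-- The coordinate form `dy^σ_J`. -/
def dy (p : Fin m × MultiIdx n r) : JetCoord n m r →L[ℝ] ℝ :=
  (ContinuousLinearMap.proj (R := ℝ) (φ := fun _ : Fin m × MultiIdx n r => ℝ) p).comp
    (ContinuousLinearMap.snd ℝ _ _)

@[simp]
theorem dx_apply (i : Fin n) (v : JetCoord n m r) : dx i v = v.1 i := rfl

@[simp]
theorem dy_apply (p : Fin m × MultiIdx n r) (v : JetCoord n m r) : dy p v = v.2 p := rfl

theorem coordCLM_inl (i : Fin n) : coordCLM (jetBasis n m r) (Sum.inl i) = dx i := by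
  refine ContinuousLinearMap.ext fun v => ?_
  rw [coordCLM_apply, jetBasis_repr]; rfl

theorem coordCLM_top (p : Fin m × FullIdx n r) :
    coordCLM (jetBasis n m r) (Sum.inr (Sum.inl p)) = dy (p.1, ⟨p.2.1, p.2.2.le⟩) := by
  refine ContinuousLinearMap.ext fun v => ?_
  rw [coordCLM_apply, jetBasis_repr]; rfl

theorem coordCLM_low (p : Fin m × LowIdx n r) :
    coordCLM (jetBasis n m r) (Sum.inr (Sum.inr p)) = dy (p.1, p.2.toIdx) := by
  refine ContinuousLinearMap.ext fun v => ?_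
  rw [coordCLM_apply, jetBasis_repr]; rfl

/-! ### The contact forms and their differentials -/

theorem omega_eq (σ : Fin m) (J : LowIdx n r) (z : JetCoord n m r) :
    omega σ J z = oneForm (dy (σ, J.toIdx) - ∑ i, z.2 (σ, J.cons i) • dx i) := rfl

theorem omega_apply (σ : Fin m) (J : LowIdx n r) (z : JetCoord n m r) (v : Fin 1 → JetCoord n m r) :
    omega σ J z v = (v 0).2 (σ, J.toIdx) - ∑ i, z.2 (σ, J.cons i) * (v 0).1 i := by
  rw [omega_eq, oneForm_apply]
  simp [sum_apply]

theorem extDeriv_omega (σ : Fin m) (J : LowIdx n r) (z : JetCoord n m r) :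
    extDeriv (omega σ J) z =
      -∑ i, wedge (by norm_num) (oneForm (dy (σ, J.cons i))) (oneForm (dx i)) := by
  have hf : HasFDerivAt (omega (n := n) (m := m) (r := r) σ J)
      (-∑ i, (dy (σ, J.cons i)).smulRight (oneForm (dx i : JetCoord n m r →L[ℝ] ℝ))) z := by
    have h1 : omega (n := n) (m := m) (r := r) σ J = fun z => oneForm (dy (σ, J.toIdx)) -
        ∑ i, (dy (σ, J.cons i) z) • oneForm (dx i : JetCoord n m r →L[ℝ] ℝ) := by
      funext z
      ext v
      simp [omega_apply, ContinuousAlternatingMap.sum_apply]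
    rw [h1]
    exact (HasFDerivAt.fun_sum fun i _ =>
      ((dy (σ, J.cons i)).hasFDerivAt).smul_const _).const_sub _
  rw [extDeriv, hf.fderiv]
  ext v
  rw [ContinuousAlternatingMap.alternatizeUncurryFin_apply]
  simp only [ContinuousAlternatingMap.neg_apply, ContinuousAlternatingMap.sum_apply,
    wedge_oneForm_apply]
  simp [Fin.removeNth, ContinuousAlternatingMap.sum_apply, sum_apply,
    Finset.sum_neg_distrib, Finset.sum_add_distrib]

theorem extDeriv_omega_apply (σ : Fin m) (J : LowIdx n r) (z : JetCoord n m r)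
    (v : Fin 2 → JetCoord n m r) : extDeriv (omega σ J) z v =
      ∑ i, ((v 1).2 (σ, J.cons i) * (v 0).1 i - (v 0).2 (σ, J.cons i) * (v 1).1 i) := by
  rw [extDeriv_omega]
  simp only [ContinuousAlternatingMap.neg_apply, ContinuousAlternatingMap.sum_apply,
    wedge_oneForm_apply]
  rw [← Finset.sum_neg_distrib]
  refine Finset.sum_congr rfl fun i _ => ?_
  simp
  ring

/-! ### The contact coframe -/

/-- The part `v ↦ (0, ∑ i, y^σ_{Ji}(z) v^i)` of the contact coframe, linear in `z`. -/
def frameShift (z : JetCoord n m r) : JetCoord n m r →L[ℝ] JetCoord n m r :=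
  (ContinuousLinearMap.inr ℝ (EuclideanSpace ℝ (Fin n)) (Fin m × MultiIdx n r → ℝ)).comp
    (ContinuousLinearMap.pi fun p : Fin m × MultiIdx n r =>
      if h : Multiset.card p.2.1 < r then
        ∑ i, z.2 (p.1, LowIdx.cons i ⟨p.2.1, h⟩) • dx i
      else 0)

/-- The linear map `(v^i, v^σ_J) ↦ (v^i, v^σ_J + t ∑ i, y^σ_{Ji}(z) v^i)` (with the correction for
`|J| < r` only). For `t = -1` its components are the `dx^i`, the contact forms at `z`, and the
`dy^σ_J` with `|J| = r`; its inverse is obtained for `t = 1`. -/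
def frame (t : ℝ) (z : JetCoord n m r) : JetCoord n m r →L[ℝ] JetCoord n m r :=
  ContinuousLinearMap.id ℝ _ + t • frameShift z

theorem frame_fst (t : ℝ) (z v : JetCoord n m r) : (frame t z v).1 = v.1 := by
  simp [frame, frameShift]

theorem frame_low (t : ℝ) (z v : JetCoord n m r) (σ : Fin m) (J : LowIdx n r) :
    (frame t z v).2 (σ, J.toIdx) =
      v.2 (σ, J.toIdx) + t * ∑ i, z.2 (σ, J.cons i) * v.1 i := by
  have : Multiset.card J.toIdx.1 < r := J.2
  simp [frame, frameShift, this, sum_apply]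
  left; rfl

theorem frame_top (t : ℝ) (z v : JetCoord n m r) (p : Fin m × MultiIdx n r)
    (hp : Multiset.card p.2.1 = r) : (frame t z v).2 p = v.2 p := by
  simp [frame, frameShift, hp]

theorem jetCoord_ext {v w : JetCoord n m r} (h1 : v.1 = w.1)
    (h2 : ∀ σ (J : LowIdx n r), v.2 (σ, J.toIdx) = w.2 (σ, J.toIdx))
    (h3 : ∀ p : Fin m × MultiIdx n r, Multiset.card p.2.1 = r → v.2 p = w.2 p) : v = w := by
  refine Prod.ext h1 (funext fun p => ?_)
  rcases p.2.2.lt_or_eq with h | h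
  · exact h2 p.1 ⟨p.2.1, h⟩
  · exact h3 p h

theorem frame_frame (t : ℝ) (z v : JetCoord n m r) : frame (-t) z (frame t z v) = v := by
  refine jetCoord_ext ?_ (fun σ J => ?_) fun p hp => ?_
  · rw [frame_fst, frame_fst]
  · rw [frame_low, frame_low, frame_fst]; ring
  · rw [frame_top _ _ _ _ hp, frame_top _ _ _ _ hp]

theorem omega_eq_comp_frame (σ : Fin m) (J : LowIdx n r) (z : JetCoord n m r) :
    omega σ J z = (omega σ J 0).compContinuousLinearMap (frame (-1) z) := by
  ext v
  rw [ContinuousAlternatingMap.compContinuousLinearMap_apply, omega_apply, omega_apply]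
  simp [frame_low, sub_eq_add_neg]

theorem extDeriv_omega_eq_comp_frame (σ : Fin m) (I : TopIdx n r) (z : JetCoord n m r) :
    extDeriv (omega σ I.toLow) z =
      (extDeriv (omega σ I.toLow) 0).compContinuousLinearMap (frame (-1) z) := by
  have hI : ∀ i, Multiset.card (I.toLow.cons i).1 = r := fun i => by
    simpa [LowIdx.cons, TopIdx.toLow] using I.2
  ext v
  rw [ContinuousAlternatingMap.compContinuousLinearMap_apply, extDeriv_omega_apply,
    extDeriv_omega_apply]
  refine Finset.sum_congr rfl fun i _ => ?_
  simp only [Function.comp_apply, frame_fst, frame_top _ _ _ (σ, I.toLow.cons i) (hI i)]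

/-! ### Total derivatives -/

/-- The vectors `∑ i, v^i (∂_i + ∑ y^σ_{Ji} ∂/∂y^σ_J)`, i.e. the tangent vectors to the `r`-jet
prolongation of a section with the given jet `u` of order `r + 1`. -/
def totalLift (u : JetCoord n m (r + 1)) : EuclideanSpace ℝ (Fin n) →L[ℝ] JetCoord n m r :=
  (ContinuousLinearMap.id ℝ _).prod (ContinuousLinearMap.pi fun p : Fin m × MultiIdx n r =>
    ∑ i, u.2 (p.1, ⟨i ::ₘ p.2.1, by simpa using p.2.2⟩) • (EuclideanSpace.proj (𝕜 := ℝ) i))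

theorem totalLift_fst (u : JetCoord n m (r + 1)) (v : EuclideanSpace ℝ (Fin n)) :
    (totalLift u v).1 = v := rfl

theorem totalLift_snd (u : JetCoord n m (r + 1)) (v : EuclideanSpace ℝ (Fin n))
    (p : Fin m × MultiIdx n r) : (totalLift u v).2 p =
      ∑ i, u.2 (p.1, ⟨i ::ₘ p.2.1, by simpa using p.2.2⟩) * v i := by
  simp [totalLift, sum_apply]

theorem jetProj_snd (u : JetCoord n m (r + 1)) (σ : Fin m) (J : LowIdx n r) (i : Fin n) :
    (jetProj n m r u).2 (σ, J.cons i) =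
      u.2 (σ, ⟨i ::ₘ J.1, by simpa using J.2.le⟩) := rfl

theorem omega_totalLift (σ : Fin m) (J : LowIdx n r) (u : JetCoord n m (r + 1))
    (v : Fin 1 → EuclideanSpace ℝ (Fin n)) :
    omega σ J (jetProj n m r u) (fun i => totalLift u (v i)) = 0 := by
  rw [omega_apply, totalLift_snd, totalLift_fst]
  simp only [jetProj_snd]
  exact sub_self _

theorem extDeriv_omega_totalLift (σ : Fin m) (J : LowIdx n r) (z : JetCoord n m r)
    (u : JetCoord n m (r + 1)) (v : Fin 2 → EuclideanSpace ℝ (Fin n)) :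
    extDeriv (omega σ J) z (fun i => totalLift u (v i)) = 0 := by
  rw [extDeriv_omega_apply]
  simp only [totalLift_snd, totalLift_fst, Finset.sum_sub_distrib, Finset.sum_mul]
  rw [sub_eq_zero, Finset.sum_comm]
  refine Finset.sum_congr rfl fun i _ => Finset.sum_congr rfl fun j _ => ?_
  have : (⟨i ::ₘ (J.cons j).1, by simpa [LowIdx.cons] using J.2⟩ : MultiIdx n (r + 1)) =
      ⟨j ::ₘ (J.cons i).1, by simpa [LowIdx.cons] using J.2⟩ :=
    Subtype.ext (Multiset.cons_swap i j J.1)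
  rw [this]
  ring

end Coordinates

/-! ### Forms vanishing on holonomic planes: the constant coefficient case -/

section Constant

variable {n m r q : ℕ}

/-- The monomial indexing the coordinate `y^σ_J` with `|J| = r`: one variable for each index in `J`
and one for `σ`. -/
def topMono (p : Fin m × FullIdx n r) : Multiset (Fin n ⊕ Fin m) :=
  p.2.1.map Sum.inl + {Sum.inr p.1}

theorem map_inl_add_inj {J J' : Multiset (Fin n)} {σ σ' : Fin m}
    (h : J.map Sum.inl + {Sum.inr σ} = J'.map Sum.inl + {Sum.inr σ'}) : J = J' ∧ σ = σ' := by
  have h1 := congrArg (Multiset.filterMap Sum.getLeft?) h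
  have h2 := congrArg (Multiset.filterMap Sum.getRight?) h
  simp only [Multiset.filterMap_add, Multiset.filterMap_map] at h1 h2
  have e1 : ((Sum.getLeft? : Fin n ⊕ Fin m → Option (Fin n)) ∘ Sum.inl) = some := rfl
  have e2 : ∀ J : Multiset (Fin n), Multiset.filterMap
      ((Sum.getRight? : Fin n ⊕ Fin m → Option (Fin m)) ∘ Sum.inl) J = 0 := fun J => by
    induction J using Multiset.induction_on with
    | empty => rfl
    | cons a J ih => rw [Multiset.filterMap_cons_none _ _ rfl, ih]
  have e3 : ∀ σ, Multiset.filterMap (Sum.getLeft? : Fin n ⊕ Fin m → _) {Sum.inr σ} = 0 :=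
    fun _ => rfl
  have e4 : ∀ σ, Multiset.filterMap (Sum.getRight? : Fin n ⊕ Fin m → _) {Sum.inr σ} = {σ} :=
    fun _ => rfl
  rw [e1, Multiset.filterMap_some, Multiset.filterMap_some, e3, e3, add_zero, add_zero] at h1
  rw [e2, e2, e4, e4, zero_add, zero_add, Multiset.singleton_inj] at h2
  exact ⟨h1, h2⟩

theorem topMono_injective : Function.Injective (topMono (n := n) (m := m) (r := r)) :=
  fun p p' h => by
    obtain ⟨h1, h2⟩ := map_inl_add_inj h
    exact Prod.ext h2 (Subtype.ext h1)

theorem countP_topMono (p : Fin m × FullIdx n r) :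
    (topMono p).countP (fun s => s.isLeft) = r := by
  rw [topMono, Multiset.countP_add, Multiset.countP_map]
  have : Multiset.countP (fun s : Fin n ⊕ Fin m => s.isLeft = true) {Sum.inr p.1} = 0 := by
    rw [Multiset.countP_eq_zero]
    simp
  rw [this]
  simp [p.2.2]

/-- The Fock module of the forms on the jet space. -/
abbrev jetFock (n m r : ℕ) : FockModule (CoordIdx n m r) (Forms (JetCoord n m r)) :=
  formsFock (jetBasis n m r)

theorem jetBasis_fst (k : (Fin m × FullIdx n r) ⊕ (Fin m × LowIdx n r)) :
    (jetBasis n m r (Sum.inr k)).1 = 0 := by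
  ext i
  have h := jetBasis_repr (jetBasis n m r (Sum.inr k)) (Sum.inl i)
  rw [Module.Basis.repr_self, Finsupp.single_apply, if_neg (by simp)] at h
  exact h.symm

theorem exists_powVec_eq_contr (l : Fin n ⊕ Fin m → ℝ) :
    ∃ v : JetCoord n m r, v.1 = 0 ∧ (jetFock n m r).powVec topMono l = contr v := by
  refine ⟨∑ k, ((topMono k).map l).prod • jetBasis n m r (Sum.inr (Sum.inl k)), ?_, ?_⟩
  · simp [Prod.fst_sum, jetBasis_fst]
  · change _ = contrₗ _ _
    rw [map_sum]
    simp only [map_smul]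
    rfl

/-- The jet of order `r + 1` whose components of order at most `r` vanish, and whose components of
order `r + 1` are `∑ l, l_σ l^K`. -/
def powJet (ls : List (Fin n ⊕ Fin m → ℝ)) : JetCoord n m (r + 1) :=
  (0, fun p => if Multiset.card p.2.1 = r + 1 then
    (ls.map fun l => (p.2.1.map fun i => l (Sum.inl i)).prod * l (Sum.inr p.1)).sum else 0)

theorem jetProj_powJet (ls : List (Fin n ⊕ Fin m → ℝ)) : jetProj n m r (powJet ls) = 0 := by
  refine Prod.ext rfl (funext fun p => ?_)
  have : Multiset.card p.2.1 ≠ r + 1 := by have := p.2.2; omega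
  simp [jetProj, powJet, this]

/-- The plane with parameters `ls` is the holonomic plane of the jet `powJet ls`. -/
theorem planeVec_eq_contr (ls : List (Fin n ⊕ Fin m → ℝ)) (j : Fin n) :
    (jetFock n m r).planeVec topMono ls j =
      contr (totalLift (powJet ls) (EuclideanSpace.single j 1)) := by
  rw [contr_eq_sum (jetBasis n m r)]
  simp only [jetBasis_repr, Fintype.sum_sum_type, coordEquiv_inl, coordEquiv_full, coordEquiv_low,
    totalLift_fst, totalLift_snd]
  have h1 : ∑ i, (EuclideanSpace.single j (1 : ℝ)) i • contr (jetBasis n m r (Sum.inl i)) =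
      (jetFock n m r).i (Sum.inl j) := by
    rw [Finset.sum_eq_single j (fun i _ hi => by simp [hi]) (by simp)]
    simp [formsFock_i]
  have h2 : ∀ (p : Fin m × MultiIdx n r),
      ∑ i, (powJet ls : JetCoord n m (r + 1)).2 (p.1, ⟨i ::ₘ p.2.1, by simpa using p.2.2⟩) *
        (EuclideanSpace.single j (1 : ℝ)) i =
      if Multiset.card p.2.1 = r then (ls.map fun l => l (Sum.inl j) *
        ((p.2.1.map fun i => l (Sum.inl i)).prod * l (Sum.inr p.1))).sum else 0 := by
    intro p
    rw [Finset.sum_eq_single j (fun i _ hi => by simp [hi]) (by simp)]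
    simp [powJet, mul_assoc]
  have h3 : ∀ p : Fin m × LowIdx n r, Multiset.card p.2.toIdx.1 ≠ r := fun p => p.2.2.ne
  have h4 : ∀ p : Fin m × FullIdx n r, Multiset.card p.2.1 = r := fun p => p.2.2
  have h5 : (ls.map fun l => l (Sum.inl j) • (jetFock n m r).powVec topMono l).sum =
      ∑ p : Fin m × FullIdx n r, (ls.map fun l => l (Sum.inl j) *
        ((p.2.1.map fun i => l (Sum.inl i)).prod * l (Sum.inr p.1))).sum •
          contr (jetBasis n m r (Sum.inr (Sum.inl p))) := by
    clear h2
    induction ls with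
    | nil => simp
    | cons l ls ih =>
      simp only [List.map_cons, List.sum_cons, add_smul, Finset.sum_add_distrib]
      rw [ih]
      congr 1
      rw [FockModule.powVec, Finset.smul_sum]
      refine Finset.sum_congr rfl fun k _ => ?_
      rw [smul_smul, topMono, Multiset.map_add, Multiset.prod_add, Multiset.map_map]
      simp [formsFock_i]
  rw [h1, FockModule.planeVec, h5]
  congr 1
  rw [Finset.sum_eq_zero (s := (Finset.univ : Finset (Fin m × LowIdx n r))) fun p _ => ?_, add_zero]
  · refine Finset.sum_congr rfl fun p _ => ?_
    rw [h2 (p.1, ⟨p.2.1, p.2.2.le⟩), if_pos (h4 p)]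
  · rw [h2 (p.1, p.2.toIdx), if_neg (h3 p), zero_smul]

/-- The form `α` vanishes whenever the first `k` arguments are vertical and the remaining ones
are tangent to one holonomic plane at `z`. The plane is the range of `totalLift u` for a jet `u` of
order `r + 1` over `z`. -/
def VanishesOnHolonomic (k : ℕ) (z : JetCoord n m r) (α : JetCoord n m r [⋀^Fin q]→L[ℝ] ℝ) : Prop :=
  ∀ u : JetCoord n m (r + 1), jetProj n m r u = z → ∀ w : Fin q → JetCoord n m r,
    (∀ i : Fin q, (i : ℕ) < k → (w i).1 = 0) →
    (∀ i : Fin q, k ≤ (i : ℕ) → ∃ v, w i = totalLift u v) → α w = 0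

/-- The contact coframe carries the holonomic planes at the origin to those at `z`. -/
theorem VanishesOnHolonomic.comp_frame {k : ℕ} {z : JetCoord n m r}
    {α : JetCoord n m r [⋀^Fin q]→L[ℝ] ℝ} (h : VanishesOnHolonomic k z α) :
    VanishesOnHolonomic k 0 (α.compContinuousLinearMap (frame 1 z)) := by
  intro u hu w hw hw'
  let u' : JetCoord n m (r + 1) := (z.1, fun p =>
    if h : Multiset.card p.2.1 ≤ r then z.2 (p.1, ⟨p.2.1, h⟩) else u.2 p)
  have hu' : jetProj n m r u' = z := by
    refine Prod.ext rfl (funext fun p => ?_)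
    have := p.2.2
    simp [jetProj, u', this]
  have key : ∀ v, frame 1 z (totalLift u v) = totalLift u' v := by
    intro v
    refine jetCoord_ext ?_ (fun σ J => ?_) fun p hp => ?_
    · rw [frame_fst]; rfl
    · have h0 : ∀ i, u.2 (σ, ⟨i ::ₘ J.1, by simpa using J.2.le⟩) = 0 := fun i => by
        rw [← jetProj_snd u σ J i, hu]; rfl
      have h1 : ∀ i, u'.2 (σ, ⟨i ::ₘ J.1, by simpa using J.2.le⟩) = z.2 (σ, J.cons i) := fun i => by
        rw [← jetProj_snd u' σ J i, hu']
      rw [frame_low, totalLift_snd, totalLift_snd, totalLift_fst]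
      simp only [LowIdx.toIdx, h0, h1]
      simp
    · rw [frame_top _ _ _ _ hp, totalLift_snd, totalLift_snd]
      refine Finset.sum_congr rfl fun i _ => ?_
      simp [u', hp]
  refine h u' hu' _ (fun i hi => ?_) fun i hi => ?_
  · exact (frame_fst 1 z (w i)).trans (hw i hi)
  · obtain ⟨v, hv⟩ := hw' i hi
    exact ⟨v, (congrArg (frame 1 z) hv).trans (key v)⟩

/-- Among the holonomic planes at the origin are those whose components of highest order are sums of
monomials in finitely many parameters `l`. -/
theorem VanishesOnHolonomic.vanishesOnPlanes {k : ℕ} {α : JetCoord n m r [⋀^Fin (n + k)]→L[ℝ] ℝ}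
    (h : VanishesOnHolonomic k 0 α) :
    (jetFock n m r).VanishesOnPlanes topMono vacuum k (Pi.single (n + k) α) := by
  intro vs hvs hk ls
  have hv : ∃ us : List (JetCoord n m r), (∀ u ∈ us, u.1 = 0) ∧ vs = us.map contr := by
    clear hk
    induction vs with
    | nil => exact ⟨[], by simp, rfl⟩
    | cons v vs ih =>
      obtain ⟨us, hus, rfl⟩ := ih fun v hv => hvs v (List.mem_cons_of_mem _ hv)
      rcases hvs v List.mem_cons_self with ⟨l, rfl⟩ | ⟨g, rfl⟩
      · obtain ⟨u, hu, e⟩ := exists_powVec_eq_contr (n := n) (m := m) (r := r) l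
        exact ⟨u :: us, by simpa [hu] using hus, by rw [e]; rfl⟩
      · exact ⟨jetBasis n m r (Sum.inr (Sum.inr g)) :: us, by
          simpa [jetBasis_fst] using hus, rfl⟩
  obtain ⟨us, hus, rfl⟩ := hv
  let D : Fin n → JetCoord n m r := fun j => totalLift (powJet ls) (EuclideanSpace.single j 1)
  let L : List (JetCoord n m r) := us.reverse ++ ((List.finRange n).map D).reverse
  have hus' : us.length = k := by simpa using hk
  have hL : L.length = n + k := by simp [L, hus', add_comm]
  let w : Fin (n + k) → JetCoord n m r := fun i => L.get (i.cast hL.symm)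
  have hw : List.ofFn w = L := by
    refine List.ext_get (by simp [hL]) fun i h1 h2 => by simp [w]
  have hplane : ((List.finRange n).map ((jetFock n m r).planeVec topMono ls)) =
      ((List.finRange n).map D).map contr := by
    rw [List.map_map]
    exact List.map_congr_left fun j _ => planeVec_eq_contr ls j
  rw [hplane, ← Module.End.mul_apply, ← List.prod_append, ← List.map_append]
  have hrev : (List.finRange n).map D ++ us = (List.ofFn w).reverse := by
    rw [hw]; simp [L]
  rw [hrev, vacuum_prod_contr, Pi.single_eq_same]
  refine h (powJet ls) (jetProj_powJet ls) w (fun i hi => ?_) fun i hi => ?_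
  · refine hus _ ?_
    have : w i = us.reverse[(i : ℕ)]'(by simpa [hus'] using hi) := by
      simp only [w, L, List.get_eq_getElem, Fin.val_cast]
      exact List.getElem_append_left (by simpa [hus'] using hi)
    rw [this]
    exact List.mem_reverse.mp (List.getElem_mem _)
  · have hmem : w i ∈ ((List.finRange n).map D).reverse := by
      have : w i = ((List.finRange n).map D).reverse[(i : ℕ) - us.reverse.length]'(by
          simp [hus']; omega) := by
        simp only [w, L, List.get_eq_getElem, Fin.val_cast]
        exact List.getElem_append_right (by simpa [hus'] using hi)
      rw [this]
      exact List.getElem_mem _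
    obtain ⟨j, -, hj⟩ := List.mem_map.mp (List.mem_reverse.mp hmem)
    exact ⟨_, hj.symm⟩

end Constant

/-! ### Expressions in terms of the contact forms -/

section ContactSum

variable {n m r q : ℕ}

section

variable {E : Type*} [NormedAddCommGroup E] [NormedSpace ℝ E]

theorem wedgeOp_wedge (h : 1 + 1 = 2) (f g : E →L[ℝ] ℝ) (x : Forms E) :
    wedgeOp (wedge h (oneForm f) (oneForm g)) x = wedgeOp (oneForm f) (wedgeOp (oneForm g) x) := by
  funext q
  by_cases hq : 2 ≤ q
  · obtain ⟨b, rfl⟩ := Nat.exists_eq_add_of_le hq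
    rw [wedgeOp_apply (d := b) rfl, wedgeOp_apply (d := 1 + b) (by ring),
      wedgeOp_apply (d := b) rfl]
    exact wedge_oneForm_oneForm_wedge _ _ _ _ _ _ _
  · rw [wedgeOp_apply_of_lt (d := 0) _ (by simp) (by omega),
      wedgeOp_apply_of_lt (d := 1) _ (fun q hq => ?_) (by omega)]
    exact wedgeOp_apply_of_lt (d := 0) _ (by simp) (by omega)

theorem wedgeOp_neg_sum {ι : Type*} [Fintype ι] {e : ℕ} (η : ι → E [⋀^Fin e]→L[ℝ] ℝ) (x : Forms E) :
    wedgeOp (-∑ j, η j) x = -∑ j, wedgeOp (η j) x := by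
  let T : (E [⋀^Fin e]→L[ℝ] ℝ) →ₗ[ℝ] Forms E :=
    { toFun := fun η => wedgeOp η x
      map_add' := fun η η' => funext fun q => by
        rw [Pi.add_apply]
        by_cases h : e ≤ q
        · simp only [wedgeOp_apply (Nat.add_sub_cancel' h), add_wedge]
        · simp only [wedgeOp_apply_of_lt (d := 0) (x := x) _ (by simp) (not_le.mp h), add_zero]
      map_smul' := fun t η => funext fun q => by
        rw [Pi.smul_apply]
        by_cases h : e ≤ q
        · simp only [wedgeOp_apply (Nat.add_sub_cancel' h), smul_wedge, RingHom.id_apply]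
        · simp only [wedgeOp_apply_of_lt (d := 0) (x := x) _ (by simp) (not_le.mp h), smul_zero] }
  have h := map_neg T (∑ j, η j)
  rw [map_sum] at h
  exact h

end

theorem jetFock_low (p : Fin m × LowIdx n r) :
    (jetFock n m r).e (Sum.inr (Sum.inr p)) = wedgeOp (omega p.1 p.2 0) := by
  rw [formsFock_e, coordCLM_low, omega_eq]
  simp

/-- The forms `∑ j, dy_{Mj} ∧ dx^j` are the differentials of the contact forms of highest order. -/
theorem curvOp_eq (M : Multiset (Fin n ⊕ Fin m)) :
    (jetFock n m r).curvOp topMono M = 0 ∨ ∃ I : Fin m × TopIdx n r, ∀ x,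
      (jetFock n m r).curvOp topMono M x = -wedgeOp (extDeriv (omega I.1 I.2.toLow) 0) x := by
  by_cases hM : ∃ (σ : Fin m) (I : TopIdx n r), M = I.1.map Sum.inl + {Sum.inr σ}
  · obtain ⟨σ, I, rfl⟩ := hM
    refine Or.inr ⟨(σ, I), fun x => ?_⟩
    rw [extDeriv_omega, wedgeOp_neg_sum, neg_neg, FockModule.curvOp, LinearMap.sum_apply]
    refine Finset.sum_congr rfl fun j _ => ?_
    have h := FockModule.dyOp_apply (F := jetFock n m r) topMono_injective
      (σ, ⟨j ::ₘ I.1, by simpa using I.2⟩)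
    have h' : topMono (σ, (⟨j ::ₘ I.1, by simpa using I.2⟩ : FullIdx n r)) =
        Sum.inl j ::ₘ (I.1.map Sum.inl + {Sum.inr σ}) := by
      simp [topMono]
    rw [h'] at h
    rw [Module.End.mul_apply, h, formsFock_e, formsFock_e, coordCLM_top, coordCLM_inl]
    exact (wedgeOp_wedge _ _ _ x).symm
  · refine Or.inl (Finset.sum_eq_zero fun j _ => ?_)
    have : (jetFock n m r).dyOp topMono (Sum.inl j ::ₘ M) = 0 := by
      refine Finset.sum_eq_zero fun p _ => if_neg fun h => hM ?_
      have hj : j ∈ p.2.1 := by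
        have : Sum.inl j ∈ topMono p := h ▸ Multiset.mem_cons_self _ _
        simpa [topMono] using this
      obtain ⟨I, hI⟩ := Multiset.exists_cons_of_mem hj
      refine ⟨p.1, ⟨I, by simpa [hI] using p.2.2⟩, ?_⟩
      rw [topMono, hI, Multiset.map_cons, Multiset.cons_add, Multiset.cons_inj_right] at h
      exact h.symm
    rw [this, zero_mul]

/-- The coefficients `Φ` of an expression in terms of the contact forms. -/
abbrev Coeffs (n m r : ℕ) : Type :=
  ∀ p s : ℕ, (Fin p → Fin m × LowIdx n r) → (Fin s → Fin m × TopIdx n r) →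
    JetCoord n m r [⋀^Fin (n - 1 - s)]→L[ℝ] ℝ

/-- The form with coefficients `Φ` in terms of the contact forms at `z` and their differentials. -/
def contactSum (hq : n + 1 ≤ q) (z : JetCoord n m r) :
    Coeffs n m r →ₗ[ℝ] (JetCoord n m r [⋀^Fin q]→L[ℝ] ℝ) where
  toFun Φ :=
    ∑ ps : {ps : ℕ × ℕ // ps ∈ (Finset.HasAntidiagonal.antidiagonal (q - n + 1)).filter
      (fun ps => ps.2 < n)},
    ∑ J : Fin ps.1.1 → Fin m × LowIdx n r, ∑ I : Fin ps.1.2 → Fin m × TopIdx n r,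
      castDeg
        (degree_eq hq (Finset.HasAntidiagonal.mem_antidiagonal.mp (Finset.mem_filter.mp ps.2).1)
          (Finset.mem_filter.mp ps.2).2)
        (iterWedge ps.1.1 (fun a => omega (J a).1 (J a).2 z)
          (iterWedge ps.1.2 (fun b => extDeriv (omega (I b).1 (I b).2.toLow) z)
            (Φ ps.1.1 ps.1.2 J I)))
  map_add' Φ Ψ := by
    simp only [Pi.add_apply, iterWedge_add, castDeg_add, Finset.sum_add_distrib]
  map_smul' t Φ := by
    simp only [Pi.smul_apply, iterWedge_smul, castDeg_smul, Finset.smul_sum, RingHom.id_apply]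

theorem contactSum_apply (hq : n + 1 ≤ q) (z : JetCoord n m r) (Φ : Coeffs n m r) :
    contactSum hq z Φ =
    ∑ ps : {ps : ℕ × ℕ // ps ∈ (Finset.HasAntidiagonal.antidiagonal (q - n + 1)).filter
      (fun ps => ps.2 < n)},
    ∑ J : Fin ps.1.1 → Fin m × LowIdx n r, ∑ I : Fin ps.1.2 → Fin m × TopIdx n r,
      castDeg
        (degree_eq hq (Finset.HasAntidiagonal.mem_antidiagonal.mp (Finset.mem_filter.mp ps.2).1)
          (Finset.mem_filter.mp ps.2).2)
        (iterWedge ps.1.1 (fun a => omega (J a).1 (J a).2 z)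
          (iterWedge ps.1.2 (fun b => extDeriv (omega (I b).1 (I b).2.toLow) z)
            (Φ ps.1.1 ps.1.2 J I))) := rfl

open Classical in
/-- A single product of contact forms and their differentials is an expression in which all
coefficients but one vanish. -/
theorem iterWedge_mem_range_contactSum (hq : n + 1 ≤ q) (z : JetCoord n m r) {p s : ℕ}
    (hps : p + s = q - n + 1) (hs : s < n) (J : Fin p → Fin m × LowIdx n r)
    (I : Fin s → Fin m × TopIdx n r) (φ : JetCoord n m r [⋀^Fin (n - 1 - s)]→L[ℝ] ℝ) :
    castDeg (degree_eq hq hps hs) (iterWedge p (fun a => omega (J a).1 (J a).2 z)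
      (iterWedge s (fun b => extDeriv (omega (I b).1 (I b).2.toLow) z) φ)) ∈
      LinearMap.range (contactSum hq z) := by
  have zero : ∀ {p s : ℕ} (h : p * 1 + (s * 2 + (n - 1 - s)) = q) (J : Fin p → Fin m × LowIdx n r)
      (I : Fin s → Fin m × TopIdx n r), castDeg h (iterWedge p (fun a => omega (J a).1 (J a).2 z)
      (iterWedge s (fun b => extDeriv (omega (I b).1 (I b).2.toLow) z) 0)) = 0 := by
    intro p s h J I
    rw [← zero_smul ℝ (0 : JetCoord n m r [⋀^Fin (n - 1 - s)]→L[ℝ] ℝ), iterWedge_smul,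
      iterWedge_smul, castDeg_smul, zero_smul]
  refine ⟨Pi.single p (Pi.single s (Pi.single J (Pi.single I φ))), ?_⟩
  have hmem : (p, s) ∈ (Finset.HasAntidiagonal.antidiagonal (q - n + 1)).filter
      (fun ps : ℕ × ℕ => ps.2 < n) := by simp [hps, hs]
  rw [contactSum_apply, Finset.sum_eq_single ⟨(p, s), hmem⟩, Finset.sum_eq_single J,
    Finset.sum_eq_single I]
  · simp only [Pi.single_eq_same]
  · intro I' _ hI
    simp only [Pi.single_eq_same]
    rw [Pi.single_eq_of_ne hI, zero]
  · simp
  · intro J' _ hJ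
    refine Finset.sum_eq_zero fun I' _ => ?_
    simp only [Pi.single_eq_same]
    rw [Pi.single_eq_of_ne hJ, Pi.zero_apply, zero]
  · simp
  · rintro ⟨⟨p', s'⟩, h'⟩ _ hne
    refine Finset.sum_eq_zero fun J' _ => Finset.sum_eq_zero fun I' _ => ?_
    dsimp only
    by_cases hp : p' = p
    · subst hp
      have hs : s' ≠ s := fun h => hne (by subst h; rfl)
      rw [Pi.single_eq_same, Pi.single_eq_of_ne hs, Pi.zero_apply, Pi.zero_apply, zero]
    · rw [Pi.single_eq_of_ne hp, Pi.zero_apply, Pi.zero_apply, Pi.zero_apply, zero]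
  · simp

theorem curvIdeal_le (s : ℕ) (N : Submodule ℝ (Forms (JetCoord n m r)))
    (h : ∀ (I : Fin s → Fin m × TopIdx n r) (x : Forms (JetCoord n m r)),
      (List.ofFn fun b => wedgeOp (extDeriv (omega (I b).1 (I b).2.toLow) 0)).prod x ∈ N) :
    (jetFock n m r).curvIdeal topMono s ≤ N := by
  induction s generalizing N with
  | zero => exact fun x _ => by simpa using h Fin.elim0 x
  | succ s ih =>
    refine iSup_le fun M => Submodule.map_le_iff_le_comap.mpr ?_
    rcases curvOp_eq (r := r) M with hM | ⟨I, hM⟩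
    · intro x _
      rw [Submodule.mem_comap, hM]
      exact N.zero_mem
    · have := ih (N.comap (wedgeOp (extDeriv (omega I.1 I.2.toLow) 0))) fun I' x => by
        have := h (Fin.cons I I') x
        simpa using this
      intro x hx
      rw [Submodule.mem_comap, hM]
      exact N.neg_mem (this hx)

theorem contactSpan_le (p s : ℕ) (N : Submodule ℝ (Forms (JetCoord n m r)))
    (h : ∀ (J : Fin p → Fin m × LowIdx n r) (I : Fin s → Fin m × TopIdx n r)
      (x : Forms (JetCoord n m r)), (List.ofFn fun a => wedgeOp (omega (J a).1 (J a).2 0)).prod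
        ((List.ofFn fun b => wedgeOp (extDeriv (omega (I b).1 (I b).2.toLow) 0)).prod x) ∈ N) :
    (jetFock n m r).contactSpan topMono p s ≤ N := by
  induction p generalizing N with
  | zero => exact curvIdeal_le s N fun I x => by simpa using h Fin.elim0 I x
  | succ p ih =>
    refine iSup_le fun g => Submodule.map_le_iff_le_comap.mpr (ih _ fun J I x => ?_)
    rw [Submodule.mem_comap, jetFock_low]
    have := h (Fin.cons g J) I x
    simpa using this

/-- The structure theorem at the origin: the form lies in the algebraic ideal of products of `k + 1`
contact forms and differentials, whose elements of degree `n + k` are the contact sums. -/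
theorem mem_range_contactSum (hq : n + 1 ≤ q) {α : JetCoord n m r [⋀^Fin q]→L[ℝ] ℝ}
    (h : VanishesOnHolonomic (q - n) 0 α) : α ∈ LinearMap.range (contactSum hq 0) := by
  obtain ⟨k, rfl⟩ := Nat.exists_eq_add_of_le (Nat.le_of_succ_le hq)
  rw [Nat.add_sub_cancel_left] at h
  have h1 := FockModule.mem_contactIdeal (F := jetFock n m r) (ε := vacuum) topMono_injective
    countP_topMono (fun k x => vacuum_wedgeOp _ x) (fun x => eq_zero_of_contr (jetBasis n m r) x)
    (by simpa using single_mem_iSup_homog (jetBasis n m r) (n + k) α) h.vanishesOnPlanes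
  have h2 : (jetFock n m r).contactIdeal topMono (k + 1) ≤
      (LinearMap.range (contactSum hq (0 : JetCoord n m r))).comap (LinearMap.proj (n + k)) := by
    refine iSup_le fun ps => contactSpan_le _ _ _ fun J I x => ?_
    obtain ⟨⟨p, s⟩, hps⟩ := ps
    dsimp only at hps J I ⊢
    rw [Submodule.mem_comap, LinearMap.proj_apply]
    by_cases hs : s < n
    · have hps' : p + s = n + k - n + 1 := by omega
      have := iterWedge_mem_range_contactSum hq 0 hps' hs J I (x (n - 1 - s))
      rw [← prod_wedgeOp_apply, ← prod_wedgeOp_apply, castDeg_apply] at this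
      exact this
    -- For `n ≤ s` the product has degree at least `p + 2 s`, which exceeds `n + k`.
    · rw [prod_wedgeOp_apply_of_lt (d := s * 2) p _ _ (fun q hq => ?_) (by omega)]
      · exact Submodule.zero_mem _
      · exact prod_wedgeOp_apply_of_lt (d := 0) s _ _ (by simp) (by omega)
  have h3 := h2 h1
  rw [Submodule.mem_comap, LinearMap.proj_apply, Pi.single_eq_same] at h3
  exact h3

end ContactSum

/-! ### Smooth dependence on the base point -/

theorem exists_rightInverse_on_range {V W : Type*} [AddCommGroup V] [Module ℝ V] [AddCommGroup W]
    [Module ℝ W] (f : V →ₗ[ℝ] W) :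
    ∃ g : W →ₗ[ℝ] V, ∀ w ∈ LinearMap.range f, f (g w) = w := by
  obtain ⟨g₀, hg₀⟩ := LinearMap.exists_rightInverse_of_surjective f.rangeRestrict
    (LinearMap.range_rangeRestrict _)
  obtain ⟨g, hg⟩ := g₀.exists_extend
  refine ⟨g, fun w hw => ?_⟩
  have h1 : g w = g₀ ⟨w, hw⟩ := LinearMap.congr_fun hg ⟨w, hw⟩
  rw [h1]
  exact congrArg Subtype.val (LinearMap.congr_fun hg₀ ⟨w, hw⟩)

section Smooth

variable {E M : Type*} [NormedAddCommGroup E] [NormedSpace ℝ E] [NormedAddCommGroup M]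
  [NormedSpace ℝ M] {κ : Type*} [Fintype κ] {q : ℕ}

/-- The values of an alternating form on tuples of basis vectors. -/
def evalBasis (b : Module.Basis κ ℝ E) (q : ℕ) :
    (E [⋀^Fin q]→L[ℝ] ℝ) →ₗ[ℝ] ((Fin q → κ) → ℝ) where
  toFun α f := α fun i => b (f i)
  map_add' _ _ := rfl
  map_smul' _ _ := rfl

theorem evalBasis_injective (b : Module.Basis κ ℝ E) (q : ℕ) :
    Function.Injective (evalBasis b q) := by
  intro α β h
  refine ContinuousAlternatingMap.toAlternatingMap_injective ?_
  exact Module.Basis.ext_alternating b fun f _ => congrFun h f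

theorem finiteDimensional_forms (b : Module.Basis κ ℝ E) (q : ℕ) :
    FiniteDimensional ℝ (E [⋀^Fin q]→L[ℝ] ℝ) :=
  FiniteDimensional.of_injective (evalBasis b q) (evalBasis_injective b q)

/-- Smoothness of a form can be checked on its values at basis vectors. -/
theorem contDiffOn_of_evalBasis (b : Module.Basis κ ℝ E) {F : M → E [⋀^Fin q]→L[ℝ] ℝ} {U : Set M}
    (h : ∀ f : Fin q → κ, ContDiffOn ℝ ∞ (fun z => F z fun i => b (f i)) U) :
    ContDiffOn ℝ ∞ F U := by
  classical
  obtain ⟨g, hg⟩ := LinearMap.exists_leftInverse_of_injective (evalBasis b q)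
    (LinearMap.ker_eq_bot.mpr (evalBasis_injective b q))
  have hF : F = fun z => LinearMap.toContinuousLinearMap g (fun f => F z fun i => b (f i)) := by
    funext z
    exact (LinearMap.congr_fun hg (F z)).symm
  rw [hF]
  exact (LinearMap.toContinuousLinearMap g).contDiff.comp_contDiffOn (contDiffOn_pi.mpr h)

theorem ContDiffOn.compContinuousLinearMap_forms (b : Module.Basis κ ℝ E)
    {F : M → E [⋀^Fin q]→L[ℝ] ℝ} {U : Set M} (hF : ContDiffOn ℝ ∞ F U) {T : M → E →L[ℝ] E}
    (hT : ∀ x k, ContDiffOn ℝ ∞ (fun z => b.repr (T z x) k) U) :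
    ContDiffOn ℝ ∞ (fun z => (F z).compContinuousLinearMap (T z)) U := by
  classical
  refine contDiffOn_of_evalBasis b fun f => ?_
  have h : ∀ z, (F z).compContinuousLinearMap (T z) (fun i => b (f i)) =
      ∑ g : Fin q → κ, (∏ i, b.repr (T z (b (f i))) (g i)) * F z (fun i => b (g i)) := by
    intro z
    rw [ContinuousAlternatingMap.compContinuousLinearMap_apply]
    have e : (⇑(T z) ∘ fun i => b (f i)) =
        fun i => ∑ k, b.repr (T z (b (f i))) k • b k := funext fun i => (b.sum_repr _).symm
    rw [e, ContinuousAlternatingMap.map_sum]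
    refine Finset.sum_congr rfl fun g _ => ?_
    exact (F z).map_smul_univ (fun i => b.repr (T z (b (f i))) (g i)) fun i => b (g i)
  simp only [h]
  refine ContDiffOn.sum fun g _ => ContDiffOn.mul (contDiffOn_prod fun i _ => hT _ _) ?_
  exact (ContinuousAlternatingMap.apply ℝ E ℝ fun i => b (g i)).contDiff.comp_contDiffOn hF

end Smooth

section Jets

variable {n m r q : ℕ}

theorem contDiff_frame_repr (t : ℝ) (x : JetCoord n m r) (k : CoordIdx n m r) :
    ContDiff ℝ ∞ (fun z => (jetBasis n m r).repr (frame t z x) k) := by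
  simp only [jetBasis_repr]
  rcases k with i | p | p
  · simp only [coordEquiv_inl, frame_fst]
    exact contDiff_const
  · simp only [coordEquiv_full, frame_top _ _ _ (p.1, (⟨p.2.1, p.2.2.le⟩ : MultiIdx n r)) p.2.2]
    exact contDiff_const
  · simp only [coordEquiv_low, frame_low]
    refine contDiff_const.add (contDiff_const.mul (ContDiff.sum fun i _ => ?_))
    exact (dy (p.1, p.2.cons i)).contDiff.mul contDiff_const

theorem contDiffOn_comp_frame {U : Set (JetCoord n m r)} (t : ℝ)
    {F : JetCoord n m r → JetCoord n m r [⋀^Fin q]→L[ℝ] ℝ} (hF : ContDiffOn ℝ ∞ F U) :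
    ContDiffOn ℝ ∞ (fun z => (F z).compContinuousLinearMap (frame t z)) U :=
  ContDiffOn.compContinuousLinearMap_forms (jetBasis n m r) hF fun x k =>
    (contDiff_frame_repr t x k).contDiffOn

theorem contactSum_comp_frame (hq : n + 1 ≤ q) (z : JetCoord n m r) (Φ : Coeffs n m r) :
    (contactSum hq 0 Φ).compContinuousLinearMap (frame (-1) z) =
      contactSum hq z fun p s J I => (Φ p s J I).compContinuousLinearMap (frame (-1) z) := by
  change ContinuousAlternatingMap.compContinuousLinearMapₗ (frame (-1) z) (contactSum hq 0 Φ) = _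
  rw [contactSum_apply, contactSum_apply, map_sum]
  refine Finset.sum_congr rfl fun ps _ => ?_
  rw [map_sum]
  refine Finset.sum_congr rfl fun J _ => ?_
  rw [map_sum]
  refine Finset.sum_congr rfl fun I _ => ?_
  change (castDeg _ _).compContinuousLinearMap _ = _
  rw [castDeg_compContinuousLinearMap, iterWedge_compContinuousLinearMap,
    iterWedge_compContinuousLinearMap]
  simp only [← omega_eq_comp_frame, ← extDeriv_omega_eq_comp_frame]

/-- A smooth form on a set of jets which vanishes on holonomic planes has an expression in terms of
the contact forms with smooth coefficients. In the contact coframe the coefficients are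
a fixed linear function of the form. -/
theorem exists_contactSum (hq : n + 1 ≤ q) {U : Set (JetCoord n m r)}
    {ρ : JetCoord n m r → JetCoord n m r [⋀^Fin q]→L[ℝ] ℝ} (hρ : ContDiffOn ℝ ∞ ρ U)
    (h : ∀ z ∈ U, VanishesOnHolonomic (q - n) z (ρ z)) :
    ∃ Φ : ∀ p s : ℕ, (Fin p → Fin m × LowIdx n r) → (Fin s → Fin m × TopIdx n r) →
      JetCoord n m r → JetCoord n m r [⋀^Fin (n - 1 - s)]→L[ℝ] ℝ,
    (∀ p s J I, ContDiffOn ℝ ∞ (Φ p s J I) U) ∧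
    ∀ z ∈ U, ρ z = contactSum hq z fun p s J I => Φ p s J I z := by
  obtain ⟨g, hg'⟩ := exists_rightInverse_on_range (contactSum hq (0 : JetCoord n m r))
  refine ⟨fun p s J I z => (g ((ρ z).compContinuousLinearMap (frame 1 z))
    p s J I).compContinuousLinearMap (frame (-1) z),
    fun p s J I => contDiffOn_comp_frame (-1) ?_, fun z hz => ?_⟩
  · have := finiteDimensional_forms (jetBasis n m r) q
    let T : (JetCoord n m r [⋀^Fin q]→L[ℝ] ℝ) →ₗ[ℝ] JetCoord n m r [⋀^Fin (n - 1 - s)]→L[ℝ] ℝ :=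
      { toFun := fun α => g α p s J I
        map_add' := fun α β => by rw [map_add]; rfl
        map_smul' := fun t α => by rw [map_smul]; rfl }
    exact (LinearMap.toContinuousLinearMap T).contDiff.comp_contDiffOn (contDiffOn_comp_frame 1 hρ)
  · have h1 := hg' _ (mem_range_contactSum hq (h z hz).comp_frame)
    rw [← contactSum_comp_frame, h1]
    ext v
    simp only [ContinuousAlternatingMap.compContinuousLinearMap_apply]
    congr 1
    funext i
    have := frame_frame (-1) z (v i)
    rw [neg_neg] at this
    exact this.symm

/-! ### Orders of vanishing along a plane -/

/-- The form `α` vanishes if fewer than `k` of its arguments lie outside `H`. -/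
def VanishesToOrder {E : Type*} [NormedAddCommGroup E] [NormedSpace ℝ E] (H : Set E) (k : ℕ)
    (α : E [⋀^Fin q]→L[ℝ] ℝ) : Prop :=
  ∀ w : Fin q → E, Nat.card {i // w i ∉ H} < k → α w = 0

section

variable {E : Type*} [NormedAddCommGroup E] [NormedSpace ℝ E] {H : Set E}

/-- In each term of the product either `α` has fewer than `k` or `β` fewer than `l` arguments
outside `H`. -/
theorem VanishesToOrder.wedge {a b c k l : ℕ} (h : a + b = c) {α : E [⋀^Fin a]→L[ℝ] ℝ}
    {β : E [⋀^Fin b]→L[ℝ] ℝ} (hα : VanishesToOrder H k α) (hβ : VanishesToOrder H l β) :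
    VanishesToOrder H (k + l) (JetForms.wedge h α β) := by
  intro w hw
  rw [wedge_apply]
  refine mul_eq_zero_of_right _ (Finset.sum_eq_zero fun τ _ => mul_eq_zero_of_right _ ?_)
  have hcard : Nat.card {i // w (τ (finCongr h (Fin.castAdd b i))) ∉ H} +
      Nat.card {j // w (τ (finCongr h (Fin.natAdd a j))) ∉ H} = Nat.card {i // w i ∉ H} := by
    rw [← Nat.card_sum]
    refine Nat.card_congr (Equiv.trans ?_
      (Equiv.subtypeEquivOfSubtype ((finSumFinEquiv.trans (finCongr h)).trans τ)))
    exact (Equiv.subtypeSum (p := fun x : Fin a ⊕ Fin b =>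
      w (τ (finCongr h (finSumFinEquiv x))) ∉ H)).symm
  rcases lt_or_ge (Nat.card {i // w (τ (finCongr h (Fin.castAdd b i))) ∉ H}) k with h1 | h1
  · exact mul_eq_zero_of_left (hα _ h1) _
  · exact mul_eq_zero_of_right _ (hβ _ (by omega))

theorem VanishesToOrder.castDeg {a b k : ℕ} (h : a = b) {α : E [⋀^Fin a]→L[ℝ] ℝ}
    (hα : VanishesToOrder H k α) : VanishesToOrder H k (JetForms.castDeg h α) := by
  subst h; exact hα

theorem VanishesToOrder.iterWedge {e d l : ℕ} (s : ℕ) {η : Fin s → E [⋀^Fin e]→L[ℝ] ℝ}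
    {φ : E [⋀^Fin d]→L[ℝ] ℝ} (hη : ∀ a, VanishesToOrder H 1 (η a)) (hφ : VanishesToOrder H l φ) :
    VanishesToOrder H (s + l) (JetForms.iterWedge s η φ) := by
  induction s with
  | zero => rw [zero_add]; exact hφ.castDeg _
  | succ s ih =>
    have h : VanishesToOrder H (1 + (s + l)) (JetForms.iterWedge (s + 1) η φ) :=
      (hη 0).wedge _ (ih fun a => hη a.succ)
    rwa [← add_assoc, add_comm 1 s] at h

end

/-- Each term is a product of `q - n + 1` factors vanishing on the holonomic plane, while at most
`q - n` arguments lie outside it. -/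
theorem vanishesOnHolonomic_contactSum (hq : n + 1 ≤ q) (z : JetCoord n m r) (Φ : Coeffs n m r) :
    VanishesOnHolonomic (q - n) z (contactSum hq z Φ) := by
  intro u hu w _ hw
  subst hu
  have hone : ∀ (e : ℕ) (η : JetCoord n m r [⋀^Fin e]→L[ℝ] ℝ),
      (∀ v : Fin e → EuclideanSpace ℝ (Fin n), η (fun i => totalLift u (v i)) = 0) →
      VanishesToOrder (Set.range (totalLift u)) 1 η := by
    intro e η h v hv
    have : IsEmpty {i // v i ∉ Set.range (totalLift u)} :=
      Finite.card_eq_zero_iff.mp (by omega)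
    have h' : ∀ i, ∃ x, totalLift u x = v i := fun i => by
      by_contra h
      exact this.false ⟨i, h⟩
    choose x hx using h'
    rw [← h x]
    congr 1
    exact funext fun i => (hx i).symm
  have hcard : Nat.card {i // w i ∉ Set.range (totalLift u)} < q - n + 1 := by
    have hinj : Function.Injective (fun i : {i // w i ∉ Set.range (totalLift u)} =>
        (⟨i.1, by
          by_contra h
          obtain ⟨v, hv⟩ := hw i.1 (not_lt.mp h)
          exact i.2 ⟨v, hv.symm⟩⟩ : Fin (q - n))) := fun i j h => by
      have := Fin.mk.inj h
      exact Subtype.ext (Fin.ext this)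
    have := Nat.card_le_card_of_injective _ hinj
    rw [Nat.card_fin] at this
    omega
  rw [contactSum_apply]
  simp only [ContinuousAlternatingMap.sum_apply]
  refine Finset.sum_eq_zero fun ps _ => Finset.sum_eq_zero fun J _ =>
    Finset.sum_eq_zero fun I _ => ?_
  have hps := Finset.HasAntidiagonal.mem_antidiagonal.mp (Finset.mem_filter.mp ps.2).1
  have h := VanishesToOrder.iterWedge ps.1.1
    (fun a => hone 1 (omega (J a).1 (J a).2 (jetProj n m r u)) (omega_totalLift _ _ u))
    (VanishesToOrder.iterWedge ps.1.2
      (fun b => hone 2 (extDeriv (omega (I b).1 (I b).2.toLow) (jetProj n m r u))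
        (extDeriv_omega_totalLift _ _ _ u))
      (l := 0) (φ := Φ ps.1.1 ps.1.2 J I) fun w hw => absurd hw (Nat.not_lt_zero _))
  rw [add_zero, hps] at h
  exact h.castDeg _ w hcard

end Jets

/-! ### Iterated partial derivatives -/

section Calculus

variable {n : ℕ} {f g : EuclideanSpace ℝ (Fin n) → ℝ} {U : Set (EuclideanSpace ℝ (Fin n))}

theorem partialD_contDiffOn (hU : IsOpen U) (hf : ContDiffOn ℝ ∞ f U)
    (i : Fin n) : ContDiffOn ℝ ∞ (partialD i f) U :=
  (hf.fderiv_of_isOpen hU (m := ∞) (by simp)).clm_apply contDiffOn_const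

theorem foldr_partialD_contDiffOn (hU : IsOpen U)
    (hf : ContDiffOn ℝ ∞ f U) (l : List (Fin n)) : ContDiffOn ℝ ∞ (l.foldr partialD f) U := by
  induction l with
  | nil => exact hf
  | cons i l ih => exact partialD_contDiffOn hU ih i

theorem partialD_eqOn (hU : IsOpen U) (h : Set.EqOn f g U) (i : Fin n) :
    Set.EqOn (partialD i f) (partialD i g) U := fun a ha => by
  have : f =ᶠ[nhds a] g := Filter.eventuallyEq_of_mem (hU.mem_nhds ha) h
  rw [partialD, partialD, this.fderiv_eq]

theorem foldr_partialD_eqOn (hU : IsOpen U) (h : Set.EqOn f g U)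
    (l : List (Fin n)) : Set.EqOn (l.foldr partialD f) (l.foldr partialD g) U := by
  induction l with
  | nil => exact h
  | cons i l ih => exact partialD_eqOn hU ih i

theorem partialD_comm (hU : IsOpen U) (hf : ContDiffOn ℝ ∞ f U)
    (i j : Fin n) : Set.EqOn (partialD i (partialD j f)) (partialD j (partialD i f)) U := by
  intro a ha
  have hfa : ContDiffAt ℝ ∞ f a := hf.contDiffAt (hU.mem_nhds ha)
  have hd : DifferentiableAt ℝ (fderiv ℝ f) a :=
    ((hf.fderiv_of_isOpen hU (m := 1) (by norm_cast)).contDiffAt (hU.mem_nhds ha)).differentiableAt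
      (by simp)
  have key : ∀ i j, partialD i (partialD j f) a =
      fderiv ℝ (fderiv ℝ f) a (EuclideanSpace.single i 1) (EuclideanSpace.single j 1) := by
    intro i j
    have := (hd.hasFDerivAt.clm_apply
      (hasFDerivAt_const (EuclideanSpace.single j (1 : ℝ)) a)).fderiv
    rw [partialD]
    change fderiv ℝ (fun b => fderiv ℝ f b (EuclideanSpace.single j 1)) a _ = _
    rw [this]
    simp
  rw [key, key]
  exact (hfa.isSymmSndFDerivAt (by simp; norm_cast)).eq _ _

theorem foldr_partialD_perm (hU : IsOpen U) (hf : ContDiffOn ℝ ∞ f U)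
    {l l' : List (Fin n)} (h : l.Perm l') :
    Set.EqOn (l.foldr partialD f) (l'.foldr partialD f) U := by
  induction h with
  | nil => exact fun _ _ => rfl
  | cons i _ ih => exact partialD_eqOn hU ih i
  | swap i j l => exact partialD_comm hU (foldr_partialD_contDiffOn hU hf l) j i
  | trans _ _ h1 h2 => exact h1.trans h2

theorem partialD_partialDs (hU : IsOpen U) (hf : ContDiffOn ℝ ∞ f U)
    (i : Fin n) (J : Multiset (Fin n)) {a : EuclideanSpace ℝ (Fin n)} (ha : a ∈ U) :
    partialD i (partialDs J f) a = partialDs (i ::ₘ J) f a := by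
  have hp : (i :: J.sort (· ≤ ·)).Perm ((i ::ₘ J).sort (· ≤ ·)) := by
    rw [← Multiset.coe_eq_coe, Multiset.sort_eq, ← Multiset.cons_coe, Multiset.sort_eq]
  exact foldr_partialD_perm hU hf hp ha

theorem fderiv_partialDs (hU : IsOpen U) (hf : ContDiffOn ℝ ∞ f U)
    (J : Multiset (Fin n)) {a : EuclideanSpace ℝ (Fin n)} (ha : a ∈ U)
    (v : EuclideanSpace ℝ (Fin n)) :
    fderiv ℝ (partialDs J f) a v = ∑ i, partialDs (i ::ₘ J) f a * v i := by
  have hv : v = ∑ i, v i • EuclideanSpace.single i (1 : ℝ) := by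
    ext j; simp [Finset.sum_apply, Pi.single_apply]
  conv_lhs => rw [hv]
  rw [map_sum]
  refine Finset.sum_congr rfl fun i _ => ?_
  rw [map_smul, smul_eq_mul, mul_comm, ← partialD_partialDs hU hf i J ha]
  rfl

/-- The differential of the jet prolongation of `g` at `a` is the total lift given by the jet of
order `r + 1`. -/
theorem fderiv_jetLift {m : ℕ} (r : ℕ) {g : EuclideanSpace ℝ (Fin n) → EuclideanSpace ℝ (Fin m)}
    (hU : IsOpen U) (hg : ContDiffOn ℝ ∞ g U) {a : EuclideanSpace ℝ (Fin n)} (ha : a ∈ U) :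
    fderiv ℝ (jetLift r g) a = totalLift (jetLift (r + 1) g a) := by
  have hσ : ∀ σ, ContDiffOn ℝ ∞ (fun b => g b σ) U := fun σ =>
    (EuclideanSpace.proj (𝕜 := ℝ) σ).contDiff.comp_contDiffOn hg
  have hd : ∀ p : Fin m × MultiIdx n r,
      DifferentiableAt ℝ (partialDs p.2.1 fun b => g b p.1) a := fun p =>
    ((foldr_partialD_contDiffOn hU (hσ p.1) _).contDiffAt (hU.mem_nhds ha)).differentiableAt
      (by simp)
  have h : HasFDerivAt (jetLift r g) ((ContinuousLinearMap.id ℝ (EuclideanSpace ℝ (Fin n))).prod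
      (ContinuousLinearMap.pi fun p : Fin m × MultiIdx n r =>
        fderiv ℝ (partialDs p.2.1 fun b => g b p.1) a)) a :=
    (hasFDerivAt_id a).prodMk (hasFDerivAt_pi.mpr fun p => (hd p).hasFDerivAt)
  rw [h.fderiv]
  refine ContinuousLinearMap.ext fun v => Prod.ext rfl (funext fun p => ?_)
  rw [totalLift_snd]
  exact fderiv_partialDs hU (hσ p.1) _ ha v

/-! ### Polynomials with a prescribed jet -/

/-- The monomial `∏ (b_i - a_i)` over the indices `i` in `K`. -/
def shiftedMono (a : EuclideanSpace ℝ (Fin n)) (K : Multiset (Fin n))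
    (b : EuclideanSpace ℝ (Fin n)) : ℝ :=
  (K.map fun i => b i - a i).prod

theorem shiftedMono_cons (a : EuclideanSpace ℝ (Fin n)) (j : Fin n) (K : Multiset (Fin n)) :
    shiftedMono a (j ::ₘ K) = fun b => (b j - a j) * shiftedMono a K b := by
  funext b; simp [shiftedMono]

theorem contDiff_shiftedMono (a : EuclideanSpace ℝ (Fin n)) (K : Multiset (Fin n)) :
    ContDiff ℝ ∞ (shiftedMono a K) := by
  induction K using Multiset.induction_on with
  | empty => exact contDiff_const (c := (1 : ℝ))
  | cons j K ih =>
    rw [shiftedMono_cons]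
    exact ((EuclideanSpace.proj (𝕜 := ℝ) j).contDiff.sub contDiff_const).mul ih

theorem partialD_shiftedMono (a : EuclideanSpace ℝ (Fin n)) (i : Fin n) (K : Multiset (Fin n)) :
    partialD i (shiftedMono a K) = (K.count i : ℝ) • shiftedMono a (K.erase i) := by
  funext b
  induction K using Multiset.induction_on with
  | empty =>
    have : shiftedMono a 0 = fun _ => (1 : ℝ) := by funext b; simp [shiftedMono]
    simp [partialD, this]
  | cons j K ih =>
    have h1 : HasFDerivAt (fun b : EuclideanSpace ℝ (Fin n) => b j - a j)
        (EuclideanSpace.proj (𝕜 := ℝ) j) b :=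
      ((EuclideanSpace.proj (𝕜 := ℝ) j).hasFDerivAt).sub_const _
    have h2 := ((contDiff_shiftedMono a K).differentiable (by simp) b).hasFDerivAt
    have h3 : partialD i (shiftedMono a (j ::ₘ K)) b =
        (b j - a j) * partialD i (shiftedMono a K) b +
          shiftedMono a K b * if j = i then 1 else 0 := by
      rw [partialD, shiftedMono_cons, (h1.fun_mul h2).fderiv]
      simp [partialD]
    rw [h3, ih]
    simp only [Pi.smul_apply, smul_eq_mul]
    by_cases h : j = i
    · subst h
      rw [Multiset.count_cons_self, Multiset.erase_cons_head, if_pos rfl]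
      by_cases hj : j ∈ K
      · have : shiftedMono a K b = (b j - a j) * shiftedMono a (K.erase j) b := by
          conv_lhs => rw [← Multiset.cons_erase hj, shiftedMono_cons]
        rw [this]; push_cast; ring
      · rw [Multiset.count_eq_zero_of_notMem hj]; simp
    · rw [Multiset.count_cons_of_ne (Ne.symm h), Multiset.erase_cons_tail _ h, if_neg h,
        shiftedMono_cons]
      ring

theorem foldr_partialD_smul (l : List (Fin n)) (c : ℝ) (f : EuclideanSpace ℝ (Fin n) → ℝ) :
    l.foldr partialD (c • f) = c • l.foldr partialD f := by
  induction l with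
  | nil => rfl
  | cons i l ih =>
    rw [List.foldr_cons, List.foldr_cons, ih]
    funext b
    simp [partialD, fderiv_const_smul_field]

theorem foldr_partialD_sum {ι : Type*} (s : Finset ι) (l : List (Fin n))
    (f : ι → EuclideanSpace ℝ (Fin n) → ℝ)
    (hf : ∀ k, ContDiff ℝ ∞ (f k)) :
    l.foldr partialD (∑ k ∈ s, f k) = ∑ k ∈ s, l.foldr partialD (f k) := by
  induction l with
  | nil => rfl
  | cons i l ih =>
    simp only [List.foldr_cons]
    rw [ih]
    funext b
    have hd : ∀ k ∈ s, DifferentiableAt ℝ (l.foldr partialD (f k)) b := fun k _ =>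
      ((foldr_partialD_contDiffOn isOpen_univ (hf k).contDiffOn l).contDiffAt
        Filter.univ_mem).differentiableAt (by simp)
    rw [Finset.sum_apply, partialD, fderiv_sum hd, sum_apply]
    rfl

theorem foldr_partialD_shiftedMono_of_ne (a : EuclideanSpace ℝ (Fin n)) (l : List (Fin n))
    (K : Multiset (Fin n)) (h : (l : Multiset (Fin n)) ≠ K) :
    l.foldr partialD (shiftedMono a K) a = 0 := by
  induction l using List.reverseRecOn generalizing K with
  | nil =>
    obtain ⟨i, hi⟩ := Multiset.exists_mem_of_ne_zero (Ne.symm h)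
    exact Multiset.prod_eq_zero (Multiset.mem_map.mpr ⟨i, hi, sub_self _⟩)
  | append_singleton l i ih =>
    rw [List.foldr_append, List.foldr_cons, List.foldr_nil, partialD_shiftedMono,
      foldr_partialD_smul, Pi.smul_apply]
    by_cases hi : i ∈ K
    · rw [ih _ fun h' => h ?_, smul_zero]
      rw [← Multiset.cons_erase hi, ← h', Multiset.cons_coe, Multiset.coe_eq_coe]
      exact List.perm_append_singleton i l
    · rw [Multiset.count_eq_zero_of_notMem hi, Nat.cast_zero, zero_smul]

theorem foldr_partialD_shiftedMono_ne_zero (a : EuclideanSpace ℝ (Fin n)) (l : List (Fin n)) :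
    l.foldr partialD (shiftedMono a l) a ≠ 0 := by
  induction l using List.reverseRecOn with
  | nil => simp [shiftedMono]
  | append_singleton l i ih =>
    have h : ((l ++ [i] : List (Fin n)) : Multiset (Fin n)) = i ::ₘ l := by
      rw [Multiset.cons_coe, Multiset.coe_eq_coe]
      exact List.perm_append_singleton i l
    rw [List.foldr_append, List.foldr_cons, List.foldr_nil, partialD_shiftedMono,
      foldr_partialD_smul, Pi.smul_apply, h, Multiset.erase_cons_head, Multiset.count_cons_self]
    exact smul_ne_zero (by positivity) ih

/-- The Taylor polynomial with prescribed derivatives. The numbers `d K` are the derivatives of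
order `K` of the monomials with exponent `K`. -/
theorem exists_jetLift_eq {m : ℕ} (r : ℕ) (u : JetCoord n m r) :
    ∃ g : EuclideanSpace ℝ (Fin n) → EuclideanSpace ℝ (Fin m),
      ContDiff ℝ ∞ g ∧ jetLift r g u.1 = u := by
  let d : MultiIdx n r → ℝ := fun K => partialDs K.1 (shiftedMono u.1 K.1) u.1
  have hd : ∀ K, d K ≠ 0 := fun K => by
    have := foldr_partialD_shiftedMono_ne_zero u.1 (K.1.sort (· ≤ ·))
    rwa [Multiset.sort_eq] at this
  let g : Fin m → EuclideanSpace ℝ (Fin n) → ℝ := fun σ =>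
    ∑ K, (u.2 (σ, K) / d K) • shiftedMono u.1 K.1
  have hs : ∀ σ K, ContDiff ℝ ∞ ((u.2 (σ, K) / d K) • shiftedMono u.1 K.1) := fun σ K =>
    contDiff_const.smul (contDiff_shiftedMono u.1 K.1)
  refine ⟨fun b => WithLp.toLp 2 fun σ => g σ b, ?_, Prod.ext rfl (funext fun p => ?_)⟩
  · rw [contDiff_euclidean]
    intro σ
    have : ContDiff ℝ ∞ (fun b => ∑ K, ((u.2 (σ, K) / d K) • shiftedMono u.1 K.1) b) :=
      ContDiff.sum fun K _ => hs σ K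
    simpa [g, Finset.sum_apply] using this
  · change partialDs p.2.1 (g p.1) u.1 = u.2 p
    rw [partialDs, foldr_partialD_sum _ _ _ (hs p.1), Finset.sum_apply]
    simp only [foldr_partialD_smul, Pi.smul_apply]
    rw [Finset.sum_eq_single p.2]
    · exact div_mul_cancel₀ _ (hd p.2)
    · intro K _ hK
      rw [foldr_partialD_shiftedMono_of_ne, smul_zero]
      rw [Multiset.sort_eq]
      exact fun h => hK (Subtype.ext h.symm)
    · simp

end Calculus

/-! ### Jets of sections in an adapted chart -/

section Manifold

variable {n m : ℕ} {X Y : Type*} [TopologicalSpace X] [TopologicalSpace Y]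
  [ChartedSpace (EuclideanSpace ℝ (Fin n)) X] [ChartedSpace (EuclideanSpace ℝ (Fin (n + m))) Y]
  {π : Y → X} (ψ : AdaptedChart n m π)

theorem jetChart_mk (r : ℕ) {p : PointedSection n m π} (hp : p.value ∈ ψ.toY.source) :
    ψ.jetChart r (Jet.mk r p) = ψ.sectionCoord r p := by
  exact if_pos hp

theorem mem_jetTarget {r : ℕ} {z : JetCoord n m r} :
    z ∈ ψ.jetTarget r ↔
      ∃ p : PointedSection n m π, p.value ∈ ψ.toY.source ∧ ψ.sectionCoord r p = z := by
  constructor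
  · rintro ⟨j, hj, rfl⟩
    obtain ⟨p, rfl⟩ := Quotient.exists_rep j
    exact ⟨p, hj, (jetChart_mk ψ r hj).symm⟩
  · rintro ⟨p, hp, rfl⟩
    exact ⟨Jet.mk r p, hp, jetChart_mk ψ r hp⟩

theorem jetProj_sectionCoord (r : ℕ) (p : PointedSection n m π) :
    jetProj n m r (ψ.sectionCoord (r + 1) p) = ψ.sectionCoord r p := rfl

variable {ψ} in
theorem base_mem_source {p : PointedSection n m π} (hp : p.value ∈ ψ.toY.source) :
    p.1.2 ∈ ψ.toX.source := by
  rw [ψ.source_toX]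
  exact ⟨p.value, hp, p.1.1.section_eq _ p.2⟩

/-- The representative of a section in an adapted chart is smooth near its base point. -/
theorem exists_contDiffOn_rep {p : PointedSection n m π} (hp : p.value ∈ ψ.toY.source) :
    ∃ U : Set (EuclideanSpace ℝ (Fin n)), IsOpen U ∧ ψ.toX p.1.2 ∈ U ∧
      ContDiffOn ℝ ∞ (ψ.rep p.1.1) U := by
  have hx := base_mem_source hp
  let W : Set X := p.1.1.dom ∩ p.1.1.toFun ⁻¹' ψ.toY.source
  have hW : IsOpen W :=
    p.1.1.smooth.continuousOn.isOpen_inter_preimage p.1.1.isOpen_dom ψ.toY.open_source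
  refine ⟨ψ.toX.target ∩ ψ.toX.symm ⁻¹' W, ψ.toX.isOpen_inter_preimage_symm hW,
    ⟨ψ.toX.map_source hx, ?_⟩, ?_⟩
  · rw [Set.mem_preimage, ψ.toX.left_inv hx]
    exact ⟨p.2, hp⟩
  · rw [← contMDiffOn_iff_contDiffOn]
    have h1 : ContMDiffOn (𝓡 n) (𝓡 (n + m)) ∞ (fun a => p.1.1.toFun (ψ.toX.symm a))
        (ψ.toX.target ∩ ψ.toX.symm ⁻¹' W) :=
      p.1.1.smooth.comp (ψ.smooth_toX_symm.mono Set.inter_subset_left) fun a ha => ha.2.1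
    have h2 : ContMDiffOn (𝓡 n) 𝓘(ℝ, EuclideanSpace ℝ (Fin n) × EuclideanSpace ℝ (Fin m)) ∞
        (fun a => ψ.toY (p.1.1.toFun (ψ.toX.symm a))) (ψ.toX.target ∩ ψ.toX.symm ⁻¹' W) :=
      ψ.smooth_toY.comp h1 fun a ha => ha.2.2
    rw [contMDiffOn_iff_contDiffOn] at h2 ⊢
    exact contDiff_snd.comp_contDiffOn h2

theorem horizontal_eq (r : ℕ) {p : PointedSection n m π} (hp : p.value ∈ ψ.toY.source) :
    ψ.horizontal r p =
      (totalLift (ψ.sectionCoord (r + 1) p)).comp (ContinuousLinearMap.fst ℝ _ _) := by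
  obtain ⟨U, hU, ha, h⟩ := exists_contDiffOn_rep ψ hp
  rw [AdaptedChart.horizontal, fderiv_jetLift r hU h ha]
  rfl

/-- Every jet of order `r` of a section can be extended to a jet of order `r + 1` with prescribed
components of order `r + 1`, by a section which is a polynomial in the chart. -/
theorem exists_sectionCoord_eq {r : ℕ} {z : JetCoord n m r} (hz : z ∈ ψ.jetTarget r)
    {u : JetCoord n m (r + 1)} (hu : jetProj n m r u = z) :
    ∃ p : PointedSection n m π, p.value ∈ ψ.toY.source ∧ ψ.sectionCoord (r + 1) p = u := by
  obtain ⟨p₀, hp₀, rfl⟩ := (mem_jetTarget ψ).mp hz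
  obtain ⟨g, hg, hgu⟩ := exists_jetLift_eq (r + 1) u
  have hx := base_mem_source hp₀
  have hu1 : u.1 = ψ.toX p₀.1.2 := congrArg Prod.fst hu
  have hval : (u.1, g u.1) = ψ.toY p₀.value := by
    refine Prod.ext ?_ ?_
    · rw [ψ.fst_toY _ hp₀, hu1]
      exact congrArg ψ.toX (p₀.1.1.section_eq _ p₀.2).symm
    · ext σ
      have h1 := congrFun (congrArg Prod.snd hgu) (σ, ⟨0, Nat.zero_le _⟩)
      have h2 := congrFun (congrArg Prod.snd hu) (σ, ⟨0, Nat.zero_le _⟩)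
      have h3 : u.2 (σ, ⟨0, Nat.zero_le _⟩) = ψ.rep p₀.1.1 (ψ.toX p₀.1.2) σ := by
        refine h2.trans ?_
        simp [AdaptedChart.sectionCoord, jetLift, partialDs]
      have h4 : g u.1 σ = u.2 (σ, ⟨0, Nat.zero_le _⟩) := by
        rw [← h1]
        simp [jetLift, partialDs]
      change g u.1 σ = (ψ.toY p₀.value).2 σ
      rw [h4, h3, AdaptedChart.rep, ψ.toX.left_inv hx]
      rfl
  let G : EuclideanSpace ℝ (Fin n) → EuclideanSpace ℝ (Fin n) × EuclideanSpace ℝ (Fin m) :=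
    fun a => (a, g a)
  have hG : ContDiff ℝ ∞ G := contDiff_id.prodMk hg
  have hO : IsOpen (G ⁻¹' ψ.toY.target) := ψ.toY.open_target.preimage hG.continuous
  let γ : LocalSection n m π :=
    { toFun := fun x => ψ.toY.symm (G (ψ.toX x))
      dom := ψ.toX.source ∩ ψ.toX ⁻¹' (G ⁻¹' ψ.toY.target)
      isOpen_dom := ψ.toX.isOpen_inter_preimage hO
      smooth := by
        have h1 : ContMDiffOn (𝓡 n) 𝓘(ℝ, EuclideanSpace ℝ (Fin n) × EuclideanSpace ℝ (Fin m)) ∞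
            (fun x => G (ψ.toX x)) (ψ.toX.source ∩ ψ.toX ⁻¹' (G ⁻¹' ψ.toY.target)) :=
          hG.contMDiff.comp_contMDiffOn (ψ.smooth_toX.mono Set.inter_subset_left)
        exact ψ.smooth_toY_symm.comp h1 fun x hx => hx.2
      section_eq := fun x hx => by
        have hmem := ψ.toY.map_target hx.2
        have h1 := ψ.fst_toY _ hmem
        rw [ψ.toY.right_inv hx.2] at h1
        refine ψ.toX.injOn ?_ hx.1 h1.symm
        rw [ψ.source_toX]
        exact ⟨_, hmem, rfl⟩ }
  have hdom : p₀.1.2 ∈ γ.dom := by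
    refine ⟨hx, ?_⟩
    change (ψ.toX p₀.1.2, g (ψ.toX p₀.1.2)) ∈ ψ.toY.target
    rw [← hu1, hval]
    exact ψ.toY.map_source hp₀
  refine ⟨⟨(γ, p₀.1.2), hdom⟩, ψ.toY.map_target hdom.2, ?_⟩
  have hrep : Set.EqOn (ψ.rep γ) g (ψ.toX.target ∩ G ⁻¹' ψ.toY.target) := by
    intro b hb
    change (ψ.toY (ψ.toY.symm (G (ψ.toX (ψ.toX.symm b))))).2 = g b
    rw [ψ.toX.right_inv hb.1, ψ.toY.right_inv hb.2]
  have ha : u.1 ∈ ψ.toX.target ∩ G ⁻¹' ψ.toY.target := by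
    rw [hu1]
    exact ⟨ψ.toX.map_source hx, hdom.2⟩
  rw [AdaptedChart.sectionCoord]
  change jetLift (r + 1) (ψ.rep γ) (ψ.toX p₀.1.2) = u
  rw [← hu1]
  refine Eq.trans (b := jetLift (r + 1) g u.1) (Prod.ext rfl (funext fun q => ?_)) hgu
  exact foldr_partialD_eqOn (ψ.toX.open_target.inter hO)
    (fun b hb => congrArg (fun y => y q.1) (hrep hb)) _ ha

/-! ### Strongly contact forms -/

theorem jetProj_surjective (r : ℕ) : Function.Surjective (jetProj n m r) := by
  intro z
  refine ⟨(z.1, fun p => if h : Multiset.card p.2.1 ≤ r then z.2 (p.1, ⟨p.2.1, h⟩) else 0),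
    Prod.ext rfl (funext fun p => ?_)⟩
  have := p.2.2
  simp [jetProj, this]

variable {r q : ℕ} (ρ : JetForm n m r q π)

/-- For the contact component the values on vertical and horizontal vectors suffice, and every
holonomic plane is tangent to a section. -/
theorem isStronglyContactOn_iff :
    ρ.IsStronglyContactOn ψ ↔
      ∀ z ∈ ψ.jetTarget r, VanishesOnHolonomic (q - n) z (ρ.rep ψ z) := by
  constructor
  · intro h z hz u hu w hw hw'
    obtain ⟨p, hp, hpu⟩ := exists_sectionCoord_eq ψ hz hu
    choose ξ hξ using fun i => jetProj_surjective (n := n) (m := m) r (w i)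
    have hfst : ∀ i, (ξ i).1 = (w i).1 := fun i => congrArg Prod.fst (hξ i)
    have hh : ∀ i, ψ.horizontal r p (ξ i) = if (i : ℕ) < q - n then 0 else w i := by
      intro i
      rw [horizontal_eq ψ r hp, hpu, ContinuousLinearMap.comp_apply, ContinuousLinearMap.coe_fst',
        hfst]
      split_ifs with hi
      · rw [hw i hi, map_zero]
      · obtain ⟨v, hv⟩ := hw' i (not_lt.mp hi)
        rw [hv]
        rfl
    have hv : ∀ i, ψ.vertical r p (ξ i) = if (i : ℕ) < q - n then w i else 0 := by
      intro i
      rw [AdaptedChart.vertical, sub_apply, hξ, hh]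
      split_ifs <;> simp
    have h0 := h p hp ξ
    rw [JetForm.contactComponent, jetChart_mk ψ r hp, ← jetProj_sectionCoord, hpu, hu] at h0
    have h1 := (mul_eq_zero.mp h0).resolve_left (by positivity)
    -- Only the permutations preserving the set of the first `q - n` indices contribute, all by the
    -- same amount.
    have h2 : ∀ τ : Equiv.Perm (Fin q), ((Equiv.Perm.sign τ : ℤ) : ℝ) *
        ρ.rep ψ z (fun i : Fin q => if (i : ℕ) < q - n then ψ.vertical r p (ξ (τ i))
          else ψ.horizontal r p (ξ (τ i))) =
        if ∀ i : Fin q, (i : ℕ) < q - n ↔ (τ i : ℕ) < q - n then ρ.rep ψ z w else 0 := by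
      intro τ
      split_ifs with hτ
      · have e : (fun i : Fin q => if (i : ℕ) < q - n then ψ.vertical r p (ξ (τ i))
            else ψ.horizontal r p (ξ (τ i))) = w ∘ τ := by
          funext i
          by_cases hi : (i : ℕ) < q - n
          · rw [if_pos hi, hv, if_pos ((hτ i).mp hi)]; rfl
          · rw [if_neg hi, hh, if_neg fun h => hi ((hτ i).mpr h)]; rfl
        rw [e]
        have := (ρ.rep ψ z).toAlternatingMap.map_perm w τ
        change _ * (ρ.rep ψ z).toAlternatingMap (w ∘ τ) = (ρ.rep ψ z).toAlternatingMap w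
        rw [this]
        rcases Int.units_eq_one_or (Equiv.Perm.sign τ) with hs | hs <;> simp [hs]
      · push Not at hτ
        obtain ⟨i, hi⟩ := hτ
        refine mul_eq_zero_of_right _ ((ρ.rep ψ z).map_coord_zero i ?_)
        rcases hi with ⟨h1, h2⟩ | ⟨h1, h2⟩
        · rw [if_pos h1, hv, if_neg (not_lt.mpr h2)]
        · rw [if_neg (not_lt.mpr h1), hh, if_pos h2]
    rw [Finset.sum_congr rfl fun τ _ => h2 τ, ← Finset.sum_filter, Finset.sum_const,
      nsmul_eq_mul] at h1
    refine (mul_eq_zero.mp h1).resolve_left ?_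
    exact Nat.cast_ne_zero.mpr (Finset.card_ne_zero_of_mem
      (Finset.mem_filter.mpr ⟨Finset.mem_univ 1, fun i => Iff.rfl⟩))
  · intro h p hp ξ
    rw [JetForm.contactComponent, jetChart_mk ψ r hp]
    refine mul_eq_zero_of_right _ (Finset.sum_eq_zero fun τ _ => mul_eq_zero_of_right _ ?_)
    refine h _ ((mem_jetTarget ψ).mpr ⟨p, hp, rfl⟩) _ (jetProj_sectionCoord ψ r p) _
      (fun i hi => ?_) fun i hi => ?_
    · rw [if_pos hi, AdaptedChart.vertical, horizontal_eq ψ r hp]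
      exact sub_self _
    · rw [if_neg (not_lt.mpr hi), horizontal_eq ψ r hp]
      exact ⟨_, rfl⟩

theorem isStronglyContactOn_iff_hasContactExpression (hq : n + 1 ≤ q) :
    ρ.IsStronglyContactOn ψ ↔ ρ.HasContactExpression hq ψ := by
  rw [isStronglyContactOn_iff]
  constructor
  · exact fun h => exists_contactSum hq (ρ.smooth ψ) h
  · rintro ⟨Φ, -, h⟩ z hz
    rw [h z hz]
    exact vanishesOnHolonomic_contactSum hq z fun p s J I => Φ p s J I z

end Manifold

end JetForms

end

theorem mainTheorem4 (n m r q : ℕ) (hq : n + 1 ≤ q)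
    {X Y : Type*} [TopologicalSpace X] [TopologicalSpace Y]
    [ChartedSpace (EuclideanSpace ℝ (Fin n)) X] [IsManifold (𝓡 n) ∞ X]
    [ChartedSpace (EuclideanSpace ℝ (Fin (n + m))) Y] [IsManifold (𝓡 (n + m)) ∞ Y]
    (π : Y → X) (_hπ : JetForms.IsFibredManifold n m π) (ρ : JetForms.JetForm n m r q π) :
    (∀ ψ : JetForms.AdaptedChart n m π,
      ρ.IsStronglyContactOn ψ ↔ ρ.HasContactExpression hq ψ) ∧
    (ρ.IsStronglyContact ↔
      ∀ ψ : JetForms.AdaptedChart n m π, ρ.HasContactExpression hq ψ) :=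
  ⟨fun ψ => JetForms.isStronglyContactOn_iff_hasContactExpression ψ ρ hq,
    forall_congr' fun ψ => JetForms.isStronglyContactOn_iff_hasContactExpression ψ ρ hq⟩
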